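/- Let $N\ge 1$ be an integer, and let $(r,p)$ be an admissible pair, i.e. $\frac2r+\frac Np=\frac N2$ and $2\le p\le \frac{2N}{N-2}$ ($2\le p<\infty$ if $N=2$, $2\le p\le\infty$ if $N=1$). Assume moreover that $p<\infty$ and $r>2$. Let $1\le q\le\infty$ and $\frac r2<\sigma<\infty$, and define $\tilde\sigma$ by $\frac1{\tilde\sigma}+\frac1\sigma=\frac2r$. Primes denote conjugate exponents, $L^{p,q}=L^{p,q}(\mathbb R^N)$ is the Lorentz space of complex-valued functions, with quasi-norm $\|\varphi\|_{L^{p,q}}=p^{1/q}\,\big\|\lambda\,|\{|\varphi|>\lambda\}|^{1/p}\big\|_{L^q((0,\infty),\,d\lambda/\lambda)}$, and $L^a(0,T;X)$ is the Bochner space of strongly measurable $X$-valued functions on $(0,T)$. Let $e^{it\Delta}$ be the free Schrödinger group on tempered distributions, i.e. the Fourier multiplier with symbol $e^{-it|2\pi\xi|^2}$ (for the Fourier transform $\int e^{-2\pi i x\cdot\xi}u(x)\,dx$). Then there is a constant $C=C(N,p,q,\sigma)>0$ such that for every $0<T\le\infty$ and every $f\in L^{\tilde\sigma'}(0,T;L^{p',q})$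 the following holds. For every $t\in[0,T)$ the integral $$\mathcal F(f)(t)=\int_0^t e^{i(t-s)\Delta}f(s)\,ds$$ converges absolutely as a weak integral in the space $\mathcal S'(\mathbb R^N)$ of tempered distributions (i.e. when tested against any Schwartz function), one has $\mathcal F(f)\in L^{\sigma}(0,T;L^{p,q})$ (i.e. some $u\in L^{\sigma}(0,T;L^{p,q})$ satisfies $u(t)=\mathcal F(f)(t)$ in $\mathcal S'$ for almost every $t\in(0,T)$), and $$\|\mathcal F(f)\|_{L^{\sigma}(0,T;L^{p,q})}\le C\,\|f\|_{L^{\tilde\sigma'}(0,T;L^{p',q})}.$$ -/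

import Mathlib

open MeasureTheory Set Filter Topology
open scoped ENNReal SchwartzMap

noncomputable section

namespace NLS

/-- The Euclidean space `ℝ^N`. -/
abbrev Space (N : ℕ) : Type := EuclideanSpace ℝ (Fin N)

/-- Complex-valued measurable functions on `ℝ^N` modulo equality almost everywhere. -/
abbrev Fn (N : ℕ) : Type := Space N →ₘ[(volume : Measure (Space N))] ℂ

/-- Schrödinger-admissible pairs `(r, p)` in dimension `N`: `2/r + N/p = N/2` and
`2 ≤ p ≤ 2N/(N-2)` (`2 ≤ p < ∞` if `N = 2`, `2 ≤ p ≤ ∞` if `N = 1`). -/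
structure Admissible (N : ℕ) (r p : ℝ≥0∞) : Prop where
  scaling : 2 / r + (N : ℝ≥0∞) / p = (N : ℝ≥0∞) / 2
  two_le : 2 ≤ p
  lt_top_of_two : N = 2 → p < ∞
  le_of_three_le : 3 ≤ N → p ≤ 2 * (N : ℝ≥0∞) / ((N : ℝ≥0∞) - 2)

/-! ### Lorentz spaces -/

/-- The measure `dλ/λ` on `(0, ∞)`. -/
def haarPos : Measure ℝ :=
  (volume.restrict (Ioi (0 : ℝ))).withDensity fun l => ENNReal.ofReal l⁻¹

/-- The distribution function `λ ↦ |{x : |φ x| > λ}|`. -/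
def distFun {N : ℕ} (φ : Fn N) (l : ℝ) : ℝ≥0∞ := volume {x : Space N | l < ‖φ x‖}

/-- The Lorentz quasi-norm
`‖φ‖_{L^{p,q}} = p^{1/q} ‖λ |{|φ| > λ}|^{1/p}‖_{L^q((0,∞), dλ/λ)}`, for `0 < p < ∞` and
`0 < q ≤ ∞` (so `sup_{λ>0} λ |{|φ| > λ}|^{1/p}` if `q = ∞`).  It equals
`‖t^{1/p} φ*(t)‖_{L^q((0,∞), dt/t)}`, where `φ*` is the decreasing rearrangement.  The function
`φ` belongs to `L^{p,q}` iff the value is finite. -/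
def lorentzNorm {N : ℕ} (p q : ℝ≥0∞) (φ : Fn N) : ℝ≥0∞ :=
  p ^ (1 / q.toReal) *
    eLpNorm (fun l : ℝ => ENNReal.ofReal l * distFun φ l ^ (1 / p.toReal)) q haarPos

/-! ### The spaces `L^a(0, T; L^{p,q}(ℝ^N))` -/

/-- The open time interval `(0, T)`, `0 < T ≤ ∞`. -/
def timeInterval (T : EReal) : Set ℝ := {t : ℝ | 0 < t ∧ (t : EReal) < T}

/-- The norm of `L^a(0, T; L^{p,q}(ℝ^N))`: the `L^a(0, T)` norm of `t ↦ ‖f(t)‖_{L^{p,q}}`. -/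
def bochnerNorm {N : ℕ} (a : ℝ≥0∞) (T : EReal) (p q : ℝ≥0∞) (f : ℝ → Fn N) : ℝ≥0∞ :=
  eLpNorm (fun t => lorentzNorm p q (f t)) a (volume.restrict (timeInterval T))

/-- Membership in the Bochner space `L^a(0, T; L^{p,q}(ℝ^N))`: `f` is strongly measurable as an
`L^{p,q}`-valued map on `(0, T)`, i.e. almost everywhere the limit in `L^{p,q}` of simple functions
with values in `L^{p,q}`, and its norm is finite. -/
structure MemBochner {N : ℕ} (a : ℝ≥0∞) (T : EReal) (p q : ℝ≥0∞) (f : ℝ → Fn N) : Prop where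
  stronglyMeasurable : ∃ S : ℕ → SimpleFunc ℝ (Fn N),
    (∀ n t, lorentzNorm p q (S n t) < ∞) ∧
    ∀ᵐ t ∂(volume.restrict (timeInterval T)),
      Tendsto (fun n => lorentzNorm p q (f t - S n t)) atTop (𝓝 0)
  norm_lt_top : bochnerNorm a T p q f < ∞

/-! ### The free Schrödinger group and the Duhamel operator -/

/-- The symbol `exp(-i t |2πξ|²)` of `e^{itΔ}`, in the normalization
`𝓕 u (ξ) = ∫ exp(-2πi x·ξ) u(x) dx` of the Fourier transform. -/
def schrodingerSymbol (N : ℕ) (t : ℝ) (ξ : Space N) : ℂ :=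
  Complex.exp (((-(t * (2 * Real.pi) ^ 2 * ‖ξ‖ ^ 2) : ℝ) : ℂ) * Complex.I)

/-- The free Schrödinger group `e^{itΔ}` on tempered distributions. -/
def schrodinger (N : ℕ) (t : ℝ) : 𝓢'(Space N, ℂ) →L[ℂ] 𝓢'(Space N, ℂ) :=
  TemperedDistribution.fourierMultiplierCLM ℂ (schrodingerSymbol N t)

/-- The functional `L` on Schwartz functions is integration against the function `φ`. -/
def Represents {N : ℕ} (φ : Fn N) (L : 𝓢(Space N, ℂ) → ℂ) : Prop :=
  ∀ ψ : 𝓢(Space N, ℂ), Integrable (fun x => ψ x * φ x) ∧ L ψ = ∫ x, ψ x * φ x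

open Classical in
/-- The tempered distribution `ψ ↦ ∫ ψ φ` given by a function `φ` (zero if `φ` is not a tempered
distribution; the functions of `L^{p,q}`, `1 < p < ∞`, `1 ≤ q ≤ ∞`, all are). -/
def toTempered {N : ℕ} (φ : Fn N) : 𝓢'(Space N, ℂ) :=
  if h : ∃ Φ : 𝓢'(Space N, ℂ), Represents φ Φ then h.choose else 0

/-- The integrand `s ↦ ⟨e^{i(t-s)Δ} f(s), ψ⟩` of the Duhamel operator, tested against `ψ`. -/
def duhamelIntegrand {N : ℕ} (f : ℝ → Fn N) (t : ℝ) (ψ : 𝓢(Space N, ℂ)) (s : ℝ) : ℂ :=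
  schrodinger N (t - s) (toTempered (f s)) ψ

/-- The Duhamel operator `𝓕(f)(t) = ∫_0^t e^{i(t-s)Δ} f(s) ds`, as an integral with values in
tempered distributions. -/
def duhamel {N : ℕ} (f : ℝ → Fn N) (t : ℝ) (ψ : 𝓢(Space N, ℂ)) : ℂ :=
  ∫ s in (0 : ℝ)..t, duhamelIntegrand f t ψ s

theorem toTempered_eq {N : ℕ} {φ : Fn N} {Φ : 𝓢'(Space N, ℂ)} (h : Represents φ Φ) :
    toTempered φ = Φ := by
  have h' : ∃ Φ : 𝓢'(Space N, ℂ), Represents φ Φ := ⟨Φ, h⟩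
  rw [toTempered, dif_pos h']
  ext ψ
  rw [(h'.choose_spec ψ).2, (h ψ).2]

theorem expI_hasTemperateGrowth : (fun x : ℝ => Complex.exp ((x:ℂ) * Complex.I)).HasTemperateGrowth := by
  have hd : ∀ n : ℕ, iteratedDeriv n (fun x : ℝ => Complex.exp ((x:ℂ) * Complex.I)) =
      fun x : ℝ => Complex.I ^ n * Complex.exp ((x:ℂ) * Complex.I) := by
    intro n
    induction n with
    | zero => simp
    | succ n ih =>
      rw [iteratedDeriv_succ, ih]
      funext x
      have h1 : HasDerivAt (fun x : ℝ => Complex.exp ((x:ℂ) * Complex.I))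
          (Complex.exp ((x:ℂ) * Complex.I) * (1 * Complex.I)) x :=
        ((Complex.ofRealCLM.hasDerivAt (x := x)).mul_const Complex.I).cexp
      rw [(h1.const_mul _).deriv]; ring
  refine ⟨?_, fun n => ⟨0, 1, fun x => ?_⟩⟩
  · exact (Complex.ofRealCLM.contDiff.mul contDiff_const).cexp
  · rw [norm_iteratedFDeriv_eq_norm_iteratedDeriv, hd]
    simp [Complex.norm_exp]

/-- The symbol is a Fourier multiplier of tempered distributions. -/
theorem schrodingerSymbol_hasTemperateGrowth (N : ℕ) (t : ℝ) :
    (schrodingerSymbol N t).HasTemperateGrowth := by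
  have h : (fun ξ : Space N => -(t * (2 * Real.pi) ^ 2 * ‖ξ‖ ^ 2)).HasTemperateGrowth := by
    fun_prop
  exact expI_hasTemperateGrowth.comp h

end NLS

end

set_option linter.unusedSectionVars false

noncomputable section

namespace NLS

/-! ### Minkowski's integral inequality and Young's inequality for nonnegative functions. -/

section Minkowski

variable {X B : Type*} [MeasurableSpace X] [MeasurableSpace B] {μ : Measure X} {ν : Measure B}

/-! Two facts give the estimate. One is the fixed-time decay of the L^{p,q} norm of e^{iτΔ}g by C
τ^{-δ} times the L^{p',q} norm of g, where δ = N(1/2 - 1/p) = 2/r by admissibility. The other is the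
Hardy–Littlewood–Sobolev inequality in time (`exists_eLpNorm_fracInt_le`). By Minkowski, the norm of
the Duhamel integral at time t is at most C ∫_0^t (t-s)^{-δ} ‖f(s)‖ ds. Fractional integration then
maps L^{σ̃'} to L^σ because 1/σ̃' = 1 - δ + 1/σ. Here r > 2 is the condition δ < 1, and σ > r/2 is
the condition 1/σ < δ.

The decay is real interpolation between unitarity on L² and the dispersive bound L¹ → L^∞, carried
out by hand. The K-functional of (L¹, L^∞) at scale m is the supremum of ∫ w|φ| over weights 0 ≤ w ≤
1 of mass at most m. It is subadditive, so it gives a true norm equivalent to the Lorentz quasi-norm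
when p > 1 (Hardy's inequality, `kNorm_le_rearrNorm`), and it can be bounded by duality. A test
function ψ with ‖ψ‖₁ ≤ m and ‖ψ‖₂ ≤ √m evolves into a function with L² norm at most √m and supremum
at most τ^{-N/2} m. A Hardy–Littlewood rearrangement argument (`lintegral_mul_le_rearr`) turns these
two bounds into a one-dimensional integral against the rearrangement of g. In logarithmic variables
it becomes a convolution whose kernel has L¹ norm of order τ^{-δ} (`lintegral_dispKernel_le`), so
Young's inequality applies for every q ≥ 1. The Hardy–Littlewood–Sobolev inequality is proved by the
same method.

The Duhamel integral is at first only a functional on Schwartz functions. It is bounded by the L¹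
and L² norms of the test function, hence continuous for a weighted L² norm, and the Riesz theorem
represents it by a function (`exists_isRep`). The duality bound then passes to the K-functional of
that function (`IsRep.kfun_le`). Strong measurability in time comes from approximating f by
continuous compactly supported maps, for which the Duhamel integral is continuous in time
(`aestronglyMeasurable_evolve`). -/

theorem measurable_essSup_of_measurable_uncurry [SFinite μ] {F : X → B → ℝ≥0∞}
    (hF : Measurable (Function.uncurry F)) : Measurable fun b => essSup (fun x => F x b) μ := by
  refine measurable_of_Iic fun c => ?_
  have : (fun b => essSup (fun x => F x b) μ) ⁻¹' Iic c =
      (fun b => μ ((fun x => (x, b)) ⁻¹' {z : X × B | c < Function.uncurry F z})) ⁻¹' {0} := by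
    ext b
    simp only [mem_preimage, mem_Iic, mem_singleton_iff]
    constructor
    · intro h
      have : ∀ᵐ x ∂μ, F x b ≤ c := (ENNReal.ae_le_essSup _).mono fun x hx => hx.trans h
      rw [ae_iff] at this
      simpa using this
    · intro h
      refine essSup_le_of_ae_le _ ?_
      change ∀ᵐ x ∂μ, F x b ≤ c
      rw [ae_iff]
      simpa using h
  rw [this]
  exact (measurable_measure_prodMk_right (measurableSet_lt measurable_const hF))
    (measurableSet_singleton 0)

/-- Write H for the inner integral and H^Q = H^{Q-1} H, exchange the integrals, apply Hölder for
each b, and divide by the resulting power of ∫ H^Q. -/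
theorem lintegral_rpow_lintegral_le [SigmaFinite μ] [SFinite ν] {F : X → B → ℝ≥0∞}
    (hF : Measurable (Function.uncurry F)) {Q : ℝ} (hQ : 1 < Q) :
    (∫⁻ x, (∫⁻ b, F x b ∂ν) ^ Q ∂μ) ^ (1 / Q) ≤ ∫⁻ b, (∫⁻ x, F x b ^ Q ∂μ) ^ (1 / Q) ∂ν := by
  have hQ0 : 0 < Q := by linarith
  set M := ∫⁻ b, (∫⁻ x, F x b ^ Q ∂μ) ^ (1 / Q) ∂ν with hM
  set H : X → ℝ≥0∞ := fun x => ∫⁻ b, F x b ∂ν with hH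
  have hHm : Measurable H := hF.lintegral_prod_right'
  -- The division needs a finite integral, so H is truncated in height and support; monotone
  -- convergence restores it at the end.
  let Hn : ℕ → X → ℝ≥0∞ := fun n => (spanningSets μ n).indicator fun x => min (H x) n
  have hHnm : ∀ n, Measurable (Hn n) := fun n =>
    (hHm.min measurable_const).indicator (measurableSet_spanningSets μ n)
  have hHnle : ∀ n x, Hn n x ≤ H x := fun n x => by
    by_cases hx : x ∈ spanningSets μ n <;> simp [Hn, hx]
  have hconj : Q.HolderConjugate (Q / (Q - 1)) := Real.HolderConjugate.conjExponent hQ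
  have key : ∀ n, (∫⁻ x, Hn n x ^ Q ∂μ) ^ (1 / Q) ≤ M := by
    intro n
    set I := ∫⁻ x, Hn n x ^ Q ∂μ with hI
    have hfin : I ≠ ∞ := by
      have : I ≤ (n : ℝ≥0∞) ^ Q * μ (spanningSets μ n) := by
        calc I ≤ ∫⁻ x, (spanningSets μ n).indicator (fun _ => (n : ℝ≥0∞) ^ Q) x ∂μ := by
              refine lintegral_mono fun x => ?_
              by_cases hx : x ∈ spanningSets μ n
              · simp only [Hn, hx, indicator_of_mem]
                gcongr
                exact min_le_right _ _
              · simp [Hn, hx, hQ0]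
          _ = _ := by
              rw [lintegral_indicator (measurableSet_spanningSets μ n), setLIntegral_const]
      exact (this.trans_lt (ENNReal.mul_lt_top (ENNReal.rpow_lt_top_of_nonneg hQ0.le (by simp))
        (measure_spanningSets_lt_top μ n))).ne
    have hb : I ≤ I ^ (1 / (Q / (Q - 1))) * M := by
      calc I = ∫⁻ x, Hn n x ^ (Q - 1) * Hn n x ∂μ := by
            refine lintegral_congr fun x => ?_
            conv_rhs => rw [← ENNReal.rpow_one (Hn n x), ← ENNReal.rpow_mul]
            rw [one_mul, ← ENNReal.rpow_add_of_nonneg _ _ (by linarith) zero_le_one]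
            simp
        _ ≤ ∫⁻ x, Hn n x ^ (Q - 1) * H x ∂μ := by
            gcongr with x
            exact hHnle n x
        _ = ∫⁻ x, ∫⁻ b, Hn n x ^ (Q - 1) * F x b ∂ν ∂μ := by
            refine lintegral_congr fun x => ?_
            exact (lintegral_const_mul _ (hF.comp measurable_prodMk_left)).symm
        _ = ∫⁻ b, ∫⁻ x, Hn n x ^ (Q - 1) * F x b ∂μ ∂ν := by
            rw [lintegral_lintegral_swap]
            exact ((((hHnm n).comp measurable_fst).pow_const _).mul hF).aemeasurable
        _ ≤ ∫⁻ b, I ^ (1 / (Q / (Q - 1))) * (∫⁻ x, F x b ^ Q ∂μ) ^ (1 / Q) ∂ν := by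
            refine lintegral_mono fun b => ?_
            have := ENNReal.lintegral_mul_le_Lp_mul_Lq μ hconj.symm
              ((hHnm n).pow_const (Q - 1)).aemeasurable
              (hF.comp (measurable_prodMk_right (y := b))).aemeasurable
            refine this.trans (le_of_eq ?_)
            congr 2
            refine lintegral_congr fun x => ?_
            rw [← ENNReal.rpow_mul]
            congr 1
            field_simp [(by linarith : Q - 1 ≠ 0)]
        _ = _ := by
            rw [lintegral_const_mul]
            exact Measurable.pow_const (Measurable.lintegral_prod_left' (hF.pow_const Q)) _
    rcases eq_or_ne I 0 with h0 | h0
    · rw [h0, ENNReal.zero_rpow_of_pos (by positivity)]; exact zero_le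
    · have e : I = I ^ (1 / (Q / (Q - 1))) * I ^ (1 / Q) := by
        rw [← ENNReal.rpow_add _ _ h0 hfin]
        have : 1 / (Q / (Q - 1)) + 1 / Q = 1 := by
          field_simp [(by linarith : Q - 1 ≠ 0)]; ring
        rw [this, ENNReal.rpow_one]
      rw [e] at hb
      conv at hb => rhs; rw [← e]
      have hne0 : I ^ (1 / (Q / (Q - 1))) ≠ 0 := by
        simp [ENNReal.rpow_eq_zero_iff, h0, hfin]
      have hnet : I ^ (1 / (Q / (Q - 1))) ≠ ∞ :=
        ENNReal.rpow_ne_top_of_nonneg (by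
          have : 0 < Q - 1 := by linarith
          positivity) hfin
      exact (ENNReal.mul_le_mul_iff_right hne0 hnet).1 hb
  have hmono : ∀ x, Monotone fun n => Hn n x := by
    intro x n m hnm
    by_cases hx : x ∈ spanningSets μ n
    · have hx' : x ∈ spanningSets μ m := monotone_spanningSets μ hnm hx
      simp only [Hn, hx, hx', indicator_of_mem]
      gcongr
    · simp [Hn, hx]
  have hsup : ∀ x, H x ^ Q = ⨆ n, Hn n x ^ Q := by
    intro x
    have ht : Tendsto (fun n => Hn n x) atTop (𝓝 (H x)) := by
      have h1 : Tendsto (fun n : ℕ => min (H x) (n : ℝ≥0∞)) atTop (𝓝 (min (H x) ∞)) :=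
        tendsto_const_nhds.min ENNReal.tendsto_nat_nhds_top
      rw [min_eq_left le_top] at h1
      refine h1.congr' ?_
      filter_upwards [eventually_ge_atTop (spanningSetsIndex μ x)] with n hn
      simp [Hn, mem_spanningSets_of_index_le μ x hn]
    have ht2 : Tendsto (fun n => Hn n x ^ Q) atTop (𝓝 (H x ^ Q)) :=
      (ENNReal.continuous_rpow_const.tendsto _).comp ht
    exact tendsto_nhds_unique ht2 (tendsto_atTop_iSup fun n m hnm =>
      ENNReal.rpow_le_rpow (hmono x hnm) hQ0.le)
  have : ∫⁻ x, H x ^ Q ∂μ = ⨆ n, ∫⁻ x, Hn n x ^ Q ∂μ := by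
    simp_rw [hsup]
    exact lintegral_iSup (fun n => (hHnm n).pow_const Q) fun n m hnm x =>
      ENNReal.rpow_le_rpow (hmono x hnm) hQ0.le
  rw [one_div, ENNReal.rpow_inv_le_iff hQ0, this]
  refine iSup_le fun n => ?_
  rw [← ENNReal.rpow_inv_le_iff hQ0, ← one_div]
  exact key n

/-- Minkowski's integral inequality. -/
theorem eLpNorm_lintegral_le [SigmaFinite μ] [SFinite ν] {F : X → B → ℝ≥0∞}
    (hF : Measurable (Function.uncurry F)) {q : ℝ≥0∞} (hq : 1 ≤ q) :
    eLpNorm (fun x => ∫⁻ b, F x b ∂ν) q μ ≤ ∫⁻ b, eLpNorm (fun x => F x b) q μ ∂ν := by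
  have hq0 : q ≠ 0 := (zero_lt_one.trans_le hq).ne'
  rcases eq_or_ne q ∞ with rfl | hqt
  · simp only [eLpNorm_exponent_top, eLpNormEssSup_eq_essSup_enorm, enorm_eq_self]
    refine essSup_le_of_ae_le _ ?_
    have hN := measurable_essSup_of_measurable_uncurry (μ := μ) hF
    have hset : MeasurableSet {z : X × B | F z.1 z.2 ≤ essSup (fun x => F x z.2) μ} :=
      measurableSet_le hF (hN.comp measurable_snd)
    have h1 : ∀ᵐ b ∂ν, ∀ᵐ x ∂μ, F x b ≤ essSup (fun x => F x b) μ :=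
      Eventually.of_forall fun b => ENNReal.ae_le_essSup _
    have h2 : ∀ᵐ x ∂μ, ∀ᵐ b ∂ν, F x b ≤ essSup (fun x => F x b) μ :=
      (Measure.ae_ae_comm hset).2 h1
    filter_upwards [h2] with x hx
    exact lintegral_mono_ae hx
  · simp only [eLpNorm_eq_lintegral_rpow_enorm_toReal hq0 hqt, enorm_eq_self]
    have h1 : 1 ≤ q.toReal := by
      rw [← ENNReal.toReal_one]; exact ENNReal.toReal_mono hqt hq
    rcases h1.eq_or_lt with h | h
    · simp only [← h, ENNReal.rpow_one, div_one]
      rw [lintegral_lintegral_swap hF.aemeasurable]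
    · exact lintegral_rpow_lintegral_le hF h

/-- Young's inequality for the convolution with a nonnegative kernel. -/
theorem eLpNorm_lintegral_mul_comp_add_le {k G : ℝ → ℝ≥0∞} (hk : Measurable k) (hG : Measurable G)
    {q : ℝ≥0∞} (hq : 1 ≤ q) :
    eLpNorm (fun x : ℝ => ∫⁻ z, k z * G (x + z)) q volume ≤
      (∫⁻ z, k z) * eLpNorm G q volume := by
  have hm : Measurable (Function.uncurry fun x z : ℝ => k z * G (x + z)) :=
    (hk.comp measurable_snd).mul (hG.comp (measurable_fst.add measurable_snd))
  refine (eLpNorm_lintegral_le hm hq).trans ?_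
  rw [← lintegral_mul_const _ hk]
  refine lintegral_mono fun z => ?_
  have e : eLpNorm (fun x => G (x + z)) q volume = eLpNorm G q volume :=
    eLpNorm_comp_measurePreserving (g := G) (f := fun x => x + z) hG.aestronglyMeasurable
      (measurePreserving_add_right volume z)
  rw [← e]
  -- Homogeneity of the norm is used for finite factors only. For an infinite one, either the
  -- translate of G vanishes a.e. or the right side is infinite.
  rcases eq_or_ne (k z) ∞ with hkz | hkz
  · rcases eq_or_ne (eLpNorm (fun x => G (x + z)) q volume) 0 with h0 | h0
    · have hGz : Measurable fun x => G (x + z) := hG.comp (measurable_id.add_const z)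
      rw [eLpNorm_eq_zero_iff hGz.aestronglyMeasurable (zero_lt_one.trans_le hq).ne'] at h0
      have : (fun x => k z * G (x + z)) =ᵐ[volume] fun _ => (0 : ℝ≥0∞) := by
        filter_upwards [h0] with x hx
        have : G (x + z) = 0 := by simpa using hx
        simp [this]
      rw [eLpNorm_congr_ae this]
      simp
    · rw [hkz, ENNReal.top_mul h0]; exact le_top
  · lift k z to NNReal using hkz with c
    exact eLpNorm_le_nnreal_smul_eLpNorm_of_ae_le_mul' (Eventually.of_forall fun x => by
      simp) q

end Minkowski

/-! ### Distribution function, decreasing rearrangement and K-functional. -/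

section Rearrangement

variable {α : Type*} [MeasurableSpace α]

/-- The distribution function of `φ`. -/
def distr (μ : Measure α) (φ : α → ℝ≥0∞) (l : ℝ) : ℝ≥0∞ := μ {x | ENNReal.ofReal l < φ x}

/-- The decreasing rearrangement of `φ`. -/
def rearr (μ : Measure α) (φ : α → ℝ≥0∞) (y : ℝ) : ℝ≥0∞ :=
  volume {l : ℝ | 0 < l ∧ ENNReal.ofReal y < distr μ φ l}

/-- The `K`-functional `K(m, φ; L¹, L^∞)`. -/
def kfun (μ : Measure α) (φ : α → ℝ≥0∞) (m : ℝ) : ℝ≥0∞ :=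
  ⨆ (w : α → ℝ≥0∞) (_ : Measurable w) (_ : ∀ x, w x ≤ 1)
    (_ : ∫⁻ x, w x ∂μ ≤ ENNReal.ofReal m), ∫⁻ x, w x * φ x ∂μ

variable {μ : Measure α} {φ ψ : α → ℝ≥0∞}

theorem setOf_ofReal_lt_eq (a : ℝ≥0∞) :
    {l : ℝ | 0 < l ∧ ENNReal.ofReal l < a} = if a = ∞ then Ioi 0 else Ioo 0 a.toReal := by
  split_ifs with h
  · ext l; simp [h]
  · ext l
    simp only [mem_ofPred_eq, mem_Ioo, and_congr_right_iff]
    intro hl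
    rw [ENNReal.ofReal_lt_iff_lt_toReal hl.le h]

theorem volume_setOf_ofReal_lt (a : ℝ≥0∞) :
    volume {l : ℝ | 0 < l ∧ ENNReal.ofReal l < a} = a := by
  rw [setOf_ofReal_lt_eq]
  split_ifs with h
  · simp [h]
  · simp [h]

theorem measurableSet_setOf_ofReal_lt (a : ℝ≥0∞) :
    MeasurableSet {l : ℝ | 0 < l ∧ ENNReal.ofReal l < a} :=
  (measurableSet_lt measurable_const measurable_id).inter
    (measurableSet_lt ENNReal.measurable_ofReal measurable_const)

theorem distr_antitone (μ : Measure α) (φ : α → ℝ≥0∞) : Antitone (distr μ φ) := fun _ _ h =>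
  measure_mono fun _ hx => (ENNReal.ofReal_le_ofReal h).trans_lt hx

theorem measurable_distr (μ : Measure α) (φ : α → ℝ≥0∞) : Measurable (distr μ φ) :=
  (distr_antitone μ φ).measurable

theorem rearr_antitone (μ : Measure α) (φ : α → ℝ≥0∞) : Antitone (rearr μ φ) := fun _ _ h =>
  measure_mono fun _ hx => ⟨hx.1, (ENNReal.ofReal_le_ofReal h).trans_lt hx.2⟩

theorem measurable_rearr (μ : Measure α) (φ : α → ℝ≥0∞) : Measurable (rearr μ φ) :=
  (rearr_antitone μ φ).measurable

/-- As `distr` is antitone, the set measured by `rearr` is an interval starting at 0. With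
`lt_distr_of_lt_rearr`, this makes the two functions generalized inverses of each other, up to the
boundary case. -/
theorem ofReal_le_rearr {l y : ℝ} (h : ENNReal.ofReal y < distr μ φ l) :
    ENNReal.ofReal l ≤ rearr μ φ y := by
  have : ENNReal.ofReal l = volume (Ioc (0 : ℝ) l) := by simp
  rw [this]
  exact measure_mono fun z hz => ⟨hz.1, h.trans_le (distr_antitone μ φ hz.2)⟩

theorem lt_distr_of_lt_rearr {l y : ℝ} (h : ENNReal.ofReal l < rearr μ φ y) :
    ENNReal.ofReal y < distr μ φ l := by
  by_contra! hc
  refine h.not_ge ?_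
  have : ENNReal.ofReal l = volume (Ioc (0 : ℝ) l) := by simp
  rw [this]
  refine measure_mono fun z hz => ⟨hz.1, ?_⟩
  by_contra! hz'
  exact (hz.2.trans_le (distr_antitone μ φ hz'.le)).not_ge hc

/-- The value φ(x) is the length of the set of l > 0 below it; Tonelli does the rest. -/
theorem lintegral_mul_eq_layercake [SFinite μ] {w : α → ℝ≥0∞} (hw : Measurable w)
    (hφ : Measurable φ) :
    ∫⁻ x, w x * φ x ∂μ = ∫⁻ l in Ioi (0 : ℝ), ∫⁻ x in {x | ENNReal.ofReal l < φ x}, w x ∂μ := by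
  have hS : MeasurableSet {z : α × ℝ | ENNReal.ofReal z.2 < φ z.1} :=
    measurableSet_lt (ENNReal.measurable_ofReal.comp measurable_snd) (hφ.comp measurable_fst)
  have hm : Measurable fun z : α × ℝ =>
      {z : α × ℝ | ENNReal.ofReal z.2 < φ z.1}.indicator (fun z => w z.1) z :=
    (hw.comp measurable_fst).indicator hS
  calc ∫⁻ x, w x * φ x ∂μ
      = ∫⁻ x, (∫⁻ l in Ioi (0 : ℝ),
          {z : α × ℝ | ENNReal.ofReal z.2 < φ z.1}.indicator (fun z => w z.1) (x, l)) ∂μ := by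
        refine lintegral_congr fun x => ?_
        have : ∀ l : ℝ, {z : α × ℝ | ENNReal.ofReal z.2 < φ z.1}.indicator (fun z => w z.1) (x, l)
            = {l : ℝ | ENNReal.ofReal l < φ x}.indicator (fun _ => w x) l := fun l => rfl
        simp_rw [this]
        rw [lintegral_indicator (measurableSet_lt ENNReal.measurable_ofReal measurable_const),
          setLIntegral_const, Measure.restrict_apply
            (measurableSet_lt ENNReal.measurable_ofReal measurable_const), inter_comm]
        congr 1
        exact (volume_setOf_ofReal_lt (φ x)).symm
    _ = ∫⁻ l in Ioi (0 : ℝ), ∫⁻ x,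
          {z : α × ℝ | ENNReal.ofReal z.2 < φ z.1}.indicator (fun z => w z.1) (x, l) ∂μ :=
        lintegral_lintegral_swap hm.aemeasurable
    _ = _ := by
        refine lintegral_congr fun l => ?_
        have : ∀ x, {z : α × ℝ | ENNReal.ofReal z.2 < φ z.1}.indicator (fun z => w z.1) (x, l)
            = {x : α | ENNReal.ofReal l < φ x}.indicator w x := fun x => rfl
        simp_rw [this]
        rw [lintegral_indicator (measurableSet_lt measurable_const hφ)]

/-- A layer-cake form of the Hardy–Littlewood rearrangement inequality. -/
theorem lintegral_mul_le_rearr [SigmaFinite μ] {w : α → ℝ≥0∞} (hw : Measurable w)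
    (hφ : Measurable φ) {V : ℝ → ℝ≥0∞} (hV : Measurable V)
    (h : ∀ F, MeasurableSet F → μ F < ∞ →
      ∫⁻ x in F, w x ∂μ ≤ ∫⁻ y in {y : ℝ | 0 < y ∧ ENNReal.ofReal y < μ F}, V y) :
    ∫⁻ x, w x * φ x ∂μ ≤ ∫⁻ y in Ioi (0 : ℝ), V y * rearr μ φ y := by
  -- Superlevel sets of φ may have infinite measure, so the hypothesis is first extended to all
  -- measurable sets by exhaustion.
  have h' : ∀ F, MeasurableSet F →
      ∫⁻ x in F, w x ∂μ ≤ ∫⁻ y in {y : ℝ | 0 < y ∧ ENNReal.ofReal y < μ F}, V y := by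
    intro F hF
    have e : F = ⋃ n, F ∩ spanningSets μ n := by
      rw [← inter_iUnion, iUnion_spanningSets, inter_univ]
    have hd : Directed (· ⊆ ·) fun n => F ∩ spanningSets μ n :=
      (show Monotone fun n => F ∩ spanningSets μ n from fun n m hnm =>
        inter_subset_inter_right _ (monotone_spanningSets μ hnm)).directed_le
    conv_lhs => rw [e]
    rw [setLIntegral_iUnion_of_directed _ hd]
    refine iSup_le fun n => (h _ (hF.inter (measurableSet_spanningSets μ n)) ?_).trans ?_
    · exact (measure_mono inter_subset_right).trans_lt (measure_spanningSets_lt_top μ n)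
    · exact lintegral_mono_set fun y hy => ⟨hy.1, hy.2.trans_le (measure_mono inter_subset_left)⟩
  rw [lintegral_mul_eq_layercake hw hφ]
  have hS : MeasurableSet {z : ℝ × ℝ | ENNReal.ofReal z.2 < distr μ φ z.1} :=
    measurableSet_lt (ENNReal.measurable_ofReal.comp measurable_snd)
      ((measurable_distr μ φ).comp measurable_fst)
  calc ∫⁻ l in Ioi (0 : ℝ), ∫⁻ x in {x | ENNReal.ofReal l < φ x}, w x ∂μ
      ≤ ∫⁻ l in Ioi (0 : ℝ), ∫⁻ y in Ioi (0 : ℝ),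
          {z : ℝ × ℝ | ENNReal.ofReal z.2 < distr μ φ z.1}.indicator (fun z => V z.2) (l, y) := by
        refine lintegral_mono fun l => (h' _ (measurableSet_lt measurable_const hφ)).trans ?_
        have : ∀ y, {z : ℝ × ℝ | ENNReal.ofReal z.2 < distr μ φ z.1}.indicator
            (fun z => V z.2) (l, y) = {y : ℝ | ENNReal.ofReal y < distr μ φ l}.indicator V y :=
          fun y => rfl
        simp_rw [this]
        rw [lintegral_indicator (measurableSet_lt ENNReal.measurable_ofReal measurable_const),
          Measure.restrict_restrict
            (measurableSet_lt ENNReal.measurable_ofReal measurable_const), inter_comm]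
        exact le_rfl
    _ = ∫⁻ y in Ioi (0 : ℝ), ∫⁻ l in Ioi (0 : ℝ),
          {z : ℝ × ℝ | ENNReal.ofReal z.2 < distr μ φ z.1}.indicator (fun z => V z.2) (l, y) :=
        lintegral_lintegral_swap ((hV.comp measurable_snd).indicator hS).aemeasurable
    _ = _ := by
        refine lintegral_congr fun y => ?_
        have : ∀ l, {z : ℝ × ℝ | ENNReal.ofReal z.2 < distr μ φ z.1}.indicator
            (fun z => V z.2) (l, y) =
              {l : ℝ | ENNReal.ofReal y < distr μ φ l}.indicator (fun _ => V y) l := fun y => rfl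
        simp_rw [this]
        have hms : MeasurableSet {l : ℝ | ENNReal.ofReal y < distr μ φ l} :=
          measurableSet_lt measurable_const (measurable_distr μ φ)
        rw [lintegral_indicator hms, setLIntegral_const, Measure.restrict_apply hms, inter_comm]
        rfl

theorem le_kfun {w : α → ℝ≥0∞} {m : ℝ} (hw : Measurable w) (h1 : ∀ x, w x ≤ 1)
    (hm : ∫⁻ x, w x ∂μ ≤ ENNReal.ofReal m) : ∫⁻ x, w x * φ x ∂μ ≤ kfun μ φ m :=
  le_iSup_of_le w (le_iSup_of_le hw (le_iSup_of_le h1 (le_iSup_of_le hm le_rfl)))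

theorem kfun_le {m : ℝ} {b : ℝ≥0∞} (h : ∀ w : α → ℝ≥0∞, Measurable w → (∀ x, w x ≤ 1) →
    ∫⁻ x, w x ∂μ ≤ ENNReal.ofReal m → ∫⁻ x, w x * φ x ∂μ ≤ b) : kfun μ φ m ≤ b :=
  iSup_le fun w => iSup_le fun hw => iSup_le fun h1 => iSup_le fun hm => h w hw h1 hm

theorem kfun_monotone (μ : Measure α) (φ : α → ℝ≥0∞) : Monotone (kfun μ φ) := fun _ _ h =>
  kfun_le fun _ hw h1 hm => le_kfun hw h1 (hm.trans (ENNReal.ofReal_le_ofReal h))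

theorem measurable_kfun (μ : Measure α) (φ : α → ℝ≥0∞) : Measurable (kfun μ φ) :=
  (kfun_monotone μ φ).measurable

theorem kfun_mono_ae {m : ℝ} (h : φ ≤ᵐ[μ] ψ) : kfun μ φ m ≤ kfun μ ψ m :=
  kfun_le fun w hw h1 hm => (lintegral_mono_ae (h.mono fun x hx => by
    gcongr)).trans (le_kfun hw h1 hm)

theorem kfun_add_le (hφ : AEMeasurable φ μ) (m : ℝ) :
    kfun μ (φ + ψ) m ≤ kfun μ φ m + kfun μ ψ m :=
  kfun_le fun w hw h1 hm => by
    simp only [Pi.add_apply, mul_add]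
    refine (lintegral_add_left' (hw.aemeasurable.mul hφ) _).le.trans ?_
    exact add_le_add (le_kfun hw h1 hm) (le_kfun hw h1 hm)

theorem kfun_const_mul (c : ℝ≥0∞) (hc : c ≠ ∞) (m : ℝ) :
    kfun μ (fun x => c * φ x) m = c * kfun μ φ m := by
  have : ∀ w : α → ℝ≥0∞, ∫⁻ x, w x * (c * φ x) ∂μ = c * ∫⁻ x, w x * φ x ∂μ := fun w => by
    rw [← lintegral_const_mul' _ _ hc]
    exact lintegral_congr fun x => by ring
  simp only [kfun, this, ENNReal.mul_iSup]

/-- Rescaled form of `le_kfun`. -/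
theorem lintegral_mul_le_kfun {w : α → ℝ≥0∞} {m M : ℝ} (hM : 0 < M) (hw : Measurable w)
    (h1 : ∀ x, w x ≤ ENNReal.ofReal M) (hm : ∫⁻ x, w x ∂μ ≤ ENNReal.ofReal (M * m)) :
    ∫⁻ x, w x * φ x ∂μ ≤ ENNReal.ofReal M * kfun μ φ m := by
  have hM0 : ENNReal.ofReal M ≠ 0 := by simpa using hM
  have hMt : ENNReal.ofReal M ≠ ∞ := ENNReal.ofReal_ne_top
  have e : ∀ x, w x = ENNReal.ofReal M * ((ENNReal.ofReal M)⁻¹ * w x) := fun x => by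
    rw [← mul_assoc, ENNReal.mul_inv_cancel hM0 hMt, one_mul]
  calc ∫⁻ x, w x * φ x ∂μ
      = ENNReal.ofReal M * ∫⁻ x, ((ENNReal.ofReal M)⁻¹ * w x) * φ x ∂μ := by
        rw [← lintegral_const_mul' _ _ hMt]
        refine lintegral_congr fun x => ?_
        rw [← mul_assoc, ← e]
    _ ≤ _ := by
        gcongr
        refine le_kfun (hw.const_mul _) (fun x => ?_) ?_
        · rw [← ENNReal.inv_mul_cancel hM0 hMt]
          gcongr
          exact h1 x
        · rw [lintegral_const_mul _ hw]
          calc _ ≤ (ENNReal.ofReal M)⁻¹ * ENNReal.ofReal (M * m) := by gcongr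
            _ = _ := by
              rw [ENNReal.ofReal_mul hM.le, ← mul_assoc, ENNReal.inv_mul_cancel hM0 hMt, one_mul]

/-- Dividing a weight admissible at scale c m by c makes it admissible at scale m. Together with
monotonicity, this gives continuity of the K-functional in its scale. -/
theorem kfun_mul_le {c m : ℝ} (hc : 1 ≤ c) :
    kfun μ φ (c * m) ≤ ENNReal.ofReal c * kfun μ φ m :=
  kfun_le fun w hw h1 hm => lintegral_mul_le_kfun (by linarith) hw
    (fun x => (h1 x).trans (by simpa using ENNReal.ofReal_le_ofReal hc)) hm

/-- The test weight is a constant multiple of the indicator of a superlevel set of measure exceeding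
y, normalized to have mass y. -/
theorem mul_rearr_le_kfun [SigmaFinite μ] (hφ : Measurable φ) {y : ℝ} (hy : 0 < y) :
    ENNReal.ofReal y * rearr μ φ y ≤ kfun μ φ y := by
  have hy0 : ENNReal.ofReal y ≠ 0 := by simpa using hy
  have hyt : ENNReal.ofReal y ≠ ∞ := ENNReal.ofReal_ne_top
  have key : ∀ l : ℝ, ENNReal.ofReal y < distr μ φ l →
      ENNReal.ofReal y * ENNReal.ofReal l ≤ kfun μ φ y := by
    intro l hl
    have hms : MeasurableSet {x | ENNReal.ofReal l < φ x} := measurableSet_lt measurable_const hφ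
    -- A subset of finite measure is needed for the normalization; it still has measure above y, so
    -- the weight stays below 1.
    obtain ⟨F, hF, hFs, hyF, hFt⟩ := Measure.exists_subset_measure_lt_top hms hl
    have hF0 : μ F ≠ 0 := (bot_le.trans_lt hyF).ne'
    have hle : ENNReal.ofReal y * (μ F)⁻¹ ≤ 1 := by
      rw [← ENNReal.mul_inv_cancel hF0 hFt.ne]
      gcongr
    have hint : ENNReal.ofReal y * (μ F)⁻¹ * μ F = ENNReal.ofReal y := by
      rw [mul_assoc, ENNReal.inv_mul_cancel hF0 hFt.ne, mul_one]
    have := le_kfun (φ := φ) (m := y) (w := F.indicator fun _ => ENNReal.ofReal y * (μ F)⁻¹)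
      (measurable_const.indicator hF)
      (fun x => (indicator_le_self' (fun _ _ => zero_le) x).trans hle)
      (by rw [lintegral_indicator hF, setLIntegral_const, hint])
    refine le_trans ?_ this
    calc ENNReal.ofReal y * ENNReal.ofReal l
        = ∫⁻ x in F, ENNReal.ofReal y * (μ F)⁻¹ * ENNReal.ofReal l ∂μ := by
          rw [setLIntegral_const, mul_right_comm, hint]
      _ ≤ ∫⁻ x in F, ENNReal.ofReal y * (μ F)⁻¹ * φ x ∂μ := by
          refine setLIntegral_mono' hF fun x hx => ?_
          gcongr
          exact (hFs hx).le
      _ = _ := by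
          rw [← lintegral_indicator hF]
          refine lintegral_congr fun x => ?_
          by_cases hx : x ∈ F <;> simp [hx]
  by_contra! hc
  obtain ⟨z, hz1, hz2⟩ := exists_between (show kfun μ φ y / ENNReal.ofReal y < rearr μ φ y by
    rw [ENNReal.div_lt_iff (Or.inl hy0) (Or.inl hyt), mul_comm]; exact hc)
  have hzt : z ≠ ∞ := (hz2.trans_le le_top).ne
  have hz := key z.toReal (lt_distr_of_lt_rearr (by rwa [ENNReal.ofReal_toReal hzt]))
  rw [ENNReal.ofReal_toReal hzt, mul_comm] at hz
  rw [ENNReal.div_lt_iff (Or.inl hy0) (Or.inl hyt)] at hz1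
  exact hz1.not_ge hz

/-- An admissible weight has mass at most min(m, μ F) on F, which is the length of (0, m) ∩ (0, μ
F). So `lintegral_mul_le_rearr` applies with the indicator of (-∞, m) as V. -/
theorem kfun_le_lintegral_rearr [SigmaFinite μ] (hφ : Measurable φ) (m : ℝ) :
    kfun μ φ m ≤ ∫⁻ y in Ioi (0 : ℝ), (Iio m).indicator 1 y * rearr μ φ y := by
  refine kfun_le fun w hw h1 hm =>
    lintegral_mul_le_rearr hw hφ (measurable_one.indicator measurableSet_Iio) fun F hF hFt => ?_
  rw [lintegral_indicator measurableSet_Iio]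
  simp only [Pi.one_apply, lintegral_one, MeasurableSet.univ, Measure.restrict_apply, univ_inter]
  rw [Measure.restrict_apply measurableSet_Iio]
  have : Iio m ∩ {y : ℝ | 0 < y ∧ ENNReal.ofReal y < μ F} =
      {y : ℝ | 0 < y ∧ ENNReal.ofReal y < min (ENNReal.ofReal m) (μ F)} := by
    ext y
    simp only [mem_inter_iff, mem_Iio, mem_ofPred_eq, lt_min_iff]
    constructor
    · rintro ⟨h1, h2, h3⟩
      exact ⟨h2, (ENNReal.ofReal_lt_ofReal_iff (h2.trans h1)).2 h1, h3⟩
    · rintro ⟨h1, h2, h3⟩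
      exact ⟨(ENNReal.ofReal_lt_ofReal_iff_of_nonneg h1.le).1 h2, h1, h3⟩
  rw [this, volume_setOf_ofReal_lt, le_min_iff]
  refine ⟨(setLIntegral_le_lintegral F w).trans hm, ?_⟩
  calc ∫⁻ x in F, w x ∂μ ≤ ∫⁻ x in F, 1 ∂μ := lintegral_mono fun x => h1 x
    _ = μ F := by simp

end Rearrangement

/-! ### The substitution λ = exp x. -/

section Exponential

theorem lintegral_Ioi_zero_eq_lintegral_exp (g : ℝ → ℝ≥0∞) :
    ∫⁻ y in Ioi (0 : ℝ), g y = ∫⁻ x : ℝ, ENNReal.ofReal (Real.exp x) * g (Real.exp x) := by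
  have := lintegral_image_eq_lintegral_abs_deriv_mul (s := univ) (f := Real.exp) (f' := Real.exp)
    MeasurableSet.univ (fun x _ => (Real.hasDerivAt_exp x).hasDerivWithinAt)
    Real.exp_injective.injOn g
  rw [image_univ, Real.range_exp] at this
  simpa [abs_of_pos (Real.exp_pos _)] using this

theorem measurableEmbedding_exp : MeasurableEmbedding Real.exp :=
  Real.isOpenEmbedding_exp.measurableEmbedding

/-- In the variable log λ the measure dλ/λ becomes Lebesgue measure, so dilation-invariant
inequalities become convolution inequalities. -/
theorem haarPos_eq_map_exp : haarPos = volume.map Real.exp := by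
  ext s hs
  rw [haarPos, withDensity_apply _ hs, Measure.map_apply Real.measurable_exp hs,
    ← lintegral_indicator hs, lintegral_Ioi_zero_eq_lintegral_exp,
    ← lintegral_indicator_one (Real.measurable_exp hs)]
  refine lintegral_congr fun x => ?_
  by_cases hx : Real.exp x ∈ s
  · have hx' : x ∈ Real.exp ⁻¹' s := hx
    simp only [hx, hx', indicator_of_mem, Pi.one_apply]
    rw [← ENNReal.ofReal_mul (Real.exp_pos x).le, mul_inv_cancel₀ (Real.exp_pos x).ne',
      ENNReal.ofReal_one]
  · have hx' : x ∉ Real.exp ⁻¹' s := hx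
    simp [hx, hx']

theorem eLpNorm_haarPos (F : ℝ → ℝ≥0∞) (q : ℝ≥0∞) :
    eLpNorm F q haarPos = eLpNorm (fun x => F (Real.exp x)) q volume := by
  rw [haarPos_eq_map_exp, measurableEmbedding_exp.eLpNorm_map_measure]
  rfl

theorem measurableSet_exp_lt (D : ℝ≥0∞) :
    MeasurableSet {b : ℝ | ENNReal.ofReal (Real.exp b) < D} :=
  measurableSet_lt (ENNReal.measurable_ofReal.comp Real.measurable_exp) measurable_const

theorem lintegral_exp_Iio {c : ℝ} (hc : 0 < c) (a : ℝ) :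
    ∫⁻ b in Iio a, ENNReal.ofReal (Real.exp (c * b)) = ENNReal.ofReal (Real.exp (c * a) / c) := by
  rw [← integral_exp_mul_Iic hc, setLIntegral_congr Iio_ae_eq_Iic,
    ofReal_integral_eq_lintegral_ofReal (integrableOn_exp_mul_Iic hc a)]
  exact Eventually.of_forall fun b => (Real.exp_pos _).le

theorem lintegral_exp_of_lt {c : ℝ} (hc : 0 < c) (D : ℝ≥0∞) :
    ∫⁻ b in {b : ℝ | ENNReal.ofReal (Real.exp b) < D}, ENNReal.ofReal (Real.exp (c * b)) =
      D ^ c / ENNReal.ofReal c := by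
  rcases eq_or_ne D ∞ with rfl | hD
  · have : {b : ℝ | ENNReal.ofReal (Real.exp b) < ∞} = univ := by ext; simp
    rw [this, ENNReal.top_rpow_of_pos hc, ENNReal.top_div_of_ne_top ENNReal.ofReal_ne_top,
      Measure.restrict_univ, eq_top_iff]
    calc (∞ : ℝ≥0∞) = ∫⁻ b in Ioi (0 : ℝ), 1 := by simp
      _ ≤ ∫⁻ b in Ioi (0 : ℝ), ENNReal.ofReal (Real.exp (c * b)) := by
        refine setLIntegral_mono' measurableSet_Ioi fun b hb => ?_
        rw [← ENNReal.ofReal_one]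
        exact ENNReal.ofReal_le_ofReal (Real.one_le_exp (mul_nonneg hc.le (le_of_lt hb)))
      _ ≤ _ := setLIntegral_le_lintegral _ _
  rcases eq_or_ne D 0 with rfl | hD0
  · simp [hc]
  have hr : 0 < D.toReal := ENNReal.toReal_pos hD0 hD
  have : {b : ℝ | ENNReal.ofReal (Real.exp b) < D} = Iio (Real.log D.toReal) := by
    ext b
    simp only [mem_ofPred_eq, mem_Iio]
    rw [ENNReal.ofReal_lt_iff_lt_toReal (Real.exp_pos b).le hD, Real.lt_log_iff_exp_lt hr]
  rw [this, lintegral_exp_Iio hc, ENNReal.ofReal_div_of_pos hc]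
  congr 1
  rw [mul_comm, ← Real.rpow_def_of_pos hr, ← ENNReal.ofReal_rpow_of_pos hr,
    ENNReal.ofReal_toReal hD]

/-- Opens a power into an integral over a half-line, so that the norms below become double integrals
to which Tonelli applies. -/
theorem rpow_eq_lintegral_exp {c : ℝ} (hc : 0 < c) (D : ℝ≥0∞) :
    D ^ c = ENNReal.ofReal c *
      ∫⁻ b in {b : ℝ | ENNReal.ofReal (Real.exp b) < D}, ENNReal.ofReal (Real.exp (c * b)) := by
  rw [lintegral_exp_of_lt hc, ENNReal.mul_div_cancel (by simpa using hc) ENNReal.ofReal_ne_top]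

end Exponential

/-! ### Three expressions of the Lorentz norm and their comparison. -/

section LorentzNorms

variable {α : Type*} [MeasurableSpace α] {μ : Measure α} {φ : α → ℝ≥0∞}

/-- The norm of `L^{P,q}` in terms of the distribution function, up to the factor `P^{1/q}`. -/
def distrNorm (P : ℝ) (q : ℝ≥0∞) (μ : Measure α) (φ : α → ℝ≥0∞) : ℝ≥0∞ :=
  eLpNorm (fun x : ℝ => ENNReal.ofReal (Real.exp x) * distr μ φ (Real.exp x) ^ (1 / P)) q volume

/-- The norm of `L^{P,q}` in terms of the decreasing rearrangement. -/
def rearrNorm (P : ℝ) (q : ℝ≥0∞) (μ : Measure α) (φ : α → ℝ≥0∞) : ℝ≥0∞ :=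
  eLpNorm (fun x : ℝ => ENNReal.ofReal (Real.exp (x / P)) * rearr μ φ (Real.exp x)) q volume

/-- The norm of `L^{P,q}` in terms of the `K`-functional. -/
def kNorm (P : ℝ) (q : ℝ≥0∞) (μ : Measure α) (φ : α → ℝ≥0∞) : ℝ≥0∞ :=
  eLpNorm (fun x : ℝ => ENNReal.ofReal (Real.exp (x * (1 / P - 1))) * kfun μ φ (Real.exp x))
    q volume

/-- If the conclusion failed, it would fail on a whole interval of b just below log D, contradicting
the a.e. bound. In the case q = ∞ this replaces the Tonelli argument. -/
theorem eLpNorm_top_le_of_exp {c : ℝ} (hc : 0 < c) {D K M : ℝ≥0∞}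
    (h : ∀ᵐ b : ℝ, ENNReal.ofReal (Real.exp b) < D → ENNReal.ofReal (Real.exp (c * b)) * K ≤ M) :
    D ^ c * K ≤ M := by
  by_contra! hc1
  have hcont : ∃ D' : ℝ≥0∞, D' < D ∧ M < D' ^ c * K := by
    by_contra! hcon
    refine hc1.not_ge ?_
    rcases eq_or_ne D 0 with rfl | hD0
    · simp [ENNReal.zero_rpow_of_pos hc]
    have : D ^ c = ⨆ (D' : ℝ≥0∞) (_ : D' < D), D' ^ c := by
      refine le_antisymm (le_of_forall_lt fun e he => ?_) (iSup₂_le fun D' hD' => by gcongr)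
      obtain ⟨e', he1, he2⟩ := exists_between he
      refine he1.trans_le (le_iSup₂_of_le (e' ^ (1 / c)) ?_ ?_)
      · rw [one_div, ENNReal.rpow_inv_lt_iff hc]; exact he2
      · rw [← ENNReal.rpow_mul, one_div, inv_mul_cancel₀ hc.ne', ENNReal.rpow_one]
    simp only [this, ENNReal.iSup_mul]
    exact iSup₂_le fun D' hD' => hcon D' hD'
  obtain ⟨D', hD', hM⟩ := hcont
  have hD'0 : D' ≠ 0 := by
    rintro rfl
    simp [ENNReal.zero_rpow_of_pos hc] at hM
  have hD't : D' ≠ ∞ := (hD'.trans_le le_top).ne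
  -- The interval (log D', log D'') has positive measure, so it contains a point where the a.e.
  -- bound holds.
  obtain ⟨D'', h1, h2⟩ := exists_between hD'
  have hD''t : D'' ≠ ∞ := (h2.trans_le le_top).ne
  have hr' : 0 < D'.toReal := ENNReal.toReal_pos hD'0 hD't
  have hlt : D'.toReal < D''.toReal := (ENNReal.toReal_lt_toReal hD't hD''t).2 h1
  have hpos : volume (Ioo (Real.log D'.toReal) (Real.log D''.toReal)) ≠ 0 := by
    simp only [Real.volume_Ioo, ne_eq, ENNReal.ofReal_eq_zero, not_le, sub_pos]
    exact Real.log_lt_log hr' hlt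
  obtain ⟨b, hb, hb'⟩ := (frequently_ae_mem_iff.2 hpos).and_eventually h |>.exists
  have e1 : ENNReal.ofReal (Real.exp b) < D := by
    refine lt_trans ?_ h2
    rw [ENNReal.ofReal_lt_iff_lt_toReal (Real.exp_pos b).le hD''t]
    exact (Real.lt_log_iff_exp_lt (hr'.trans hlt)).1 hb.2
  refine (hb' e1).not_gt (hM.trans_le ?_)
  gcongr
  rw [mul_comm, Real.exp_mul, ← ENNReal.ofReal_rpow_of_pos (Real.exp_pos b)]
  gcongr
  rw [← ENNReal.ofReal_toReal hD't]
  exact ENNReal.ofReal_le_ofReal ((Real.log_lt_iff_lt_exp hr').1 hb.1).le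

theorem distrNorm_top_eq_rearrNorm {P : ℝ} (hP : 0 < P) :
    distrNorm P ∞ μ φ = rearrNorm P ∞ μ φ := by
  simp only [distrNorm, rearrNorm, eLpNorm_exponent_top, eLpNormEssSup_eq_essSup_enorm,
    enorm_eq_self]
  refine le_antisymm (essSup_le_of_ae_le _ (Eventually.of_forall fun a => ?_))
    (essSup_le_of_ae_le _ (Eventually.of_forall fun b => ?_))
  · simp only
    rw [mul_comm]
    refine eLpNorm_top_le_of_exp (by positivity) ?_
    filter_upwards [ENNReal.ae_le_essSup (μ := volume) fun x : ℝ =>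
      ENNReal.ofReal (Real.exp (x / P)) * rearr μ φ (Real.exp x)] with b hb hlt
    refine le_trans ?_ hb
    rw [one_div_mul_eq_div]
    gcongr
    exact ofReal_le_rearr hlt
  · simp only
    rw [mul_comm, ← ENNReal.rpow_one (rearr μ φ (Real.exp b))]
    refine eLpNorm_top_le_of_exp one_pos ?_
    filter_upwards [ENNReal.ae_le_essSup (μ := volume) fun x : ℝ =>
      ENNReal.ofReal (Real.exp x) * distr μ φ (Real.exp x) ^ (1 / P)] with a ha hlt
    refine le_trans ?_ ha
    rw [one_mul]
    gcongr
    have := (lt_distr_of_lt_rearr hlt).le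
    calc ENNReal.ofReal (Real.exp (b / P)) = ENNReal.ofReal (Real.exp b) ^ (1 / P) := by
          rw [ENNReal.ofReal_rpow_of_pos (Real.exp_pos b), ← Real.exp_mul]
          congr 2; ring
      _ ≤ _ := by gcongr

/-- Both sides are Q times the integral of exp(Qa) exp(Qb/P) over the planar region exp b < `distr`
(exp a), sliced in one direction or the other. The factor P is the one whose root normalizes the
Lorentz quasi-norm. -/
theorem lintegral_distr_eq_lintegral_rearr {P Q : ℝ} (hP : 0 < P) (hQ : 0 < Q) :
    ENNReal.ofReal P *
      ∫⁻ x : ℝ, (ENNReal.ofReal (Real.exp x) * distr μ φ (Real.exp x) ^ (1 / P)) ^ Q =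
      ∫⁻ x : ℝ, (ENNReal.ofReal (Real.exp (x / P)) * rearr μ φ (Real.exp x)) ^ Q := by
  let Ω : Set (ℝ × ℝ) := {z | ENNReal.ofReal (Real.exp z.2) < distr μ φ (Real.exp z.1)}
  have hΩ : MeasurableSet Ω := measurableSet_lt
    (ENNReal.measurable_ofReal.comp (Real.measurable_exp.comp measurable_snd))
    ((measurable_distr μ φ).comp (Real.measurable_exp.comp measurable_fst))
  let g : ℝ × ℝ → ℝ≥0∞ := Ω.indicator fun z =>
    ENNReal.ofReal (Real.exp (Q * z.1)) * ENNReal.ofReal (Real.exp (Q / P * z.2))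
  have hg : Measurable g := by
    refine Measurable.indicator (by fun_prop) hΩ
  have hQP : 0 < Q / P := by positivity
  have e1 : ∀ a : ℝ, (ENNReal.ofReal (Real.exp a) * distr μ φ (Real.exp a) ^ (1 / P)) ^ Q =
      ENNReal.ofReal (Q / P) * ∫⁻ b, g (a, b) := by
    intro a
    rw [ENNReal.mul_rpow_of_nonneg _ _ hQ.le, ← ENNReal.rpow_mul, one_div_mul_eq_div,
      rpow_eq_lintegral_exp hQP, ENNReal.ofReal_rpow_of_pos (Real.exp_pos a), ← Real.exp_mul,
      mul_comm a Q, mul_left_comm, ← lintegral_const_mul' _ _ ENNReal.ofReal_ne_top,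
      ← lintegral_indicator (measurableSet_exp_lt _)]
    rfl
  have e2 : ∀ b : ℝ, (ENNReal.ofReal (Real.exp (b / P)) * rearr μ φ (Real.exp b)) ^ Q =
      ENNReal.ofReal Q * ∫⁻ a, g (a, b) := by
    intro b
    have hΩb : MeasurableSet {a : ℝ | (a, b) ∈ Ω} := measurable_prodMk_right hΩ
    -- The two intervals have the same right endpoint and can differ only there.
    have hset : {a : ℝ | ENNReal.ofReal (Real.exp a) < rearr μ φ (Real.exp b)} =ᵐ[volume]
        {a : ℝ | (a, b) ∈ Ω} := by
      refine (show {a : ℝ | ENNReal.ofReal (Real.exp a) < rearr μ φ (Real.exp b)} ⊆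
        {a : ℝ | (a, b) ∈ Ω} from fun a ha => lt_distr_of_lt_rearr ha).eventuallyLE.antisymm ?_
      have hne : ∀ᵐ a : ℝ, a ≠ Real.log (rearr μ φ (Real.exp b)).toReal :=
        Measure.ae_ne volume _
      filter_upwards [hne] with a ha hΩa
      have h1 : ENNReal.ofReal (Real.exp a) ≤ rearr μ φ (Real.exp b) := ofReal_le_rearr hΩa
      refine lt_of_le_of_ne h1 fun heq => ha ?_
      rw [← heq, ENNReal.toReal_ofReal (Real.exp_pos a).le, Real.log_exp]
    rw [ENNReal.mul_rpow_of_nonneg _ _ hQ.le, rpow_eq_lintegral_exp hQ (rearr μ φ _),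
      ENNReal.ofReal_rpow_of_pos (Real.exp_pos _), ← Real.exp_mul, mul_left_comm,
      setLIntegral_congr hset, ← lintegral_const_mul' _ _ ENNReal.ofReal_ne_top,
      ← lintegral_indicator hΩb]
    congr 1
    refine lintegral_congr fun a => ?_
    change _ = Ω.indicator _ (a, b)
    by_cases ha : (a, b) ∈ Ω
    · have ha' : a ∈ {a : ℝ | (a, b) ∈ Ω} := ha
      simp only [ha, ha', indicator_of_mem]
      rw [mul_comm]
      congr 3
      ring
    · have ha' : a ∉ {a : ℝ | (a, b) ∈ Ω} := ha
      simp only [ha, ha', indicator_of_notMem, not_false_eq_true]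
  simp_rw [e1, e2]
  rw [lintegral_const_mul' _ _ ENNReal.ofReal_ne_top,
    lintegral_const_mul' _ _ ENNReal.ofReal_ne_top, ← mul_assoc, ← ENNReal.ofReal_mul hP.le,
    mul_div_cancel₀ Q hP.ne',
    lintegral_lintegral_swap (f := fun a b => g (a, b)) hg.aemeasurable]

theorem distrNorm_eq_rearrNorm {P : ℝ} (hP : 0 < P) {q : ℝ≥0∞} (hq : q ≠ 0) :
    ENNReal.ofReal P ^ (1 / q.toReal) * distrNorm P q μ φ = rearrNorm P q μ φ := by
  rcases eq_or_ne q ∞ with rfl | hqt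
  · simp [distrNorm_top_eq_rearrNorm hP]
  have hQ := ENNReal.toReal_pos hq hqt
  simp only [distrNorm, rearrNorm, eLpNorm_eq_lintegral_rpow_enorm_toReal hq hqt, enorm_eq_self]
  rw [← lintegral_distr_eq_lintegral_rearr hP hQ, ENNReal.mul_rpow_of_nonneg _ _ (by positivity)]

theorem rearrNorm_le_kNorm [SigmaFinite μ] (hφ : Measurable φ) (P : ℝ) (q : ℝ≥0∞) :
    rearrNorm P q μ φ ≤ kNorm P q μ φ := by
  refine eLpNorm_mono_enorm fun x => ?_
  simp only [enorm_eq_self]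
  calc _ = ENNReal.ofReal (Real.exp (x * (1 / P - 1))) *
        (ENNReal.ofReal (Real.exp x) * rearr μ φ (Real.exp x)) := by
        rw [← mul_assoc, ← ENNReal.ofReal_mul (Real.exp_pos _).le, ← Real.exp_add]
        congr 3; ring
    _ ≤ _ := by
        gcongr
        exact mul_rearr_le_kfun hφ (Real.exp_pos x)

/-- This is Hardy's inequality. In logarithmic variables the average of the rearrangement over (0,
exp x) is a convolution with exp((1 - 1/P)u) on u < 0. The mass of this kernel is the constant,
finite because P > 1. -/
theorem kNorm_le_rearrNorm [SigmaFinite μ] (hφ : Measurable φ) {P : ℝ} (hP : 1 < P) {q : ℝ≥0∞}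
    (hq : 1 ≤ q) :
    kNorm P q μ φ ≤ ENNReal.ofReal (1 / (1 - 1 / P)) * rearrNorm P q μ φ := by
  have hc : 0 < 1 - 1 / P := by
    rw [sub_pos, div_lt_one (by linarith)]; exact hP
  let k : ℝ → ℝ≥0∞ := (Iio 0).indicator fun u => ENNReal.ofReal (Real.exp ((1 - 1 / P) * u))
  have hk : Measurable k := Measurable.indicator (by fun_prop) measurableSet_Iio
  let G : ℝ → ℝ≥0∞ := fun x => ENNReal.ofReal (Real.exp (x / P)) * rearr μ φ (Real.exp x)
  have hG : Measurable G := by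
    have := (measurable_rearr μ φ).comp Real.measurable_exp
    exact Measurable.mul (by fun_prop) this
  have hkint : ∫⁻ z, k z = ENNReal.ofReal (1 / (1 - 1 / P)) := by
    rw [lintegral_indicator measurableSet_Iio, lintegral_exp_Iio hc]; simp
  rw [← hkint]
  refine le_trans ?_ (eLpNorm_lintegral_mul_comp_add_le hk hG hq)
  refine eLpNorm_mono_enorm fun x => ?_
  simp only [enorm_eq_self]
  calc _ ≤ ENNReal.ofReal (Real.exp (x * (1 / P - 1))) *
        ∫⁻ y in Ioi (0 : ℝ), (Iio (Real.exp x)).indicator 1 y * rearr μ φ y := by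
        gcongr
        exact kfun_le_lintegral_rearr hφ _
    _ = ∫⁻ z, k (-x + z) * G z := by
        rw [lintegral_Ioi_zero_eq_lintegral_exp, ← lintegral_const_mul' _ _ ENNReal.ofReal_ne_top]
        refine lintegral_congr fun z => ?_
        by_cases hz : z < x
        · have h1 : Real.exp z ∈ Iio (Real.exp x) := Real.exp_lt_exp.2 hz
          have h2 : -x + z ∈ Iio (0 : ℝ) := by simp; linarith
          simp only [k, h1, h2, indicator_of_mem, Pi.one_apply, one_mul, G]
          rw [← mul_assoc, ← mul_assoc, ← ENNReal.ofReal_mul (Real.exp_pos _).le,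
            ← ENNReal.ofReal_mul (Real.exp_pos _).le, ← Real.exp_add, ← Real.exp_add]
          congr 3; ring
        · have h1 : Real.exp z ∉ Iio (Real.exp x) := by simpa using hz
          have h2 : -x + z ∉ Iio (0 : ℝ) := by simp; linarith
          simp [k, h1, h2]
    _ = ∫⁻ z, k z * G (x + z) := by
        rw [← lintegral_add_left_eq_self _ x]
        simp

end LorentzNorms

/-! ### The case L^{P,P} = L^P and monotonicity in the second index. -/

section RearrangementNorms

variable {α : Type*} [MeasurableSpace α] {μ : Measure α} {φ : α → ℝ≥0∞}

/-- A kernel decaying exponentially on both sides is integrable; every interpolation below ends with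
such a kernel. The factor exp b comes from integrating the right branch over u > -1, which after
reflection is an open half-line containing all -u with u ≥ 0. -/
theorem lintegral_min_exp_le {a b : ℝ} (ha : 0 < a) (hb : 0 < b) :
    ∫⁻ u : ℝ, min (ENNReal.ofReal (Real.exp (a * u))) (ENNReal.ofReal (Real.exp (-b * u))) ≤
      ENNReal.ofReal (1 / a + Real.exp b / b) := by
  have hm1 : Measurable ((Iio (0 : ℝ)).indicator fun u => ENNReal.ofReal (Real.exp (a * u))) :=
    Measurable.indicator (by fun_prop) measurableSet_Iio
  calc _ ≤ ∫⁻ u : ℝ, ((Iio (0 : ℝ)).indicator (fun u => ENNReal.ofReal (Real.exp (a * u))) u +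
        (Iio (1 : ℝ)).indicator (fun u => ENNReal.ofReal (Real.exp (b * u))) (-u)) := by
        refine lintegral_mono fun u => ?_
        by_cases hu : u < 0
        · have : u ∈ Iio (0 : ℝ) := hu
          rw [indicator_of_mem this]
          exact (min_le_left _ _).trans le_self_add
        · have : -u ∈ Iio (1 : ℝ) := by simp; linarith
          rw [indicator_of_mem this]
          refine (min_le_right _ _).trans ((le_of_eq ?_).trans le_add_self)
          congr 2; ring
    _ = _ := by
        rw [lintegral_add_left hm1, lintegral_neg_eq_self
          (fun u => (Iio (1 : ℝ)).indicator (fun u => ENNReal.ofReal (Real.exp (b * u))) u),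
          lintegral_indicator measurableSet_Iio, lintegral_indicator measurableSet_Iio,
          lintegral_exp_Iio ha, lintegral_exp_Iio hb, ENNReal.ofReal_add (by positivity)
          (by positivity)]
        simp

theorem rearrNorm_self [SFinite μ] (hφ : Measurable φ) {P : ℝ} (hP : 0 < P) :
    rearrNorm P (ENNReal.ofReal P) μ φ = eLpNorm φ (ENNReal.ofReal P) μ := by
  have hq : ENNReal.ofReal P ≠ 0 := by simpa using hP
  have hS : MeasurableSet {z : α × ℝ | ENNReal.ofReal (Real.exp z.2) < φ z.1} :=
    measurableSet_lt (ENNReal.measurable_ofReal.comp (Real.measurable_exp.comp measurable_snd))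
      (hφ.comp measurable_fst)
  have hm : Measurable fun z : α × ℝ => {z : α × ℝ | ENNReal.ofReal (Real.exp z.2) < φ z.1}.indicator
      (fun z => ENNReal.ofReal (Real.exp (P * z.2))) z := Measurable.indicator (by fun_prop) hS
  rw [← distrNorm_eq_rearrNorm hP hq, distrNorm,
    eLpNorm_eq_lintegral_rpow_enorm_toReal hq ENNReal.ofReal_ne_top,
    eLpNorm_eq_lintegral_rpow_enorm_toReal hq ENNReal.ofReal_ne_top, ENNReal.toReal_ofReal hP.le,
    ← ENNReal.mul_rpow_of_nonneg _ _ (by positivity)]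
  simp only [enorm_eq_self]
  congr 1
  calc _ = ENNReal.ofReal P * ∫⁻ x : ℝ, ∫⁻ y, {z : α × ℝ | ENNReal.ofReal (Real.exp z.2) < φ z.1}.indicator
          (fun z => ENNReal.ofReal (Real.exp (P * z.2))) (y, x) ∂μ := by
        congr 1
        refine lintegral_congr fun x => ?_
        rw [ENNReal.mul_rpow_of_nonneg _ _ hP.le, ← ENNReal.rpow_mul, one_div_mul_cancel hP.ne',
          ENNReal.rpow_one, ENNReal.ofReal_rpow_of_pos (Real.exp_pos x), ← Real.exp_mul,
          mul_comm x P, distr]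
        have hms : MeasurableSet {y | ENNReal.ofReal (Real.exp x) < φ y} :=
          measurableSet_lt measurable_const hφ
        rw [← setLIntegral_const, ← lintegral_indicator hms]
        rfl
    _ = ENNReal.ofReal P * ∫⁻ y, (∫⁻ x : ℝ, {z : α × ℝ | ENNReal.ofReal (Real.exp z.2) < φ z.1}.indicator
          (fun z => ENNReal.ofReal (Real.exp (P * z.2))) (y, x)) ∂μ := by
        congr 1
        exact lintegral_lintegral_swap (hm.comp measurable_swap).aemeasurable
    _ = _ := by
        rw [← lintegral_const_mul' _ _ ENNReal.ofReal_ne_top]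
        refine lintegral_congr fun y => ?_
        rw [rpow_eq_lintegral_exp hP (φ y), ← lintegral_indicator (measurableSet_exp_lt _)]
        rfl

/-- Since the rearrangement decreases, its weighted value at z is controlled by its L^P mass on [z -
1, z]. Hence G is bounded by a multiple of its own L^P norm, and G^S = G^{S-P} G^P. -/
theorem rearrNorm_le_of_lt {P S : ℝ} (hP : 0 < P) (hPS : P < S) :
    rearrNorm P (ENNReal.ofReal S) μ φ ≤
      ENNReal.ofReal (Real.exp (1 / P) ^ ((S - P) / S)) * rearrNorm P (ENNReal.ofReal P) μ φ := by
  have hS : 0 < S := hP.trans hPS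
  let G : ℝ → ℝ≥0∞ := fun x => ENNReal.ofReal (Real.exp (x / P)) * rearr μ φ (Real.exp x)
  have hG : Measurable G := by
    have := (measurable_rearr μ φ).comp Real.measurable_exp
    exact Measurable.mul (by fun_prop) this
  have hPq : ENNReal.ofReal P ≠ 0 := by simpa using hP
  have hSq : ENNReal.ofReal S ≠ 0 := by simpa using hS
  set M := rearrNorm P (ENNReal.ofReal P) μ φ with hM
  have hMP : ∫⁻ x, G x ^ P = M ^ P := by
    rw [hM, rearrNorm, eLpNorm_eq_lintegral_rpow_enorm_toReal hPq ENNReal.ofReal_ne_top,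
      ENNReal.toReal_ofReal hP.le, ← ENNReal.rpow_mul, one_div_mul_cancel hP.ne', ENNReal.rpow_one]
    rfl
  have hpt : ∀ z, G z ≤ ENNReal.ofReal (Real.exp (1 / P)) * M := by
    intro z
    have h1 : (ENNReal.ofReal (Real.exp ((z - 1) / P)) * rearr μ φ (Real.exp z)) ^ P ≤ M ^ P := by
      rw [← hMP]
      calc _ = ∫⁻ x in Icc (z - 1) z,
            (ENNReal.ofReal (Real.exp ((z - 1) / P)) * rearr μ φ (Real.exp z)) ^ P := by
            rw [setLIntegral_const]; simp
        _ ≤ ∫⁻ x in Icc (z - 1) z, G x ^ P := by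
            refine setLIntegral_mono' measurableSet_Icc fun x hx => ?_
            refine ENNReal.rpow_le_rpow (mul_le_mul' ?_ ?_) hP.le
            · have := hx.1
              gcongr
            · exact rearr_antitone μ φ (Real.exp_le_exp.2 hx.2)
        _ ≤ _ := setLIntegral_le_lintegral _ _
    rw [ENNReal.rpow_le_rpow_iff hP] at h1
    calc G z = ENNReal.ofReal (Real.exp (1 / P)) *
          (ENNReal.ofReal (Real.exp ((z - 1) / P)) * rearr μ φ (Real.exp z)) := by
          rw [← mul_assoc, ← ENNReal.ofReal_mul (Real.exp_pos _).le, ← Real.exp_add]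
          simp only [G]
          congr 3
          ring
      _ ≤ _ := by gcongr
  rw [rearrNorm, eLpNorm_eq_lintegral_rpow_enorm_toReal hSq ENNReal.ofReal_ne_top,
    ENNReal.toReal_ofReal hS.le, one_div, ENNReal.rpow_inv_le_iff hS]
  calc ∫⁻ x, G x ^ S ≤ ∫⁻ x, (ENNReal.ofReal (Real.exp (1 / P)) * M) ^ (S - P) * G x ^ P := by
        refine lintegral_mono fun x => ?_
        calc G x ^ S = G x ^ (S - P) * G x ^ P := by
              rw [← ENNReal.rpow_add_of_nonneg _ _ (by linarith) hP.le]; congr 1; ring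
          _ ≤ _ := by
              gcongr
              exact hpt x
    _ = (ENNReal.ofReal (Real.exp (1 / P)) * M) ^ (S - P) * M ^ P := by
        rw [lintegral_const_mul _ (hG.pow_const P), hMP]
    _ = _ := by
        rw [ENNReal.mul_rpow_of_nonneg _ _ (by linarith), ENNReal.mul_rpow_of_nonneg _ _ hS.le,
          mul_assoc, ← ENNReal.rpow_add_of_nonneg _ _ (by linarith) hP.le,
          ENNReal.ofReal_rpow_of_pos (Real.exp_pos _),
          ENNReal.ofReal_rpow_of_pos (Real.rpow_pos_of_pos (Real.exp_pos _) _), ← Real.rpow_mul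
          (Real.exp_pos _).le, div_mul_cancel₀ _ hS.ne']
        congr 2; ring

end RearrangementNorms

/-! ### Fractional integration and the Hardy–Littlewood–Sobolev inequality. -/

section FractionalIntegral

/-- The one-sided fractional integral `t ↦ ∫_0^∞ τ^{-δ} h(t - τ) dτ`. -/
def fracInt (δ : ℝ) (h : ℝ → ℝ≥0∞) (t : ℝ) : ℝ≥0∞ :=
  ∫⁻ τ in Ioi (0 : ℝ), ENNReal.ofReal (τ ^ (-δ)) * h (t - τ)

theorem measurable_rpow_kernel (δ : ℝ) : Measurable fun τ : ℝ => ENNReal.ofReal (τ ^ (-δ)) := by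
  fun_prop

theorem measurable_fracInt (δ : ℝ) {h : ℝ → ℝ≥0∞} (hh : Measurable h) :
    Measurable (fracInt δ h) := by
  refine Measurable.lintegral_prod_right' (f := fun z : ℝ × ℝ =>
    ENNReal.ofReal (z.2 ^ (-δ)) * h (z.1 - z.2)) ?_
  exact ((measurable_rpow_kernel δ).comp measurable_snd).mul
    (hh.comp (measurable_fst.sub measurable_snd))

theorem lintegral_rpow_Iio {δ m : ℝ} (hδ : δ < 1) (hm : 0 < m) :
    ∫⁻ τ in Ioi (0 : ℝ), (Iio m).indicator (fun τ => ENNReal.ofReal (τ ^ (-δ))) τ =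
      ENNReal.ofReal (m ^ (1 - δ) / (1 - δ)) := by
  have hc : 0 < 1 - δ := by linarith
  have e : Real.exp ((1 - δ) * Real.log m) = m ^ (1 - δ) := by
    rw [Real.rpow_def_of_pos hm, mul_comm]
  rw [lintegral_Ioi_zero_eq_lintegral_exp, ← e, ← lintegral_exp_Iio hc,
    ← lintegral_indicator measurableSet_Iio]
  refine lintegral_congr fun x => ?_
  by_cases hx : x < Real.log m
  · have h1 : Real.exp x ∈ Iio m := (Real.lt_log_iff_exp_lt hm).1 hx
    have h2 : x ∈ Iio (Real.log m) := hx
    rw [indicator_of_mem h1, indicator_of_mem h2, ← ENNReal.ofReal_mul (Real.exp_pos _).le,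
      ← Real.exp_mul, ← Real.exp_add]
    congr 2; ring
  · have h1 : Real.exp x ∉ Iio m := fun h => hx ((Real.lt_log_iff_exp_lt hm).2 h)
    have h2 : x ∉ Iio (Real.log m) := hx
    simp [h1, h2]

/-- Bathtub principle: a bounded density of mass m does best near the singularity. On τ < m use v ≤
1; on τ ≥ m the kernel is at most m^{-δ}. -/
theorem lintegral_rpow_mul_le {δ m : ℝ} (hδ0 : 0 < δ) (hδ : δ < 1) (hm : 0 < m) {v : ℝ → ℝ≥0∞}
    (hv : ∀ x, v x ≤ 1) (hvm : ∫⁻ τ in Ioi (0 : ℝ), v τ ≤ ENNReal.ofReal m) :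
    ∫⁻ τ in Ioi (0 : ℝ), ENNReal.ofReal (τ ^ (-δ)) * v τ ≤
      ENNReal.ofReal ((1 / (1 - δ) + 1) * m ^ (1 - δ)) := by
  have hc : 0 < 1 - δ := by linarith
  calc _ ≤ ∫⁻ τ in Ioi (0 : ℝ), ((Iio m).indicator (fun τ => ENNReal.ofReal (τ ^ (-δ))) τ +
        ENNReal.ofReal (m ^ (-δ)) * v τ) := by
        refine lintegral_mono fun τ => ?_
        by_cases hτ : τ < m
        · have : τ ∈ Iio m := hτ
          rw [indicator_of_mem this]
          exact (mul_le_of_le_one_right' (hv τ)).trans le_self_add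
        · refine le_trans ?_ le_add_self
          gcongr ?_ * _
          exact ENNReal.ofReal_le_ofReal
            (Real.rpow_le_rpow_of_nonpos hm (not_lt.1 hτ) (by linarith))
    _ ≤ ENNReal.ofReal (m ^ (1 - δ) / (1 - δ)) + ENNReal.ofReal (m ^ (-δ)) * ENNReal.ofReal m := by
        rw [lintegral_add_left ((measurable_rpow_kernel δ).indicator measurableSet_Iio),
          lintegral_rpow_Iio hδ hm, lintegral_const_mul' _ _ ENNReal.ofReal_ne_top]
        gcongr
    _ = _ := by
        rw [← ENNReal.ofReal_mul (by positivity), ← ENNReal.ofReal_add (by positivity)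
          (by positivity)]
        congr 1
        have : m ^ (-δ) * m = m ^ (1 - δ) := by
          nth_rewrite 2 [← Real.rpow_one m]
          rw [← Real.rpow_add hm]; congr 1; ring
        rw [this]; ring

/-- The fractional integral is transposed onto the weight w. The resulting pairing with the
indicator of F is bounded by the bathtub estimate in two ways, using the mass m of w or the measure
of F; the minimum of the two enters `lintegral_mul_le_rearr`. -/
theorem kfun_fracInt_le {δ m : ℝ} (hδ0 : 0 < δ) (hδ : δ < 1) (hm : 0 < m) {h : ℝ → ℝ≥0∞}
    (hh : Measurable h) :
    kfun volume (fracInt δ h) m ≤ ENNReal.ofReal (1 / (1 - δ) + 1) *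
      ∫⁻ z in Ioi (0 : ℝ), ENNReal.ofReal (min (m ^ (1 - δ)) (m * z ^ (-δ))) *
        rearr volume h z := by
  have hc : 0 < 1 - δ := by linarith
  set C := 1 / (1 - δ) + 1 with hC
  have hC0 : 0 < C := by positivity
  refine kfun_le fun w hw h1 hwm => ?_
  have hk := measurable_rpow_kernel δ
  let v : ℝ → ℝ≥0∞ := fun s => ∫⁻ τ in Ioi (0 : ℝ), ENNReal.ofReal (τ ^ (-δ)) * w (s + τ)
  have hv : Measurable v := by
    refine Measurable.lintegral_prod_right' (f := fun z : ℝ × ℝ =>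
      ENNReal.ofReal (z.2 ^ (-δ)) * w (z.1 + z.2)) ?_
    exact (hk.comp measurable_snd).mul (hw.comp (measurable_fst.add measurable_snd))
  have swap : ∀ g : ℝ → ℝ≥0∞, Measurable g → ∫⁻ t, w t * fracInt δ g t = ∫⁻ s, v s * g s := by
    intro g hg
    calc ∫⁻ t, w t * fracInt δ g t
        = ∫⁻ t, ∫⁻ τ in Ioi (0 : ℝ), w t * (ENNReal.ofReal (τ ^ (-δ)) * g (t - τ)) := by
          refine lintegral_congr fun t => ?_
          rw [lintegral_const_mul]
          · rfl
          · exact hk.mul (hg.comp (measurable_const.sub measurable_id))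
      _ = ∫⁻ τ in Ioi (0 : ℝ), ∫⁻ t, w t * (ENNReal.ofReal (τ ^ (-δ)) * g (t - τ)) := by
          refine lintegral_lintegral_swap (Measurable.aemeasurable ?_)
          exact (hw.comp measurable_fst).mul ((hk.comp measurable_snd).mul
            (hg.comp (measurable_fst.sub measurable_snd)))
      _ = ∫⁻ τ in Ioi (0 : ℝ), ∫⁻ s, ENNReal.ofReal (τ ^ (-δ)) * w (s + τ) * g s := by
          refine lintegral_congr fun τ => ?_
          rw [← lintegral_add_right_eq_self _ τ]
          refine lintegral_congr fun s => ?_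
          rw [add_sub_cancel_right]; ring
      _ = ∫⁻ s, ∫⁻ τ in Ioi (0 : ℝ), ENNReal.ofReal (τ ^ (-δ)) * w (s + τ) * g s := by
          refine lintegral_lintegral_swap (Measurable.aemeasurable ?_)
          exact ((hk.comp measurable_fst).mul (hw.comp (measurable_snd.add measurable_fst))).mul
            (hg.comp measurable_snd)
      _ = _ := by
          refine lintegral_congr fun s => ?_
          rw [lintegral_mul_const]
          exact hk.mul (hw.comp (measurable_const.add measurable_id))
  rw [swap h hh, ← lintegral_const_mul' _ _ ENNReal.ofReal_ne_top]
  simp_rw [← mul_assoc]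
  refine lintegral_mul_le_rearr hv hh (by fun_prop) fun F hF hFt => ?_
  rcases eq_or_ne (volume F) 0 with hF0 | hF0
  · rw [setLIntegral_measure_zero _ _ hF0]; exact zero_le
  set y := (volume F).toReal with hy
  have hy0 : 0 < y := ENNReal.toReal_pos hF0 hFt.ne
  have hFy : volume F = ENNReal.ofReal y := (ENNReal.ofReal_toReal hFt.ne).symm
  have b1 : ∫⁻ s in F, v s ≤ ENNReal.ofReal (C * m ^ (1 - δ)) * ENNReal.ofReal y := by
    rw [← hFy, ← setLIntegral_const]
    refine lintegral_mono fun s => lintegral_rpow_mul_le hδ0 hδ hm (fun x => h1 _) ?_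
    refine (setLIntegral_le_lintegral _ _).trans ?_
    rw [lintegral_add_left_eq_self w s]
    exact hwm
  -- Transposing back puts the fractional integral on the indicator of F, where the bathtub bound
  -- sees the measure y.
  have b2 : ∫⁻ s in F, v s ≤ ENNReal.ofReal (C * y ^ (1 - δ)) * ENNReal.ofReal m := by
    have e : ∫⁻ s in F, v s = ∫⁻ s, v s * F.indicator 1 s := by
      rw [← lintegral_indicator hF]
      refine lintegral_congr fun s => ?_
      by_cases hs : s ∈ F <;> simp [hs]
    rw [e, ← swap _ (measurable_one.indicator hF)]
    calc _ ≤ ∫⁻ t, w t * ENNReal.ofReal (C * y ^ (1 - δ)) := by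
          refine lintegral_mono fun t => mul_le_mul_right (lintegral_rpow_mul_le hδ0 hδ hy0
            (v := fun τ => F.indicator 1 (t - τ))
            (fun x => indicator_le_self' (f := fun _ => (1 : ℝ≥0∞)) (fun _ _ => zero_le) _) ?_) _
          refine (setLIntegral_le_lintegral _ _).trans ?_
          rw [lintegral_sub_left_eq_self (F.indicator 1) t, lintegral_indicator_one hF, hFy]
      _ ≤ _ := by
          rw [lintegral_mul_const _ hw, mul_comm]
          gcongr
  calc ∫⁻ s in F, v s
      ≤ ENNReal.ofReal (C * min (m ^ (1 - δ)) (m * y ^ (-δ))) * ENNReal.ofReal y := by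
        rw [mul_min_of_nonneg _ _ hC0.le]
        rcases min_choice (C * m ^ (1 - δ)) (C * (m * y ^ (-δ))) with hmin | hmin
        · rw [hmin]; exact b1
        · rw [hmin]
          refine b2.trans (le_of_eq ?_)
          rw [← ENNReal.ofReal_mul (by positivity), ← ENNReal.ofReal_mul (by positivity)]
          congr 1
          have : y ^ (-δ) * y = y ^ (1 - δ) := by
            nth_rewrite 2 [← Real.rpow_one y]
            rw [← Real.rpow_add hy0]; congr 1; ring
          rw [← this]; ring
    _ = ∫⁻ z in {z : ℝ | 0 < z ∧ ENNReal.ofReal z < volume F},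
          ENNReal.ofReal (C * min (m ^ (1 - δ)) (m * y ^ (-δ))) := by
        rw [setLIntegral_const, volume_setOf_ofReal_lt, hFy]
    _ ≤ _ := by
        refine setLIntegral_mono' (measurableSet_setOf_ofReal_lt _) fun z hz => ?_
        rw [← ENNReal.ofReal_mul hC0.le]
        have hzy : z ≤ y := by
          have := hz.2
          rw [hFy] at this
          exact (ENNReal.ofReal_lt_ofReal_iff_of_nonneg hz.1.le).1 this |>.le
        have : y ^ (-δ) ≤ z ^ (-δ) := Real.rpow_le_rpow_of_nonpos hz.1 hzy (by linarith)
        gcongr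

/-- The Hardy–Littlewood–Sobolev inequality on the line. -/
theorem exists_eLpNorm_fracInt_le {δ A S : ℝ} (hδ0 : 0 < δ) (hδ : δ < 1) (hS : 1 < S)
    (hSδ : 1 / S < δ) (hA : 1 / A = 1 - δ + 1 / S) :
    ∃ C : ℝ, 0 < C ∧ ∀ h : ℝ → ℝ≥0∞, Measurable h →
      eLpNorm (fracInt δ h) (ENNReal.ofReal S) volume ≤
        ENNReal.ofReal C * eLpNorm h (ENNReal.ofReal A) volume := by
  have hc : 0 < 1 - δ := by linarith
  have hS0 : 0 < S := by linarith
  have hinvA : 0 < 1 / A := by rw [hA]; positivity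
  have hA0 : 0 < A := one_div_pos.1 hinvA
  have hAS : A < S := by
    rw [← one_div_lt_one_div hS0 hA0, hA]; linarith
  have ha : 0 < δ - 1 / S := by linarith
  have hb : 0 < 1 / S := by positivity
  refine ⟨(1 / (1 - δ) + 1) * (1 / (δ - 1 / S) + Real.exp (1 / S) / (1 / S)) *
    Real.exp (1 / A) ^ ((S - A) / S), by positivity, fun h hh => ?_⟩
  have hSq : (1 : ℝ≥0∞) ≤ ENNReal.ofReal S := by simpa using hS.le
  -- With the weights exp(x(1/S - 1)) and exp(z/A), the two branches of the minimum depend only on u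
  -- = z - x. The rates δ - 1/S and 1/S are both positive.
  let k : ℝ → ℝ≥0∞ := fun u =>
    min (ENNReal.ofReal (Real.exp ((δ - 1 / S) * u))) (ENNReal.ofReal (Real.exp (-(1 / S) * u)))
  have hk : Measurable k := by fun_prop
  let G : ℝ → ℝ≥0∞ := fun x => ENNReal.ofReal (Real.exp (x / A)) * rearr volume h (Real.exp x)
  have hG : Measurable G := by
    have := (measurable_rearr volume h).comp Real.measurable_exp
    exact Measurable.mul (by fun_prop) this
  have step : kNorm S (ENNReal.ofReal S) volume (fracInt δ h) ≤
      ENNReal.ofReal (1 / (1 - δ) + 1) * (ENNReal.ofReal (1 / (δ - 1 / S) +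
        Real.exp (1 / S) / (1 / S)) * rearrNorm A (ENNReal.ofReal S) volume h) := by
    calc kNorm S (ENNReal.ofReal S) volume (fracInt δ h)
        ≤ ENNReal.ofReal (1 / (1 - δ) + 1) *
          eLpNorm (fun x => ∫⁻ z, k z * G (x + z)) (ENNReal.ofReal S) volume := by
          have := eLpNorm_le_nnreal_smul_eLpNorm_of_ae_le_mul' (μ := volume)
            (f := fun x : ℝ => ENNReal.ofReal (Real.exp (x * (1 / S - 1))) *
              kfun volume (fracInt δ h) (Real.exp x))
            (g := fun x => ∫⁻ z, k z * G (x + z)) (c := (1 / (1 - δ) + 1).toNNReal)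
            (Eventually.of_forall fun x => ?_) (ENNReal.ofReal S)
          · exact this
          simp only [enorm_eq_self]
          calc _ ≤ ENNReal.ofReal (Real.exp (x * (1 / S - 1))) *
                (ENNReal.ofReal (1 / (1 - δ) + 1) *
                ∫⁻ z in Ioi (0 : ℝ), ENNReal.ofReal (min (Real.exp x ^ (1 - δ))
                  (Real.exp x * z ^ (-δ))) * rearr volume h z) := by
                gcongr
                exact kfun_fracInt_le hδ0 hδ (Real.exp_pos x) hh
            _ = ENNReal.ofReal (1 / (1 - δ) + 1) * ∫⁻ z, k (-x + z) * G z := by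
                rw [mul_left_comm]
                congr 1
                rw [lintegral_Ioi_zero_eq_lintegral_exp,
                  ← lintegral_const_mul' _ _ ENNReal.ofReal_ne_top]
                refine lintegral_congr fun z => ?_
                simp only [k, G]
                rw [← mul_assoc, ← mul_assoc, ← mul_assoc,
                  ← (ENNReal.ofReal_mono).map_min, ← ENNReal.ofReal_mul (Real.exp_pos _).le,
                  ← ENNReal.ofReal_mul (by positivity), ← ENNReal.ofReal_mul (by positivity),
                  ← Real.exp_mul, ← Real.exp_mul, ← Real.exp_add, ← Real.exp_add,
                  mul_min_of_nonneg _ _ (Real.exp_pos _).le,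
                  min_mul_of_nonneg _ _ (Real.exp_pos _).le, ← Real.exp_add, ← Real.exp_add,
                  ← Real.exp_add, ← Real.exp_add]
                have hzA : z / A = z * (1 - δ + 1 / S) := by rw [← hA]; ring
                rw [hzA]
                congr 4 <;> ring
            _ = _ := by
                rw [← lintegral_add_left_eq_self _ x]
                simp [ENNReal.ofReal]
      _ ≤ _ := by
          gcongr
          refine (eLpNorm_lintegral_mul_comp_add_le hk hG hSq).trans ?_
          gcongr
          · exact lintegral_min_exp_le ha hb
          · exact le_rfl
  -- The convolution bound goes from L^{A,S} to L^{S,S} = L^S; the inclusion L^A = L^{A,A} ⊂ L^{A,S}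
  -- holds as A < S.
  calc eLpNorm (fracInt δ h) (ENNReal.ofReal S) volume
      = rearrNorm S (ENNReal.ofReal S) volume (fracInt δ h) :=
        (rearrNorm_self (measurable_fracInt δ hh) hS0).symm
    _ ≤ _ := rearrNorm_le_kNorm (measurable_fracInt δ hh) _ _
    _ ≤ _ := step
    _ ≤ ENNReal.ofReal (1 / (1 - δ) + 1) * (ENNReal.ofReal (1 / (δ - 1 / S) +
        Real.exp (1 / S) / (1 / S)) * (ENNReal.ofReal (Real.exp (1 / A) ^ ((S - A) / S)) *
          eLpNorm h (ENNReal.ofReal A) volume)) := by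
        rw [← rearrNorm_self hh hA0]
        gcongr
        exact rearrNorm_le_of_lt hA0 hAS
    _ = _ := by
        rw [← mul_assoc, ← mul_assoc, ← ENNReal.ofReal_mul (by positivity),
          ← ENNReal.ofReal_mul (by positivity)]

end FractionalIntegral

/-! ### Lorentz spaces as normed spaces, with the K-functional norm. -/

section LorentzSpace

variable {N : ℕ} {P : ℝ} {q : ℝ≥0∞}

theorem measurable_enorm_coe (φ : Fn N) : Measurable fun x => ‖φ x‖ₑ :=
  φ.stronglyMeasurable.measurable.enorm

/-- The `K`-functional norm of `L^{P,q}(ℝ^N)`. -/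
def fnorm (P : ℝ) (q : ℝ≥0∞) (φ : Fn N) : ℝ≥0∞ := kNorm P q volume fun x => ‖φ x‖ₑ

theorem lorentzNorm_eq_rearrNorm {p : ℝ≥0∞} (hp0 : p ≠ 0) (hpt : p ≠ ∞) (hq : 1 ≤ q) (φ : Fn N) :
    lorentzNorm p q φ = rearrNorm p.toReal q volume fun x => ‖φ x‖ₑ := by
  rw [← distrNorm_eq_rearrNorm (ENNReal.toReal_pos hp0 hpt) (zero_lt_one.trans_le hq).ne',
    lorentzNorm, eLpNorm_haarPos, distrNorm, ENNReal.ofReal_toReal hpt]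
  congr 2
  funext x
  congr 2
  simp only [distFun, distr, ← ofReal_norm,
    ENNReal.ofReal_lt_ofReal_iff_of_nonneg (Real.exp_pos x).le]

theorem lorentzNorm_le_fnorm {p : ℝ≥0∞} (hp0 : p ≠ 0) (hpt : p ≠ ∞) (hq : 1 ≤ q) (φ : Fn N) :
    lorentzNorm p q φ ≤ fnorm p.toReal q φ := by
  rw [lorentzNorm_eq_rearrNorm hp0 hpt hq]
  exact rearrNorm_le_kNorm (measurable_enorm_coe φ) _ _

theorem fnorm_le_lorentzNorm {p : ℝ≥0∞} (hp1 : 1 < p) (hpt : p ≠ ∞) (hq : 1 ≤ q) (φ : Fn N) :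
    fnorm p.toReal q φ ≤ ENNReal.ofReal (1 / (1 - 1 / p.toReal)) * lorentzNorm p q φ := by
  rw [lorentzNorm_eq_rearrNorm (zero_lt_one.trans hp1).ne' hpt hq]
  refine kNorm_le_rearrNorm (measurable_enorm_coe φ) ?_ hq
  rw [← ENNReal.toReal_one]
  exact (ENNReal.toReal_lt_toReal ENNReal.one_ne_top hpt).2 hp1

theorem measurable_kNorm_integrand (P : ℝ) {α : Type*} [MeasurableSpace α] (μ : Measure α)
    (φ : α → ℝ≥0∞) :
    Measurable fun x : ℝ => ENNReal.ofReal (Real.exp (x * (1 / P - 1))) * kfun μ φ (Real.exp x) := by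
  have := (measurable_kfun μ φ).comp Real.measurable_exp
  exact Measurable.mul (by fun_prop) this

theorem kfun_coe_add_le (φ ψ : Fn N) (m : ℝ) :
    kfun volume (fun x => ‖(φ + ψ) x‖ₑ) m ≤
      kfun volume (fun x => ‖φ x‖ₑ) m + kfun volume (fun x => ‖ψ x‖ₑ) m := by
  refine le_trans (kfun_mono_ae ?_) (kfun_add_le (measurable_enorm_coe φ).aemeasurable m)
  filter_upwards [AEEqFun.coeFn_add φ ψ] with x hx
  rw [hx]
  exact enorm_add_le _ _

theorem kfun_coe_smul (c : ℂ) (φ : Fn N) (m : ℝ) :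
    kfun volume (fun x => ‖(c • φ) x‖ₑ) m = ‖c‖ₑ * kfun volume (fun x => ‖φ x‖ₑ) m := by
  rw [← kfun_const_mul _ enorm_ne_top]
  refine le_antisymm (kfun_mono_ae ?_) (kfun_mono_ae ?_) <;>
  · filter_upwards [AEEqFun.coeFn_smul c φ] with x hx
    rw [hx, Pi.smul_apply, enorm_smul]

theorem kfun_coe_sub_le (φ ψ : Fn N) (m : ℝ) :
    kfun volume (fun x => ‖φ x‖ₑ) m ≤
      kfun volume (fun x => ‖ψ x‖ₑ) m + kfun volume (fun x => ‖(φ - ψ) x‖ₑ) m := by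
  simpa using kfun_coe_add_le ψ (φ - ψ) m

theorem fnorm_add_le (hq : 1 ≤ q) (φ ψ : Fn N) : fnorm P q (φ + ψ) ≤ fnorm P q φ + fnorm P q ψ := by
  refine le_trans ?_ (eLpNorm_add_le (measurable_kNorm_integrand P volume _).aestronglyMeasurable
    (measurable_kNorm_integrand P volume _).aestronglyMeasurable hq)
  refine eLpNorm_mono_enorm fun x => ?_
  simp only [enorm_eq_self, Pi.add_apply, ← mul_add]
  gcongr
  exact kfun_coe_add_le φ ψ _

theorem fnorm_smul_le (c : ℂ) (φ : Fn N) : fnorm P q (c • φ) ≤ ‖c‖ₑ * fnorm P q φ := by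
  refine eLpNorm_le_nnreal_smul_eLpNorm_of_ae_le_mul' (c := ‖c‖₊) (Eventually.of_forall fun x => ?_) q
  simp only [enorm_eq_self, kfun_coe_smul]
  exact le_of_eq (mul_left_comm _ _ _)

theorem fnorm_smul (c : ℂ) (φ : Fn N) : fnorm P q (c • φ) = ‖c‖ₑ * fnorm P q φ := by
  refine le_antisymm (fnorm_smul_le c φ) ?_
  rcases eq_or_ne c 0 with rfl | hc
  · simp
  have := fnorm_smul_le (P := P) (q := q) c⁻¹ (c • φ)
  rw [smul_smul, inv_mul_cancel₀ hc, one_smul] at this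
  calc ‖c‖ₑ * fnorm P q φ ≤ ‖c‖ₑ * (‖c⁻¹‖ₑ * fnorm P q (c • φ)) := by gcongr
    _ = _ := by rw [← mul_assoc, ← enorm_mul, mul_inv_cancel₀ hc, enorm_one, one_mul]

theorem fnorm_zero : fnorm P q (0 : Fn N) = 0 := by
  have := fnorm_smul (P := P) (q := q) (0 : ℂ) (0 : Fn N)
  rwa [zero_smul ℂ (0 : Fn N), enorm_zero, zero_mul] at this

/-- Pointwise control of the `K`-functional by the Lorentz norm. -/
theorem kfun_exp_le_fnorm (hP : 1 ≤ P) (hq : q ≠ 0) (φ : Fn N) (x : ℝ) :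
    kfun volume (fun x => ‖φ x‖ₑ) (Real.exp x) ≤
      ENNReal.ofReal (Real.exp ((x + 1) * (1 - 1 / P))) * fnorm P q φ := by
  set K := kfun volume (fun x => ‖φ x‖ₑ) (Real.exp x) with hK
  have hc : 0 ≤ 1 - 1 / P := by
    rw [sub_nonneg, div_le_one (by linarith)]; exact hP
  -- On [x, x + 1] the integrand of the norm is at least this constant. Since the interval has
  -- length one, a constant has the same L^q norm for every q.
  have h1 : ENNReal.ofReal (Real.exp (-((x + 1) * (1 - 1 / P)))) * K ≤ fnorm P q φ := by
    calc _ = eLpNorm (fun _ : ℝ => ENNReal.ofReal (Real.exp (-((x + 1) * (1 - 1 / P)))) * K) q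
          (volume.restrict (Icc x (x + 1))) := by
          rw [eLpNorm_const _ hq]
          · simp
          · simp
      _ ≤ eLpNorm (fun x : ℝ => ENNReal.ofReal (Real.exp (x * (1 / P - 1))) *
            kfun volume (fun x => ‖φ x‖ₑ) (Real.exp x)) q (volume.restrict (Icc x (x + 1))) := by
          refine eLpNorm_mono_enorm_ae ?_
          filter_upwards [ae_restrict_mem measurableSet_Icc] with y hy
          simp only [enorm_eq_self]
          gcongr
          · nlinarith [hy.2]
          · exact kfun_monotone _ _ (Real.exp_le_exp.2 hy.1)
      _ ≤ _ := eLpNorm_mono_measure _ Measure.restrict_le_self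
  calc K = ENNReal.ofReal (Real.exp ((x + 1) * (1 - 1 / P))) *
        (ENNReal.ofReal (Real.exp (-((x + 1) * (1 - 1 / P)))) * K) := by
        rw [← mul_assoc, ← ENNReal.ofReal_mul (Real.exp_pos _).le, ← Real.exp_add]
        simp
    _ ≤ _ := by gcongr

/-- The K-functional then vanishes at scale 1, hence at all smaller scales. A superlevel set of
positive measure would make it positive at some such scale. -/
theorem eq_zero_of_fnorm_eq_zero (hP : 1 ≤ P) (hq : q ≠ 0) {φ : Fn N} (h : fnorm P q φ = 0) :
    φ = 0 := by
  have hk : kfun volume (fun x => ‖φ x‖ₑ) (Real.exp 0) = 0 := by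
    have := kfun_exp_le_fnorm hP hq φ 0
    rw [h, mul_zero] at this
    exact le_antisymm this zero_le
  have hall : ∀ l : ℝ, 0 < l → volume {x | ENNReal.ofReal l < ‖φ x‖ₑ} = 0 := by
    intro l hl
    by_contra hne
    have hpos : (0 : ℝ≥0∞) < volume {x | ENNReal.ofReal l < ‖φ x‖ₑ} := pos_iff_ne_zero.2 hne
    obtain ⟨y, hy0, hy⟩ : ∃ y : ℝ, 0 < y ∧ y ≤ 1 ∧
        ENNReal.ofReal y < volume {x | ENNReal.ofReal l < ‖φ x‖ₑ} := by
      obtain ⟨z, hz0, hz⟩ := ENNReal.lt_iff_exists_real_btwn.1 hpos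
      have hz1 : 0 < z := by simpa using hz.1
      exact ⟨min z 1, by positivity, min_le_right _ _,
        (ENNReal.ofReal_le_ofReal (min_le_left _ _)).trans_lt hz.2⟩
    have h1 := mul_rearr_le_kfun (measurable_enorm_coe φ) hy0 (μ := volume)
    have h2 : kfun volume (fun x => ‖φ x‖ₑ) y = 0 :=
      le_antisymm ((kfun_monotone _ _ (by simpa using hy.1)).trans hk.le) zero_le
    have h3 : ENNReal.ofReal l ≤ rearr volume (fun x => ‖φ x‖ₑ) y := ofReal_le_rearr hy.2
    rw [h2] at h1
    have : ENNReal.ofReal y * ENNReal.ofReal l ≤ 0 := (mul_le_mul_right h3 _).trans h1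
    rw [← ENNReal.ofReal_mul hy0.le] at this
    have h4 := mul_pos hy0 hl
    simp at this
    linarith
  have : ∀ᵐ x, φ x = 0 := by
    have h2 : ∀ᵐ x, ∀ n : ℕ, ‖φ x‖ₑ ≤ ENNReal.ofReal (1 / (n + 1)) := by
      refine ae_all_iff.2 fun n => ?_
      rw [ae_iff]
      simpa using hall (1 / (n + 1)) (by positivity)
    filter_upwards [h2] with x hx
    have h3 : Tendsto (fun n : ℕ => ENNReal.ofReal (1 / ((n : ℝ) + 1))) atTop (𝓝 0) := by
      simpa using ENNReal.tendsto_ofReal tendsto_one_div_add_atTop_nhds_zero_nat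
    exact enorm_eq_zero.1 (le_antisymm (ge_of_tendsto' h3 hx) zero_le)
  refine AEEqFun.ext ?_
  filter_upwards [this, AEEqFun.coeFn_zero (α := Space N) (β := ℂ) (μ := volume)] with x h1 h2
  rw [h1, h2]; rfl

/-- The Lorentz space `L^{P,q}(ℝ^N)`. -/
def lorentz (N : ℕ) (P : ℝ) (q : ℝ≥0∞) [hq : Fact (1 ≤ q)] : Submodule ℂ (Fn N) where
  carrier := {φ | fnorm P q φ < ∞}
  add_mem' h1 h2 := (fnorm_add_le hq.out _ _).trans_lt (ENNReal.add_lt_top.2 ⟨h1, h2⟩)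
  zero_mem' := by simp [fnorm_zero]
  smul_mem' c φ h := (fnorm_smul_le c φ).trans_lt (ENNReal.mul_lt_top enorm_lt_top h)

variable [hq : Fact (1 ≤ q)]

instance : Norm (lorentz N P q) := ⟨fun φ => (fnorm P q (φ : Fn N)).toReal⟩

theorem lorentz_norm_def (φ : lorentz N P q) : ‖φ‖ = (fnorm P q (φ : Fn N)).toReal := rfl

theorem ofReal_lorentz_norm (φ : lorentz N P q) :
    ENNReal.ofReal ‖φ‖ = fnorm P q (φ : Fn N) := ENNReal.ofReal_toReal φ.2.ne

variable [hP : Fact (1 ≤ P)]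

variable (N P q) in
theorem lorentz_core : NormedSpace.Core ℂ (lorentz N P q) where
  norm_nonneg φ := ENNReal.toReal_nonneg
  norm_smul c φ := by
    rw [lorentz_norm_def, Submodule.coe_smul, fnorm_smul, ENNReal.toReal_mul]; rfl
  norm_triangle φ ψ := by
    rw [lorentz_norm_def, lorentz_norm_def, lorentz_norm_def,
      ← ENNReal.toReal_add φ.2.ne ψ.2.ne]
    exact ENNReal.toReal_mono (ENNReal.add_ne_top.2 ⟨φ.2.ne, ψ.2.ne⟩) (fnorm_add_le hq.out _ _)
  norm_eq_zero_iff φ := by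
    rw [lorentz_norm_def]
    constructor
    · intro h
      rcases (ENNReal.toReal_eq_zero_iff _).1 h with h | h
      · exact Subtype.ext (eq_zero_of_fnorm_eq_zero hP.out (zero_lt_one.trans_le hq.out).ne' h)
      · exact absurd h φ.2.ne
    · rintro rfl
      simp [fnorm_zero]

instance : NormedAddCommGroup (lorentz N P q) := NormedAddCommGroup.ofCore (lorentz_core N P q)

instance : NormedSpace ℂ (lorentz N P q) := NormedSpace.ofCore (lorentz_core N P q)

theorem lorentz_enorm_def (φ : lorentz N P q) : ‖φ‖ₑ = fnorm P q (φ : Fn N) := by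
  rw [← ofReal_norm, ofReal_lorentz_norm]

/-- The `K`-functional of an element of a Lorentz space. -/
def kf (φ : lorentz N P q) (x : ℝ) : ℝ≥0∞ :=
  kfun volume (fun y => ‖(φ : Fn N) y‖ₑ) (Real.exp x)

theorem kf_le (φ : lorentz N P q) (x : ℝ) :
    kf φ x ≤ ENNReal.ofReal (Real.exp ((x + 1) * (1 - 1 / P))) * ‖φ‖ₑ := by
  rw [lorentz_enorm_def]
  exact kfun_exp_le_fnorm hP.out (zero_lt_one.trans_le hq.out).ne' _ x

theorem kf_lt_top (φ : lorentz N P q) (x : ℝ) : kf φ x < ∞ :=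
  (kf_le φ x).trans_lt (ENNReal.mul_lt_top ENNReal.ofReal_lt_top enorm_lt_top)

theorem kf_continuous (φ : lorentz N P q) : Continuous (kf φ) := by
  rw [continuous_iff_continuousAt]
  intro x
  have hne := (kf_lt_top φ x).ne
  have key : ∀ a b : ℝ, a ≤ b → kf φ b ≤ ENNReal.ofReal (Real.exp (b - a)) * kf φ a := by
    intro a b hab
    have := kfun_mul_le (μ := volume) (φ := fun y => ‖(φ : Fn N) y‖ₑ) (c := Real.exp (b - a))
      (m := Real.exp a) (Real.one_le_exp (by linarith))
    rwa [← Real.exp_add, sub_add_cancel] at this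
  have h1 : Tendsto (fun y => ENNReal.ofReal (min 1 (Real.exp (y - x))) * kf φ x) (𝓝 x)
      (𝓝 (kf φ x)) := by
    have hc : Continuous fun y => min 1 (Real.exp (y - x)) := by fun_prop
    have := ENNReal.Tendsto.mul_const (b := kf φ x)
      (ENNReal.tendsto_ofReal (hc.tendsto x)) (Or.inr hne)
    simpa using this
  have h2 : Tendsto (fun y => ENNReal.ofReal (max 1 (Real.exp (y - x))) * kf φ x) (𝓝 x)
      (𝓝 (kf φ x)) := by
    have hc : Continuous fun y => max 1 (Real.exp (y - x)) := by fun_prop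
    have := ENNReal.Tendsto.mul_const (b := kf φ x)
      (ENNReal.tendsto_ofReal (hc.tendsto x)) (Or.inr hne)
    simpa using this
  refine tendsto_of_tendsto_of_tendsto_of_le_of_le h1 h2 (fun y => ?_) (fun y => ?_)
  · rcases le_total x y with h | h
    · calc _ ≤ 1 * kf φ x := by
            gcongr
            rw [← ENNReal.ofReal_one]
            exact ENNReal.ofReal_le_ofReal (min_le_left _ _)
        _ ≤ kf φ y := by
            rw [one_mul]
            exact kfun_monotone _ _ (Real.exp_le_exp.2 h)
    · calc _ ≤ ENNReal.ofReal (Real.exp (y - x)) *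
            (ENNReal.ofReal (Real.exp (x - y)) * kf φ y) :=
            mul_le_mul' (ENNReal.ofReal_le_ofReal (min_le_right _ _)) (key y x h)
        _ = kf φ y := by
            rw [← mul_assoc, ← ENNReal.ofReal_mul (Real.exp_pos _).le, ← Real.exp_add]; simp
  · rcases le_total x y with h | h
    · refine (key x y h).trans ?_
      gcongr
      exact le_max_right _ _
    · calc kf φ y ≤ 1 * kf φ x := by
            rw [one_mul]
            exact kfun_monotone _ _ (Real.exp_le_exp.2 h)
        _ ≤ _ := by
            gcongr
            rw [← ENNReal.ofReal_one]
            exact ENNReal.ofReal_le_ofReal (le_max_left _ _)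

/-- At a fixed scale the K-functional is subadditive and bounded by a multiple of the norm, so it is
Lipschitz. -/
theorem kf_continuous_left (x : ℝ) : Continuous fun φ : lorentz N P q => kf φ x := by
  have hL : LipschitzWith (Real.exp ((x + 1) * (1 - 1 / P))).toNNReal
      fun φ : lorentz N P q => (kf φ x).toReal := by
    refine LipschitzWith.of_le_add_mul _ fun φ ψ => ?_
    rw [Real.coe_toNNReal _ (Real.exp_pos _).le, dist_eq_norm]
    have h1 : kf φ x ≤ kf ψ x + kf (φ - ψ) x := kfun_coe_sub_le _ _ _
    have h2 := kf_le (φ - ψ) x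
    have h3 := ENNReal.toReal_mono (ENNReal.add_ne_top.2
      ⟨(kf_lt_top ψ x).ne, ENNReal.mul_ne_top ENNReal.ofReal_ne_top enorm_ne_top⟩)
      (h1.trans (add_le_add le_rfl h2))
    rwa [ENNReal.toReal_add (kf_lt_top ψ x).ne (ENNReal.mul_ne_top ENNReal.ofReal_ne_top
      enorm_ne_top), ENNReal.toReal_mul, ENNReal.toReal_ofReal (Real.exp_pos _).le,
      toReal_enorm] at h3
  have := ENNReal.continuous_ofReal.comp hL.continuous
  refine this.congr fun φ => ENNReal.ofReal_toReal (kf_lt_top φ x).ne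

/-- Carathéodory: continuity in the scale and measurability in the parameter. The joint
measurability serves Minkowski's inequality over time. -/
theorem measurable_kf {α : Type*} [MeasurableSpace α] {f : α → lorentz N P q}
    (hf : StronglyMeasurable f) : Measurable fun z : ℝ × α => kf (f z.2) z.1 :=
  measurable_uncurry_of_continuous_of_measurable (u := fun x a => kf (f a) x)
    (fun a => kf_continuous (f a))
    fun x => ((kf_continuous_left x).comp_stronglyMeasurable hf).measurable

end LorentzSpace

/-! ### The Schrödinger group on Schwartz functions: unitarity, dispersion, continuity in time. -/

section Propagator

open FourierTransform

variable {N : ℕ}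

/-- The transposed Schrödinger group on Schwartz functions. -/
def propagate (N : ℕ) (τ : ℝ) (ψ : 𝓢(Space N, ℂ)) : 𝓢(Space N, ℂ) :=
  𝓕 (SchwartzMap.smulLeftCLM ℂ (schrodingerSymbol N τ) (𝓕⁻ ψ))

theorem schrodinger_apply (τ : ℝ) (Φ : 𝓢'(Space N, ℂ)) (ψ : 𝓢(Space N, ℂ)) :
    schrodinger N τ Φ ψ = Φ (propagate N τ ψ) := rfl

theorem norm_schrodingerSymbol (τ : ℝ) (ξ : Space N) : ‖schrodingerSymbol N τ ξ‖ = 1 :=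
  Complex.norm_exp_ofReal_mul_I _

theorem propagate_add (τ : ℝ) (ψ₁ ψ₂ : 𝓢(Space N, ℂ)) :
    propagate N τ (ψ₁ + ψ₂) = propagate N τ ψ₁ + propagate N τ ψ₂ := by
  simp only [propagate, fourierInv_add, map_add, FourierTransform.fourier_add]

theorem propagate_smul (τ : ℝ) (c : ℂ) (ψ : 𝓢(Space N, ℂ)) :
    propagate N τ (c • ψ) = c • propagate N τ ψ := by
  simp only [propagate, fourierInv_smul, map_smul, FourierTransform.fourier_smul]

theorem norm_toLp_two_eq_of_norm_eq {f g : 𝓢(Space N, ℂ)} (h : ∀ x, ‖f x‖ = ‖g x‖) :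
    ‖f.toLp 2‖ = ‖g.toLp 2‖ := by
  rw [SchwartzMap.norm_toLp, SchwartzMap.norm_toLp,
    eLpNorm_congr_norm_ae (Eventually.of_forall h)]

theorem norm_toLp_two_propagate (τ : ℝ) (ψ : 𝓢(Space N, ℂ)) :
    ‖(propagate N τ ψ).toLp 2‖ = ‖ψ.toLp 2‖ := by
  rw [propagate, SchwartzMap.norm_fourier_toL2_eq, norm_toLp_two_eq_of_norm_eq (g := 𝓕⁻ ψ),
    ← SchwartzMap.norm_fourier_toL2_eq, fourier_fourierInv_eq]
  intro x
  rw [SchwartzMap.smulLeftCLM_apply_apply (schrodingerSymbol_hasTemperateGrowth N τ), norm_smul,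
    norm_schrodingerSymbol, one_mul]

theorem propagate_apply (τ : ℝ) (ψ : 𝓢(Space N, ℂ)) (x : Space N) :
    propagate N τ ψ x = ∫ ξ : Space N, Complex.exp (2 * Real.pi * Complex.I * inner ℝ x ξ) *
      (schrodingerSymbol N τ ξ * 𝓕 ψ ξ) := by
  -- The reflection ξ ↦ -ξ turns the inverse transform into the transform and leaves the symbol
  -- unchanged, since it is even.
  rw [propagate, SchwartzMap.fourier_coe, Real.fourier_eq', ← integral_neg_eq_self]
  refine integral_congr_ae (Eventually.of_forall fun ξ => ?_)
  simp only
  rw [SchwartzMap.smulLeftCLM_apply_apply (schrodingerSymbol_hasTemperateGrowth N τ),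
    SchwartzMap.fourierInv_coe, Real.fourierInv_eq_fourier_neg, neg_neg, inner_neg_left,
    SchwartzMap.fourier_coe, smul_eq_mul, smul_eq_mul, real_inner_comm]
  congr 2
  · push_cast; ring
  · simp [schrodingerSymbol]

theorem norm_propagate_apply_le (τ : ℝ) (ψ : 𝓢(Space N, ℂ)) (x : Space N) :
    ‖propagate N τ ψ x‖ ≤ ∫ ξ : Space N, ‖𝓕 ψ ξ‖ := by
  rw [propagate_apply]
  refine (norm_integral_le_integral_norm _).trans (le_of_eq ?_)
  refine integral_congr_ae (Eventually.of_forall fun ξ => ?_)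
  simp only [norm_mul, norm_schrodingerSymbol, one_mul]
  have : 2 * (Real.pi : ℂ) * Complex.I * (inner ℝ x ξ : ℝ) =
      ((2 * Real.pi * inner ℝ x ξ : ℝ) : ℂ) * Complex.I := by push_cast; ring
  rw [this, Complex.norm_exp_ofReal_mul_I, one_mul]

/-- The Fourier transform is moved from ψ to the modulated Gaussian, whose explicit transform has
modulus at most (π/|b|)^{N/2}. The bound depends on |b| only, so it survives Re b → 0. -/
theorem norm_gaussian_pairing_le {b : ℂ} (hb : 0 < b.re) (ψ : 𝓢(Space N, ℂ)) (x : Space N) :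
    ‖∫ ξ : Space N, Complex.exp (-b * ‖ξ‖ ^ 2 + 2 * Real.pi * Complex.I * inner ℝ x ξ) * 𝓕 ψ ξ‖ ≤
      (Real.pi / ‖b‖) ^ ((N : ℝ) / 2) * ∫ y, ‖ψ y‖ := by
  have hint : Integrable fun ξ : Space N =>
      Complex.exp (-b * ‖ξ‖ ^ 2 + 2 * Real.pi * Complex.I * inner ℝ x ξ) :=
    GaussianFourier.integrable_cexp_neg_mul_sq_norm_add hb _ x
  have e := VectorFourier.integral_fourierIntegral_smul_eq_flip (μ := (volume : Measure (Space N)))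
    (ν := (volume : Measure (Space N))) (L := innerₗ (Space N)) Real.continuous_fourierChar
    continuous_inner hint ψ.integrable
  have e2 : ∫ ξ : Space N,
      Complex.exp (-b * ‖ξ‖ ^ 2 + 2 * Real.pi * Complex.I * inner ℝ x ξ) * 𝓕 ψ ξ =
      ∫ y : Space N, 𝓕 (fun ξ : Space N =>
        Complex.exp (-b * ‖ξ‖ ^ 2 + 2 * Real.pi * Complex.I * inner ℝ x ξ)) y * ψ y := by
    rw [flip_innerₗ] at e
    exact e.symm
  rw [e2, ← integral_const_mul]
  refine norm_integral_le_of_norm_le (ψ.integrable.norm.const_mul _)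
    (Eventually.of_forall fun y => ?_)
  rw [norm_mul, fourier_gaussian_innerProductSpace' hb, norm_mul]
  have h1 : ‖((Real.pi : ℂ) / b) ^ (((Module.finrank ℝ (Space N) : ℕ) : ℂ) / 2)‖ =
      (Real.pi / ‖b‖) ^ ((N : ℝ) / 2) := by
    have : (((Module.finrank ℝ (Space N) : ℕ) : ℂ) / 2) = (((N : ℝ) / 2 : ℝ) : ℂ) := by
      simp
    rw [this, Complex.norm_cpow_real, norm_div, Complex.norm_real, Real.norm_of_nonneg
      Real.pi_pos.le]
  have h2 : ‖Complex.exp (-(Real.pi : ℂ) ^ 2 * (‖x - y‖ : ℂ) ^ 2 / b)‖ ≤ 1 := by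
    rw [Complex.norm_exp, Real.exp_le_one_iff]
    have : -(Real.pi : ℂ) ^ 2 * (‖x - y‖ : ℂ) ^ 2 / b =
        ((-(Real.pi ^ 2 * ‖x - y‖ ^ 2) : ℝ) : ℂ) * b⁻¹ := by push_cast; ring
    rw [this, Complex.re_ofReal_mul, Complex.inv_re]
    have h3 : 0 ≤ Real.pi ^ 2 * ‖x - y‖ ^ 2 := by positivity
    have h4 : 0 ≤ b.re / Complex.normSq b := div_nonneg hb.le (Complex.normSq_nonneg _)
    nlinarith [mul_nonneg h3 h4]
  rw [h1]
  have h5 : 0 ≤ (Real.pi / ‖b‖) ^ ((N : ℝ) / 2) := by positivity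
  calc _ ≤ (Real.pi / ‖b‖) ^ ((N : ℝ) / 2) * 1 * ‖ψ y‖ := by gcongr
    _ = _ := by rw [mul_one]

/-- The dispersive estimate. -/
theorem norm_propagate_apply_le_dispersive {τ : ℝ} (hτ : τ ≠ 0) (ψ : 𝓢(Space N, ℂ)) (x : Space N) :
    ‖propagate N τ ψ x‖ ≤ |τ| ^ (-((N : ℝ) / 2)) * ∫ y, ‖ψ y‖ := by
  -- A small positive real part makes the oscillating Gaussian integrable; it tends to 0 by
  -- dominated convergence.
  let b : ℕ → ℂ := fun n => ((1 / ((n : ℝ) + 1) : ℝ) : ℂ) +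
    ((τ * (2 * Real.pi) ^ 2 : ℝ) : ℂ) * Complex.I
  have hbre : ∀ n, (b n).re = 1 / ((n : ℝ) + 1) := fun n => by
    simp only [b, Complex.add_re, Complex.ofReal_re, Complex.re_ofReal_mul, Complex.I_re,
      mul_zero, add_zero]
  have hbim : ∀ n, (b n).im = τ * (2 * Real.pi) ^ 2 := fun n => by
    simp only [b, Complex.add_im, Complex.ofReal_im, Complex.im_ofReal_mul, Complex.I_im,
      mul_one, zero_add]
  have hb : ∀ n, 0 < (b n).re := fun n => by rw [hbre]; positivity
  have hψ : Integrable fun ξ : Space N => 𝓕 ψ ξ := (𝓕 ψ).integrable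
  have hlim : Tendsto (fun n => ∫ ξ : Space N,
      Complex.exp (-b n * ‖ξ‖ ^ 2 + 2 * Real.pi * Complex.I * inner ℝ x ξ) * 𝓕 ψ ξ) atTop
      (𝓝 (propagate N τ ψ x)) := by
    rw [propagate_apply]
    refine tendsto_integral_of_dominated_convergence (fun ξ => ‖𝓕 ψ ξ‖) (fun n => ?_) hψ.norm
      (fun n => Eventually.of_forall fun ξ => ?_) (Eventually.of_forall fun ξ => ?_)
    · exact ((GaussianFourier.integrable_cexp_neg_mul_sq_norm_add (hb n) _
        x).aestronglyMeasurable).mul hψ.aestronglyMeasurable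
    · rw [norm_mul]
      refine mul_le_of_le_one_left (norm_nonneg _) ?_
      rw [Complex.norm_exp, Real.exp_le_one_iff]
      have : (-b n * (‖ξ‖ : ℂ) ^ 2 + 2 * Real.pi * Complex.I * (inner ℝ x ξ : ℝ)) =
          ((-‖ξ‖ ^ 2 : ℝ) : ℂ) * b n + ((2 * Real.pi * inner ℝ x ξ : ℝ) : ℂ) * Complex.I := by
        push_cast; ring
      rw [this, Complex.add_re, Complex.re_ofReal_mul, Complex.re_ofReal_mul, Complex.I_re]
      nlinarith [mul_nonneg (sq_nonneg ‖ξ‖) (hb n).le]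
    · rw [← mul_assoc]
      refine Tendsto.mul_const _ ?_
      have hbl : Tendsto b atTop (𝓝 (((0 : ℝ) : ℂ) +
          ((τ * (2 * Real.pi) ^ 2 : ℝ) : ℂ) * Complex.I)) :=
        ((Complex.continuous_ofReal.tendsto 0).comp
          tendsto_one_div_add_atTop_nhds_zero_nat).add_const _
      have := ((hbl.neg.mul_const ((‖ξ‖ : ℂ) ^ 2)).add_const
        (2 * Real.pi * Complex.I * (inner ℝ x ξ : ℝ))).cexp
      convert this using 2
      rw [schrodingerSymbol, ← Complex.exp_add]
      congr 1
      push_cast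
      ring
  refine le_of_tendsto hlim.norm (Eventually.of_forall fun n => ?_)
  refine (norm_gaussian_pairing_le (hb n) ψ x).trans ?_
  have hI : 0 ≤ ∫ y, ‖ψ y‖ := integral_nonneg fun _ => norm_nonneg _
  refine mul_le_mul_of_nonneg_right ?_ hI
  have hτ0 : 0 < |τ| := abs_pos.2 hτ
  -- The imaginary part already has size (2π)²|τ|. Keeping only π|τ| gives the dispersive bound with
  -- constant 1.
  have h1 : Real.pi * |τ| ≤ ‖b n‖ := by
    have h2 := Complex.abs_im_le_norm (b n)
    rw [hbim, abs_mul, abs_of_pos (show 0 < (2 * Real.pi) ^ 2 by positivity)] at h2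
    have h3 : Real.pi ≤ (2 * Real.pi) ^ 2 := by nlinarith [Real.pi_gt_three]
    rw [mul_comm]
    exact (mul_le_mul_of_nonneg_left h3 hτ0.le).trans h2
  rw [Real.rpow_neg hτ0.le, ← Real.inv_rpow hτ0.le]
  refine Real.rpow_le_rpow (by positivity) ?_ (by positivity)
  rw [div_le_iff₀ (lt_of_lt_of_le (by positivity) h1), inv_mul_eq_div, le_div_iff₀ hτ0]
  exact h1

/-- Size of the difference of two symbols against the Fourier transform. -/
theorem norm_propagate_sub_apply_le (τ τ₀ : ℝ) (ψ : 𝓢(Space N, ℂ)) (x : Space N) :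
    ‖(propagate N τ ψ - propagate N τ₀ ψ) x‖ ≤
      ∫ ξ : Space N, ‖schrodingerSymbol N τ ξ - schrodingerSymbol N τ₀ ξ‖ * ‖𝓕 ψ ξ‖ := by
  have hexp : ∀ ξ : Space N, ‖Complex.exp (2 * Real.pi * Complex.I * (inner ℝ x ξ : ℝ))‖ = 1 := by
    intro ξ
    have : 2 * (Real.pi : ℂ) * Complex.I * (inner ℝ x ξ : ℝ) =
        ((2 * Real.pi * inner ℝ x ξ : ℝ) : ℂ) * Complex.I := by push_cast; ring
    rw [this, Complex.norm_exp_ofReal_mul_I]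
  have hi : ∀ τ, Integrable fun ξ : Space N =>
      Complex.exp (2 * Real.pi * Complex.I * (inner ℝ x ξ : ℝ)) *
      (schrodingerSymbol N τ ξ * 𝓕 ψ ξ) := by
    intro τ
    refine ((𝓕 ψ).integrable (μ := volume)).mono ?_ (Eventually.of_forall fun ξ => ?_)
    · refine Continuous.aestronglyMeasurable ?_
      have h1 : Continuous (schrodingerSymbol N τ) :=
        (schrodingerSymbol_hasTemperateGrowth N τ).1.continuous
      have h2 : Continuous fun ξ : Space N => 𝓕 ψ ξ := (𝓕 ψ).continuous
      have h3 : Continuous fun ξ : Space N => ((inner ℝ x ξ : ℝ) : ℂ) := by fun_prop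
      fun_prop
    · rw [norm_mul, hexp, norm_mul, norm_schrodingerSymbol, one_mul, one_mul]
  rw [sub_apply, propagate_apply, propagate_apply, ← integral_sub (hi τ) (hi τ₀)]
  refine (norm_integral_le_integral_norm _).trans (le_of_eq ?_)
  refine integral_congr_ae (Eventually.of_forall fun ξ => ?_)
  simp only
  rw [← mul_sub, ← sub_mul, norm_mul, hexp, norm_mul, one_mul]

theorem continuous_schrodingerSymbol_time (ξ : Space N) :
    Continuous fun τ => schrodingerSymbol N τ ξ := by
  unfold schrodingerSymbol; fun_prop

/-- Dominated convergence with majorant (2|f|)^k. The power 1 controls differences of propagated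
functions in supremum, the power 2 in L². -/
theorem tendsto_integral_symbol_sub (τ₀ : ℝ) (f : 𝓢(Space N, ℂ)) (k : ℕ) (hk : k ≠ 0) :
    Tendsto (fun τ => ∫ ξ : Space N,
      (‖schrodingerSymbol N τ ξ - schrodingerSymbol N τ₀ ξ‖ * ‖f ξ‖) ^ k) (𝓝 τ₀) (𝓝 0) := by
  have hmeas : ∀ τ, Continuous (schrodingerSymbol N τ) := fun τ =>
    (schrodingerSymbol_hasTemperateGrowth N τ).1.continuous
  have hfk : Integrable fun ξ : Space N => (2 * ‖f ξ‖) ^ k := by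
    have := (f.memLp k volume).integrable_norm_pow hk
    simp_rw [mul_pow]
    exact this.const_mul _
  have hz : (0 : ℝ) = ∫ ξ : Space N, (0 : ℝ) := by simp
  rw [hz]
  refine tendsto_integral_filter_of_dominated_convergence (fun ξ => (2 * ‖f ξ‖) ^ k)
    (Eventually.of_forall fun τ => ?_)
    (Eventually.of_forall fun τ => Eventually.of_forall fun ξ => ?_) hfk
    (Eventually.of_forall fun ξ => ?_)
  · have h1 := hmeas τ
    have h2 := hmeas τ₀
    have h3 : Continuous f := f.continuous
    exact Continuous.aestronglyMeasurable (by fun_prop)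
  · rw [Real.norm_of_nonneg (by positivity)]
    gcongr
    refine (norm_sub_le _ _).trans ?_
    rw [norm_schrodingerSymbol, norm_schrodingerSymbol]; norm_num
  · have h1 : Continuous fun τ =>
        (‖schrodingerSymbol N τ ξ - schrodingerSymbol N τ₀ ξ‖ * ‖f ξ‖) ^ k := by
      have := continuous_schrodingerSymbol_time ξ
      fun_prop
    have := h1.tendsto τ₀
    simpa [hk] using this

theorem fourier_schwartz_sub (f g : 𝓢(Space N, ℂ)) : 𝓕 (f - g) = 𝓕 f - 𝓕 g :=
  map_sub (AddMonoidHom.mk' 𝓕 FourierTransform.fourier_add) f g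

theorem tendsto_norm_toLp_propagate_sub (τ₀ : ℝ) (ψ : 𝓢(Space N, ℂ)) :
    Tendsto (fun τ => ‖(propagate N τ ψ - propagate N τ₀ ψ).toLp 2‖) (𝓝 τ₀) (𝓝 0) := by
  have e : ∀ τ, ‖(propagate N τ ψ - propagate N τ₀ ψ).toLp 2‖ =
      (∫ ξ : Space N, (‖schrodingerSymbol N τ ξ - schrodingerSymbol N τ₀ ξ‖ *
        ‖(𝓕⁻ ψ) ξ‖) ^ 2) ^ (2 : ℝ)⁻¹ := by
    intro τ
    rw [propagate, propagate, ← fourier_schwartz_sub, SchwartzMap.norm_fourier_toL2_eq,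
      SchwartzMap.norm_toLp' (by norm_num) (by norm_num)]
    congr 1
    refine integral_congr_ae (Eventually.of_forall fun ξ => ?_)
    simp only [sub_apply]
    rw [SchwartzMap.smulLeftCLM_apply_apply (schrodingerSymbol_hasTemperateGrowth N τ),
      SchwartzMap.smulLeftCLM_apply_apply (schrodingerSymbol_hasTemperateGrowth N τ₀),
      ← sub_smul, norm_smul]
    norm_num
  simp_rw [e]
  have := (tendsto_integral_symbol_sub τ₀ (𝓕⁻ ψ) 2 two_ne_zero).rpow_const
    (p := (2 : ℝ)⁻¹) (Or.inr (by norm_num))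
  simpa using this

end Propagator

/-! ### Pairing of L² ∩ L^∞ with Lorentz spaces. -/

section Pairing

open FourierTransform

variable {N : ℕ} {P : ℝ} {q : ℝ≥0∞} [hq : Fact (1 ≤ q)] [hP : Fact (1 ≤ P)]

theorem setLIntegral_le_eLpNorm_two {α : Type*} [MeasurableSpace α] {μ : Measure α}
    {w : α → ℝ≥0∞} (hw : Measurable w) {M : ℝ} (hM : 0 ≤ M)
    (h2 : eLpNorm w 2 μ ≤ ENNReal.ofReal M) {F : Set α} {y : ℝ} (hy : 0 < y)
    (hF : μ F = ENNReal.ofReal y) :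
    ∫⁻ x in F, w x ∂μ ≤ ENNReal.ofReal (M * y ^ (-(1 / 2) : ℝ) * y) := by
  have h := eLpNorm_le_eLpNorm_mul_rpow_measure_univ (μ := μ.restrict F) (p := 1) (q := 2)
    (f := w) (by norm_num) hw.aestronglyMeasurable
  rw [eLpNorm_one_eq_lintegral_enorm] at h
  simp only [enorm_eq_self, Measure.restrict_apply_univ, hF] at h
  refine h.trans ?_
  calc _ ≤ ENNReal.ofReal M * ENNReal.ofReal y ^ (1 / (1 : ℝ≥0∞).toReal - 1 / (2 : ℝ≥0∞).toReal) := by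
        gcongr
        exact (eLpNorm_mono_measure _ Measure.restrict_le_self).trans h2
    _ = _ := by
        rw [ENNReal.ofReal_rpow_of_pos hy, ← ENNReal.ofReal_mul hM, mul_assoc]
        congr 2
        nth_rewrite 3 [← Real.rpow_one y]
        rw [← Real.rpow_add hy]
        norm_num

/-- Rearrangement bound for the pairing with a function of `L² ∩ L^∞`. -/
theorem lintegral_mul_enorm_le (g : lorentz N P q) {w : Space N → ℝ≥0∞} (hw : Measurable w)
    {M₂ M : ℝ} (hM₂ : 0 ≤ M₂) (hM : 0 ≤ M)
    (h2 : eLpNorm w 2 volume ≤ ENNReal.ofReal M₂) (hsup : ∀ x, w x ≤ ENNReal.ofReal M) :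
    ∫⁻ x, w x * ‖(g : Fn N) x‖ₑ ≤
      ∫⁻ z : ℝ, ENNReal.ofReal (min (M₂ * Real.exp (-(1 / 2) * z)) M) * kf g z := by
  refine (lintegral_mul_le_rearr hw (measurable_enorm_coe _)
    (V := fun y => ENNReal.ofReal (min (M₂ * y ^ (-(1 / 2) : ℝ)) M)) (by fun_prop)
    fun F hF hFt => ?_).trans ?_
  · rcases eq_or_ne (volume F) 0 with hF0 | hF0
    · rw [setLIntegral_measure_zero _ _ hF0]; exact zero_le
    set y := (volume F).toReal with hy
    have hy0 : 0 < y := ENNReal.toReal_pos hF0 hFt.ne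
    have hFy : volume F = ENNReal.ofReal y := (ENNReal.ofReal_toReal hFt.ne).symm
    have b1 := setLIntegral_le_eLpNorm_two hw hM₂ h2 hy0 hFy
    have b2 : ∫⁻ x in F, w x ≤ ENNReal.ofReal (M * y) := by
      calc _ ≤ ∫⁻ x in F, ENNReal.ofReal M := lintegral_mono fun x => hsup x
        _ = _ := by rw [setLIntegral_const, hFy, ENNReal.ofReal_mul hM]
    calc ∫⁻ x in F, w x ≤ ENNReal.ofReal (min (M₂ * y ^ (-(1 / 2) : ℝ)) M * y) := by
          rw [min_mul_of_nonneg _ _ hy0.le]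
          rcases min_choice (M₂ * y ^ (-(1 / 2) : ℝ) * y) (M * y) with h | h
          · rw [h]; exact b1
          · rw [h]; exact b2
      _ = ∫⁻ z in {z : ℝ | 0 < z ∧ ENNReal.ofReal z < volume F},
            ENNReal.ofReal (min (M₂ * y ^ (-(1 / 2) : ℝ)) M) := by
          rw [setLIntegral_const, volume_setOf_ofReal_lt, hFy, ENNReal.ofReal_mul (by positivity)]
      _ ≤ _ := by
          refine setLIntegral_mono' (measurableSet_setOf_ofReal_lt _) fun z hz => ?_
          have hzy : z ≤ y := by
            have := hz.2
            rw [hFy] at this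
            exact (ENNReal.ofReal_lt_ofReal_iff_of_nonneg hz.1.le).1 this |>.le
          have : y ^ (-(1 / 2) : ℝ) ≤ z ^ (-(1 / 2) : ℝ) :=
            Real.rpow_le_rpow_of_nonpos hz.1 hzy (by norm_num)
          gcongr
  · rw [lintegral_Ioi_zero_eq_lintegral_exp]
    refine lintegral_mono fun z => ?_
    rw [mul_left_comm, ← Real.exp_mul, mul_comm z]
    gcongr
    exact mul_rearr_le_kfun (measurable_enorm_coe _) (Real.exp_pos z)

/-- The constant in `lintegral_mul_enorm_le_norm`. -/
def pairConst (P : ℝ) : ℝ :=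
  Real.exp (1 - 1 / P) *
    (1 / (1 - 1 / P) + Real.exp (1 / 2 - (1 - 1 / P)) / (1 / 2 - (1 - 1 / P)))

theorem one_sub_inv_pos (h1 : 1 < P) : 0 < 1 - 1 / P := by
  rw [sub_pos, div_lt_one (by linarith)]; exact h1

theorem one_sub_inv_lt (h1 : 1 < P) (h2 : P < 2) : 0 < 1 / 2 - (1 - 1 / P) := by
  have : 1 / 2 < 1 / P := one_div_lt_one_div_of_lt (by linarith) h2
  linarith

theorem pairConst_pos (h1 : 1 < P) (h2 : P < 2) : 0 < pairConst P := by
  have := one_sub_inv_pos h1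
  have := one_sub_inv_lt h1 h2
  unfold pairConst
  positivity

/-- The K-functional of g at exp z grows at most like exp(θz) with θ = 1 - 1/P. Against
min(exp(-z/2), 1) this is integrable exactly because 0 < θ < 1/2, that is 1 < P < 2. -/
theorem lintegral_mul_enorm_le_norm (h1 : 1 < P) (h2 : P < 2) (g : lorentz N P q)
    {w : Space N → ℝ≥0∞} (hw : Measurable w) {M : ℝ} (hM : 0 ≤ M)
    (hw2 : eLpNorm w 2 volume ≤ ENNReal.ofReal M) (hsup : ∀ x, w x ≤ ENNReal.ofReal M) :
    ∫⁻ x, w x * ‖(g : Fn N) x‖ₑ ≤ ENNReal.ofReal (pairConst P * M) * ‖g‖ₑ := by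
  have ha := one_sub_inv_pos h1
  have hb := one_sub_inv_lt h1 h2
  set θ := 1 - 1 / P with hθ
  refine (lintegral_mul_enorm_le g hw hM hM hw2 hsup).trans ?_
  calc _ ≤ ∫⁻ z : ℝ, ENNReal.ofReal (M * Real.exp θ) * min (ENNReal.ofReal (Real.exp (θ * z)))
          (ENNReal.ofReal (Real.exp (-(1 / 2 - θ) * z))) * ‖g‖ₑ := by
        refine lintegral_mono fun z => ?_
        calc _ ≤ ENNReal.ofReal (min (M * Real.exp (-(1 / 2) * z)) M) *
              (ENNReal.ofReal (Real.exp ((z + 1) * θ)) * ‖g‖ₑ) := by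
              gcongr
              exact kf_le g z
          _ = _ := by
              rw [← mul_assoc, ← ENNReal.ofReal_mul (by positivity), ← ENNReal.ofReal_mono.map_min,
                ← ENNReal.ofReal_mul (by positivity)]
              congr 2
              have e : min (M * Real.exp (-(1 / 2) * z)) M = M * min (Real.exp (-(1 / 2) * z)) 1 := by
                rw [mul_min_of_nonneg _ _ hM, mul_one]
              rw [e, mul_assoc, mul_assoc, min_mul_of_nonneg _ _ (Real.exp_pos _).le,
                mul_min_of_nonneg _ _ (Real.exp_pos _).le, ← Real.exp_add, ← Real.exp_add,
                ← Real.exp_add, min_comm, one_mul]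
              congr 3 <;> ring
    _ = ENNReal.ofReal (M * Real.exp θ) * (∫⁻ z : ℝ, min (ENNReal.ofReal (Real.exp (θ * z)))
          (ENNReal.ofReal (Real.exp (-(1 / 2 - θ) * z)))) * ‖g‖ₑ := by
        rw [lintegral_mul_const' _ _ enorm_ne_top, lintegral_const_mul' _ _ ENNReal.ofReal_ne_top]
    _ ≤ ENNReal.ofReal (M * Real.exp θ) *
          ENNReal.ofReal (1 / θ + Real.exp (1 / 2 - θ) / (1 / 2 - θ)) * ‖g‖ₑ := by
        gcongr
        exact lintegral_min_exp_le ha hb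
    _ = _ := by
        rw [← ENNReal.ofReal_mul (by positivity), pairConst]
        congr 2; ring

theorem eLpNorm_schwartz (w : 𝓢(Space N, ℂ)) (p : ℝ≥0∞) :
    eLpNorm (fun x => ‖w x‖ₑ) p volume = ENNReal.ofReal ‖w.toLp p‖ := by
  rw [eLpNorm_enorm, SchwartzMap.norm_toLp]
  exact (ENNReal.ofReal_toReal (w.memLp p volume).eLpNorm_ne_top).symm

theorem measurable_enorm_schwartz (w : 𝓢(Space N, ℂ)) : Measurable fun x => ‖w x‖ₑ :=
  w.continuous.measurable.enorm

/-- The pairing of a Schwartz function with a function of a Lorentz space. -/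
def pair (w : 𝓢(Space N, ℂ)) (g : lorentz N P q) : ℂ := ∫ x, w x * (g : Fn N) x

theorem lintegral_schwartz_le (h1 : 1 < P) (h2 : P < 2) (w : 𝓢(Space N, ℂ)) (g : lorentz N P q)
    {M : ℝ} (hM : ‖w.toLp 2‖ ≤ M) (hsup : ∀ x, ‖w x‖ ≤ M) :
    ∫⁻ x, ‖w x * (g : Fn N) x‖ₑ ≤ ENNReal.ofReal (pairConst P * M) * ‖g‖ₑ := by
  simp_rw [enorm_mul]
  refine lintegral_mul_enorm_le_norm h1 h2 g (measurable_enorm_schwartz w)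
    ((norm_nonneg _).trans hM) ?_ fun x => ?_
  · rw [eLpNorm_schwartz]; exact ENNReal.ofReal_le_ofReal hM
  · rw [← ofReal_norm]; exact ENNReal.ofReal_le_ofReal (hsup x)

theorem exists_forall_norm_le (w : 𝓢(Space N, ℂ)) : ∃ C : ℝ, ∀ x, ‖w x‖ ≤ C := by
  obtain ⟨C, -, hC⟩ := w.decay 0 0
  simp only [pow_zero, norm_iteratedFDeriv_zero, one_mul] at hC
  exact ⟨C, hC⟩

theorem exists_schwartz_bound (w : 𝓢(Space N, ℂ)) :
    ∃ M : ℝ, ‖w.toLp 2‖ ≤ M ∧ ∀ x, ‖w x‖ ≤ M := by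
  obtain ⟨C, hC⟩ := exists_forall_norm_le w
  generalize ‖w.toLp 2‖ = b
  exact ⟨max b C, le_max_left _ _, fun x => (hC x).trans (le_max_right _ _)⟩

theorem integrable_pair (h1 : 1 < P) (h2 : P < 2) (w : 𝓢(Space N, ℂ)) (g : lorentz N P q) :
    Integrable fun x => w x * (g : Fn N) x := by
  obtain ⟨M, hM, hs⟩ := exists_schwartz_bound w
  refine ⟨w.continuous.aestronglyMeasurable.mul (g : Fn N).aestronglyMeasurable, ?_⟩
  exact (lintegral_schwartz_le h1 h2 w g hM hs).trans_lt
    (ENNReal.mul_lt_top ENNReal.ofReal_lt_top enorm_lt_top)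

theorem norm_pair_le (h1 : 1 < P) (h2 : P < 2) (w : 𝓢(Space N, ℂ)) (g : lorentz N P q)
    {M : ℝ} (hM : ‖w.toLp 2‖ ≤ M) (hsup : ∀ x, ‖w x‖ ≤ M) :
    ‖pair w g‖ ≤ pairConst P * M * ‖g‖ := by
  have hM0 : 0 ≤ M := (norm_nonneg _).trans hM
  have hc := (pairConst_pos h1 h2).le
  have := (enorm_integral_le_lintegral_enorm (fun x => w x * (g : Fn N) x)).trans
    (lintegral_schwartz_le h1 h2 w g hM hsup)
  rw [← ofReal_norm, ← ofReal_norm, ← ENNReal.ofReal_mul (by positivity)] at this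
  exact (ENNReal.ofReal_le_ofReal_iff (by positivity)).1 this

theorem pair_add_left (h1 : 1 < P) (h2 : P < 2) (w₁ w₂ : 𝓢(Space N, ℂ)) (g : lorentz N P q) :
    pair (w₁ + w₂) g = pair w₁ g + pair w₂ g := by
  rw [pair, pair, pair, ← integral_add (integrable_pair h1 h2 w₁ g) (integrable_pair h1 h2 w₂ g)]
  exact integral_congr_ae (Eventually.of_forall fun x => by simp [add_mul])

theorem pair_smul_left (c : ℂ) (w : 𝓢(Space N, ℂ)) (g : lorentz N P q) :
    pair (c • w) g = c * pair w g := by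
  rw [pair, pair, ← integral_const_mul]
  exact integral_congr_ae (Eventually.of_forall fun x => by simp [mul_assoc])

theorem pair_sub_left (h1 : 1 < P) (h2 : P < 2) (w₁ w₂ : 𝓢(Space N, ℂ)) (g : lorentz N P q) :
    pair (w₁ - w₂) g = pair w₁ g - pair w₂ g := by
  have := pair_add_left h1 h2 (w₁ - w₂) w₂ g
  rw [sub_add_cancel] at this
  rw [this]; ring

theorem pair_sub_right (h1 : 1 < P) (h2 : P < 2) (w : 𝓢(Space N, ℂ)) (g₁ g₂ : lorentz N P q) :
    pair w (g₁ - g₂) = pair w g₁ - pair w g₂ := by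
  rw [pair, pair, pair, ← integral_sub (integrable_pair h1 h2 w g₁) (integrable_pair h1 h2 w g₂)]
  refine integral_congr_ae ?_
  filter_upwards [AEEqFun.coeFn_sub (g₁ : Fn N) (g₂ : Fn N)] with x hx
  rw [Submodule.coe_sub, hx]
  simp [mul_sub]

/-- The L² and supremum norms of a Schwartz function are bounded by Schwartz seminorms, so the
pairing with g is a tempered distribution and `toTempered` does not take its default value 0. -/
theorem represents_toTempered (h1 : 1 < P) (h2 : P < 2) (g : lorentz N P q) :
    Represents (g : Fn N) (toTempered (g : Fn N)) := by
  obtain ⟨k, C, hC, hk⟩ := SchwartzMap.norm_toLp_le_seminorm ℂ (E := Space N) ℂ 2 volume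
  let L : 𝓢(Space N, ℂ) →L[ℂ] ℂ := SchwartzMap.mkCLMtoNormedSpace (σ := RingHom.id ℂ)
    (fun w => pair w g) (fun w₁ w₂ => pair_add_left h1 h2 w₁ w₂ g)
    (fun c w => pair_smul_left c w g) (by
      refine ⟨Finset.Iic (k, 0), pairConst P * (C + 1) * ‖g‖, ?_, fun w => ?_⟩
      · have := pairConst_pos h1 h2
        positivity
      · set s := (Finset.Iic (k, 0)).sup (schwartzSeminormFamily ℂ (Space N) ℂ) w with hs
        have hs0 : 0 ≤ s := apply_nonneg _ _
        have hsup : ∀ x, ‖w x‖ ≤ (C + 1) * s := fun x => by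
          have h3 := SchwartzMap.norm_le_seminorm ℂ w x
          have h4 : SchwartzMap.seminorm ℂ 0 0 w ≤ s :=
            Seminorm.le_def.1 (Finset.le_sup (f := schwartzSeminormFamily ℂ (Space N) ℂ)
              (b := ((0, 0) : ℕ × ℕ)) (by simp)) w
          nlinarith [mul_nonneg hC hs0]
        have h5 := norm_pair_le h1 h2 w g (M := (C + 1) * s)
          ((hk w).trans (by nlinarith)) hsup
        refine h5.trans (le_of_eq ?_)
        ring)
  have hL : Represents (g : Fn N) (L.toPointwiseConvergenceCLM ℂ _ _ _ : 𝓢'(Space N, ℂ)) := fun w =>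
    ⟨integrable_pair h1 h2 w g, rfl⟩
  rw [toTempered_eq hL]
  exact hL

theorem norm_pair_propagate_le (h1 : 1 < P) (h2 : P < 2) (ψ : 𝓢(Space N, ℂ)) :
    ∃ C : ℝ, 0 ≤ C ∧ ∀ (τ : ℝ) (g : lorentz N P q), ‖pair (propagate N τ ψ) g‖ ≤ C * ‖g‖ := by
  have hc := pairConst_pos h1 h2
  refine ⟨pairConst P * max ‖ψ.toLp 2‖ (∫ ξ : Space N, ‖𝓕 ψ ξ‖), ?_, fun τ g => ?_⟩
  · have : 0 ≤ max ‖ψ.toLp 2‖ (∫ ξ : Space N, ‖𝓕 ψ ξ‖) := le_max_of_le_left (norm_nonneg _)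
    positivity
  · exact norm_pair_le h1 h2 _ g ((norm_toLp_two_propagate τ ψ).le.trans (le_max_left _ _))
      fun x => (norm_propagate_apply_le τ ψ x).trans (le_max_right _ _)

/-- Joint continuity makes the Duhamel integrand strongly measurable when g is a strongly measurable
function of time. -/
theorem continuous_pair_propagate (h1 : 1 < P) (h2 : P < 2) (ψ : 𝓢(Space N, ℂ)) :
    Continuous fun z : ℝ × lorentz N P q => pair (propagate N z.1 ψ) z.2 := by
  obtain ⟨C, hC, hb⟩ := norm_pair_propagate_le (N := N) (P := P) (q := q) h1 h2 ψ
  rw [continuous_iff_continuousAt]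
  rintro ⟨τ₀, g₀⟩
  rw [ContinuousAt, tendsto_iff_norm_sub_tendsto_zero]
  let d : ℝ → ℝ := fun τ => max ‖(propagate N τ ψ - propagate N τ₀ ψ).toLp 2‖
    (∫ ξ : Space N, ‖schrodingerSymbol N τ ξ - schrodingerSymbol N τ₀ ξ‖ * ‖𝓕 ψ ξ‖)
  have hd : Tendsto d (𝓝 τ₀) (𝓝 0) := by
    have e1 := tendsto_norm_toLp_propagate_sub τ₀ ψ
    have e2 := tendsto_integral_symbol_sub τ₀ (𝓕 ψ) 1 one_ne_zero
    simp only [pow_one] at e2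
    simpa using e1.max e2
  have hmaj : Tendsto (fun z : ℝ × lorentz N P q =>
      C * ‖z.2 - g₀‖ + pairConst P * d z.1 * ‖g₀‖) (𝓝 (τ₀, g₀)) (𝓝 0) := by
    have t1 : Tendsto (fun z : ℝ × lorentz N P q => C * ‖z.2 - g₀‖) (𝓝 (τ₀, g₀)) (𝓝 0) := by
      have : Continuous fun z : ℝ × lorentz N P q => C * ‖z.2 - g₀‖ := by fun_prop
      simpa using this.tendsto (τ₀, g₀)
    have t2 : Tendsto (fun z : ℝ × lorentz N P q => pairConst P * d z.1 * ‖g₀‖)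
        (𝓝 (τ₀, g₀)) (𝓝 0) := by
      have := ((hd.comp (continuous_fst.tendsto (τ₀, g₀))).const_mul (pairConst P)).mul_const ‖g₀‖
      simpa using this
    simpa using t1.add t2
  refine squeeze_zero (fun _ => norm_nonneg _) (fun z => ?_) hmaj
  have e : pair (propagate N z.1 ψ) z.2 - pair (propagate N τ₀ ψ) g₀ =
      pair (propagate N z.1 ψ) (z.2 - g₀) +
        pair (propagate N z.1 ψ - propagate N τ₀ ψ) g₀ := by
    rw [pair_sub_right h1 h2, pair_sub_left h1 h2]; ring
  simp only
  rw [e]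
  refine (norm_add_le _ _).trans (add_le_add (hb _ _) ?_)
  exact norm_pair_le h1 h2 _ g₀ (le_max_left _ _) fun x =>
    (norm_propagate_sub_apply_le _ _ ψ x).trans (le_max_right _ _)

end Pairing

/-! ### Representing functionals on Schwartz functions by functions, and duality for the
K-functional. -/

section Representation

open scoped NNReal InnerProductSpace ComplexConjugate

/-- A polynomial weight on `ℝ^N` with integrable inverse. -/
def wt {N : ℕ} (x : Space N) : ℝ≥0 := (1 + ‖x‖₊) ^ (N + 1)

/-- The measure on `ℝ^N` with density `wt`. -/
def wvol (N : ℕ) : Measure (Space N) := volume.withDensity fun x => (wt x : ℝ≥0∞)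

variable {N : ℕ}

theorem continuous_wt : Continuous (wt : Space N → ℝ≥0) := by unfold wt; fun_prop

theorem measurable_wt : Measurable (wt : Space N → ℝ≥0) := continuous_wt.measurable

theorem one_le_wt (x : Space N) : 1 ≤ wt x := one_le_pow₀ (by simp)

theorem wt_ne_zero (x : Space N) : wt x ≠ 0 := (zero_lt_one.trans_le (one_le_wt x)).ne'

theorem volume_le_wvol : (volume : Measure (Space N)) ≤ wvol N := by
  conv_lhs => rw [← withDensity_one (μ := (volume : Measure (Space N)))]
  exact withDensity_mono (Eventually.of_forall fun x => by simpa using one_le_wt x)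

theorem ae_wvol_iff {P : Space N → Prop} : (∀ᵐ x ∂(wvol N), P x) ↔ ∀ᵐ x, P x := by
  refine ⟨fun h => ae_mono volume_le_wvol h, fun h => ?_⟩
  exact (withDensity_absolutelyContinuous _ _).ae_le h

instance : IsLocallyFiniteMeasure (wvol N) := IsLocallyFiniteMeasure.withDensity_coe continuous_wt

theorem enorm_le_one_iff {z : ℂ} : ‖z‖ₑ ≤ 1 ↔ ‖z‖ ≤ 1 := by
  rw [← ofReal_norm, ← ENNReal.ofReal_one, ENNReal.ofReal_le_ofReal_iff zero_le_one]

theorem integrable_wvol_iff {f : Space N → ℂ} :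
    Integrable f (wvol N) ↔ Integrable (fun x => wt x • f x) volume :=
  integrable_withDensity_iff_integrable_smul measurable_wt

theorem integral_wvol (f : Space N → ℂ) : ∫ x, f x ∂(wvol N) = ∫ x, wt x • f x :=
  integral_withDensity_eq_integral_smul measurable_wt f

theorem integrable_inv_wt : Integrable (fun x : Space N => ((wt x : ℝ))⁻¹) := by
  have h := integrable_one_add_norm (E := Space N) (μ := volume) (r := ((N + 1 : ℕ) : ℝ)) (by simp)
  refine h.congr (Eventually.of_forall fun x => ?_)
  simp only [wt, NNReal.coe_pow, NNReal.coe_add, NNReal.coe_one, coe_nnnorm]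
  rw [Real.rpow_neg (by positivity), Real.rpow_natCast]

instance : (wvol N).HasTemperateGrowth where
  exists_integrable := by
    -- One factor of order N + 1 cancels the weight, the other leaves an integrable function.
    refine ⟨2 * (N + 1), ?_⟩
    rw [wvol, integrable_withDensity_iff_integrable_smul measurable_wt]
    refine integrable_inv_wt.congr (Eventually.of_forall fun x => ?_)
    simp only [wt, NNReal.smul_def, NNReal.coe_pow, NNReal.coe_add, NNReal.coe_one, coe_nnnorm,
      smul_eq_mul]
    have : 0 < 1 + ‖x‖ := by positivity
    rw [Real.rpow_neg this.le, Real.rpow_natCast, two_mul, pow_add]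
    field_simp
    ring

/-- Cauchy–Schwarz for the weighted measure against 1/`wt`, whose weighted L² norm is finite because
1/`wt` is integrable. Thus weighted L² embeds into L¹, and into L² as the weight is at least 1. -/
theorem exists_eLpNorm_one_le : ∃ K : ℝ, 0 ≤ K ∧ ∀ f : Space N → ℂ, AEStronglyMeasurable f volume →
    eLpNorm f 1 volume ≤ ENNReal.ofReal K * eLpNorm f 2 (wvol N) := by
  set I : ℝ≥0∞ := ∫⁻ x : Space N, ((wt x : ℝ≥0∞))⁻¹ with hI
  have hI' : I < ∞ := by
    have := (integrable_inv_wt (N := N)).2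
    rw [HasFiniteIntegral] at this
    refine lt_of_le_of_lt (lintegral_mono fun x => ?_) this
    rw [enorm_inv (by exact_mod_cast wt_ne_zero x)]
    simp
  refine ⟨(I ^ (1 / 2 : ℝ)).toReal, ENNReal.toReal_nonneg, fun f hf => ?_⟩
  rw [ENNReal.ofReal_toReal (ENNReal.rpow_ne_top_of_nonneg (by norm_num) hI'.ne)]
  have hm : AEMeasurable (fun x : Space N => ((wt x : ℝ≥0∞))⁻¹) (wvol N) :=
    (measurable_wt.coe_nnreal_ennreal.inv).aemeasurable
  have hf' : AEMeasurable (fun x => ‖f x‖ₑ) (wvol N) :=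
    (hf.enorm).mono_ac (withDensity_absolutelyContinuous _ _)
  have hwt : Measurable fun x : Space N => (wt x : ℝ≥0∞) := measurable_wt.coe_nnreal_ennreal
  have h := ENNReal.lintegral_mul_le_Lp_mul_Lq (wvol N) Real.HolderConjugate.two_two hm hf'
  have e1 : ∫⁻ x, ((fun x : Space N => ((wt x : ℝ≥0∞))⁻¹) * fun x => ‖f x‖ₑ) x ∂(wvol N) =
      eLpNorm f 1 volume := by
    rw [eLpNorm_one_eq_lintegral_enorm, wvol,
      lintegral_withDensity_eq_lintegral_mul_non_measurable _ hwt (by simp)]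
    refine lintegral_congr fun x => ?_
    simp only [Pi.mul_apply]
    rw [← mul_assoc, ENNReal.mul_inv_cancel (by exact_mod_cast wt_ne_zero x) (by simp), one_mul]
  have e2 : ∫⁻ x, ((wt x : ℝ≥0∞))⁻¹ ^ (2 : ℝ) ∂(wvol N) = I := by
    rw [wvol, lintegral_withDensity_eq_lintegral_mul_non_measurable _ hwt (by simp)]
    refine lintegral_congr fun x => ?_
    simp only [Pi.mul_apply]
    rw [ENNReal.rpow_two, sq, ← mul_assoc,
      ENNReal.mul_inv_cancel (by exact_mod_cast wt_ne_zero x) (by simp), one_mul]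
  have e3 : (∫⁻ x, ‖f x‖ₑ ^ (2 : ℝ) ∂(wvol N)) ^ (1 / 2 : ℝ) = eLpNorm f 2 (wvol N) := by
    rw [eLpNorm_eq_lintegral_rpow_enorm_toReal (by norm_num) (by norm_num)]
    simp
  rw [e1, e2, e3] at h
  exact h

theorem eLpNorm_two_le (f : Space N → ℂ) : eLpNorm f 2 volume ≤ eLpNorm f 2 (wvol N) :=
  eLpNorm_mono_measure _ volume_le_wvol

theorem aestronglyMeasurable_rep (h : Lp ℂ 2 (wvol N)) :
    AEStronglyMeasurable (fun x => conj (h x) * ((wt x : ℝ) : ℂ)) (volume : Measure (Space N)) := by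
  have h1 : StronglyMeasurable h := Lp.stronglyMeasurable h
  have h2 : Continuous fun x : Space N => ((wt x : ℝ) : ℂ) :=
    Complex.continuous_ofReal.comp (NNReal.continuous_coe.comp continuous_wt)
  exact ((Complex.continuous_conj.comp_stronglyMeasurable h1).mul
    h2.stronglyMeasurable).aestronglyMeasurable

/-- The function by which the functional `ψ ↦ ⟪h, ψ⟫` on `L²(wvol)` acts. -/
def repFn (h : Lp ℂ 2 (wvol N)) : Fn N :=
  AEEqFun.mk (fun x => conj (h x) * ((wt x : ℝ) : ℂ)) (aestronglyMeasurable_rep h)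

theorem coeFn_repFn (h : Lp ℂ 2 (wvol N)) :
    repFn h =ᵐ[volume] fun x => conj (h x) * ((wt x : ℝ) : ℂ) := AEEqFun.coeFn_mk _ _

/-- The functional `V` on Schwartz functions is integration against `φ`, where `φ` lies in a
weighted `L²` space. -/
def IsRep (φ : Fn N) (V : 𝓢(Space N, ℂ) → ℂ) : Prop :=
  ∃ h : Lp ℂ 2 (wvol N), φ = repFn h ∧ ∀ ψ : 𝓢(Space N, ℂ), V ψ = ⟪h, ψ.toLp 2 (wvol N)⟫_ℂ

theorem IsRep.sub {φ₁ φ₂ : Fn N} {V₁ V₂ : 𝓢(Space N, ℂ) → ℂ} (h₁ : IsRep φ₁ V₁)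
    (h₂ : IsRep φ₂ V₂) : IsRep (φ₁ - φ₂) fun ψ => V₁ ψ - V₂ ψ := by
  obtain ⟨g₁, rfl, e₁⟩ := h₁
  obtain ⟨g₂, rfl, e₂⟩ := h₂
  refine ⟨g₁ - g₂, ?_, fun ψ => by simp only; rw [e₁, e₂, inner_sub_left]⟩
  refine AEEqFun.ext ?_
  have h3 := ae_wvol_iff.1 (Lp.coeFn_sub g₁ g₂)
  filter_upwards [AEEqFun.coeFn_sub (repFn g₁) (repFn g₂), coeFn_repFn g₁, coeFn_repFn g₂,
    coeFn_repFn (g₁ - g₂), h3] with x h4 h5 h6 h7 h8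
  rw [h4, h7, Pi.sub_apply, h5, h6, h8, Pi.sub_apply, map_sub, sub_mul]

theorem toLp_ae_volume (ψ : 𝓢(Space N, ℂ)) : ∀ᵐ x, ψ.toLp 2 (wvol N) x = ψ x :=
  ae_wvol_iff.1 (ψ.coeFn_toLp 2 (wvol N))

theorem IsRep.represents {φ : Fn N} {V : 𝓢(Space N, ℂ) → ℂ} (h : IsRep φ V) : Represents φ V := by
  obtain ⟨g, rfl, e⟩ := h
  intro ψ
  have key : (fun x => (wt x) • ⟪g x, ψ.toLp 2 (wvol N) x⟫_ℂ) =ᵐ[volume]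
      fun x => ψ x * repFn g x := by
    filter_upwards [coeFn_repFn g, toLp_ae_volume ψ] with x h1 h2
    rw [h1, h2, NNReal.smul_def, Complex.real_smul, RCLike.inner_apply]
    ring
  have h1 := L2.integrable_inner g (ψ.toLp 2 (wvol N)) (𝕜 := ℂ)
  rw [integrable_wvol_iff] at h1
  refine ⟨h1.congr key, ?_⟩
  rw [e, L2.inner_def, integral_wvol]
  exact integral_congr_ae key

/-- The weighted L² norm dominates both norms in the hypothesis and Schwartz functions are dense for
it. So V extends to a Hilbert space and the Riesz theorem applies. -/
theorem exists_isRep (V : 𝓢(Space N, ℂ) →ₗ[ℂ] ℂ) {K : ℝ}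
    (hV : ∀ ψ : 𝓢(Space N, ℂ), ‖V ψ‖ ≤ K * (‖ψ.toLp 1‖ + ‖ψ.toLp 2‖)) : ∃ φ : Fn N, IsRep φ V := by
  obtain ⟨C, hC, hle⟩ := exists_eLpNorm_one_le (N := N)
  have hd : DenseRange (SchwartzMap.toLpCLM ℂ (E := Space N) ℂ 2 (wvol N)).toLinearMap :=
    SchwartzMap.denseRange_toLpCLM (E := Space N) (F := ℂ) (μ := wvol N) ENNReal.ofNat_ne_top
  have hb : ∀ ψ : 𝓢(Space N, ℂ), ‖V ψ‖ ≤ |K| * (C + 1) *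
      ‖(SchwartzMap.toLpCLM ℂ (E := Space N) ℂ 2 (wvol N)).toLinearMap ψ‖ := by
    intro ψ
    have h1 : ‖ψ.toLp 1‖ ≤ C * ‖ψ.toLp 2 (wvol N)‖ := by
      rw [SchwartzMap.norm_toLp, SchwartzMap.norm_toLp, ← ENNReal.toReal_ofReal hC,
        ← ENNReal.toReal_mul]
      refine ENNReal.toReal_mono (ENNReal.mul_ne_top ENNReal.ofReal_ne_top
        (ψ.memLp 2 _).eLpNorm_ne_top) (hle ψ ψ.continuous.aestronglyMeasurable)
    have h2 : ‖ψ.toLp 2‖ ≤ ‖ψ.toLp 2 (wvol N)‖ := by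
      rw [SchwartzMap.norm_toLp, SchwartzMap.norm_toLp]
      exact ENNReal.toReal_mono (ψ.memLp 2 _).eLpNorm_ne_top (eLpNorm_two_le ψ)
    have h3 := hV ψ
    have h4 : 0 ≤ ‖ψ.toLp 1‖ := norm_nonneg _
    have h5 : 0 ≤ ‖ψ.toLp 2‖ := norm_nonneg _
    change ‖V ψ‖ ≤ |K| * (C + 1) * ‖ψ.toLp 2 (wvol N)‖
    generalize ‖ψ.toLp 1‖ = a at *
    generalize ‖ψ.toLp 2‖ = b at *
    generalize ‖ψ.toLp 2 (wvol N)‖ = d at *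
    calc ‖V ψ‖ ≤ |K| * (a + b) :=
          h3.trans (mul_le_mul_of_nonneg_right (le_abs_self K) (by positivity))
      _ ≤ |K| * (C * d + d) := by gcongr
      _ = |K| * (C + 1) * d := by ring
  set L := V.extendOfNorm (SchwartzMap.toLpCLM ℂ (E := Space N) ℂ 2 (wvol N)).toLinearMap with hL
  refine ⟨_, (InnerProductSpace.toDual ℂ (Lp ℂ 2 (wvol N))).symm L, rfl, fun ψ => ?_⟩
  rw [InnerProductSpace.toDual_symm_apply]
  exact (LinearMap.extendOfNorm_eq hd ⟨_, hb⟩ ψ).symm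

/-- A bound for `⟪h, ·⟫` on Schwartz functions extends to `L²(wvol)`. -/
theorem enorm_inner_le (h : Lp ℂ 2 (wvol N)) {m : ℝ} (hm : 0 < m) {B : ℝ≥0∞}
    (hB : ∀ ψ : 𝓢(Space N, ℂ), eLpNorm ψ 1 volume ≤ ENNReal.ofReal m →
      eLpNorm ψ 2 volume ≤ ENNReal.ofReal (√m) → ‖⟪h, ψ.toLp 2 (wvol N)⟫_ℂ‖ₑ ≤ B)
    (g : Lp ℂ 2 (wvol N)) (h1 : eLpNorm g 1 volume ≤ ENNReal.ofReal m)
    (h2 : eLpNorm g 2 volume ≤ ENNReal.ofReal (√m)) : ‖⟪h, g⟫_ℂ‖ₑ ≤ B := by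
  obtain ⟨K, hK, hle⟩ := exists_eLpNorm_one_le (N := N)
  have hgm : AEStronglyMeasurable g (volume : Measure (Space N)) :=
    (Lp.stronglyMeasurable g).aestronglyMeasurable
  -- Schwartz approximations of g may violate the two constraints slightly; they satisfy them after
  -- division by c, and c then tends to 1.
  suffices H : ∀ c : ℝ, 1 < c → ‖⟪h, g⟫_ℂ‖ₑ ≤ ENNReal.ofReal c * B by
    have ht : Tendsto (fun c : ℝ => ENNReal.ofReal c * B) (𝓝[>] 1) (𝓝 (ENNReal.ofReal 1 * B)) :=
      ENNReal.Tendsto.mul_const ((ENNReal.tendsto_ofReal tendsto_id).mono_left nhdsWithin_le_nhds)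
        (Or.inl (by simp))
    rw [ENNReal.ofReal_one, one_mul] at ht
    exact ge_of_tendsto ht (eventually_mem_nhdsWithin.mono fun c hc => H c hc)
  intro c hc
  have hc0 : 0 < c := by linarith
  have hd : DenseRange (SchwartzMap.toLpCLM ℝ (E := Space N) ℂ 2 (wvol N)) :=
    SchwartzMap.denseRange_toLpCLM ENNReal.ofNat_ne_top
  -- Chosen so that m + Kε ≤ c m and √m + ε ≤ c √m; K + 1 avoids division by zero.
  set ε : ℝ := min ((c - 1) * m / (K + 1)) ((c - 1) * √m) with hε
  have hsm : 0 < √m := Real.sqrt_pos.2 hm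
  have hε0 : 0 < ε := lt_min (by have : 0 < c - 1 := by linarith
                                 positivity) (mul_pos (by linarith) hsm)
  have hcl : g ∈ closure {f : Lp ℂ 2 (wvol N) | ‖⟪h, f⟫_ℂ‖ₑ ≤ ENNReal.ofReal c * B} := by
    rw [Metric.mem_closure_iff]
    intro η hη
    obtain ⟨ψ, hψ⟩ := hd.exists_dist_lt g (lt_min hε0 hη)
    refine ⟨ψ.toLp 2 (wvol N), ?_, hψ.trans_le (min_le_right _ _)⟩
    have hdist : eLpNorm (fun x => ψ x - g x) 2 (wvol N) ≤ ENNReal.ofReal ε := by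
      have e : ‖ψ.toLp 2 (wvol N) - g‖ ≤ ε := by
        rw [← dist_eq_norm, dist_comm]
        exact (hψ.trans_le (min_le_left _ _)).le
      rw [Lp.norm_def] at e
      refine le_trans (le_of_eq (eLpNorm_congr_ae ?_))
        ((ENNReal.le_ofReal_iff_toReal_le (Lp.eLpNorm_ne_top _) hε0.le).2 e)
      filter_upwards [Lp.coeFn_sub (ψ.toLp 2 (wvol N)) g, ψ.coeFn_toLp 2 (wvol N)] with x h3 h4
      rw [h3, Pi.sub_apply, h4]
    have hsub : AEStronglyMeasurable (fun x => ψ x - g x) (volume : Measure (Space N)) :=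
      ψ.continuous.aestronglyMeasurable.sub hgm
    have hsplit : (ψ : Space N → ℂ) = (fun x => g x) + fun x => ψ x - g x := by
      funext x; simp
    have b1 : eLpNorm ψ 1 volume ≤ ENNReal.ofReal (c * m) := by
      rw [hsplit]
      refine (eLpNorm_add_le hgm hsub le_rfl).trans ?_
      calc _ ≤ ENNReal.ofReal m + ENNReal.ofReal K * ENNReal.ofReal ε := by
            gcongr
            exact (hle _ hsub).trans (by gcongr)
        _ = ENNReal.ofReal (m + K * ε) := by
            rw [← ENNReal.ofReal_mul hK, ← ENNReal.ofReal_add hm.le (by positivity)]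
        _ ≤ _ := by
            refine ENNReal.ofReal_le_ofReal ?_
            have : ε ≤ (c - 1) * m / (K + 1) := min_le_left _ _
            rw [le_div_iff₀ (by positivity)] at this
            nlinarith
    have b2 : eLpNorm ψ 2 volume ≤ ENNReal.ofReal (c * √m) := by
      rw [hsplit]
      refine (eLpNorm_add_le hgm hsub (by norm_num)).trans ?_
      calc _ ≤ ENNReal.ofReal (√m) + ENNReal.ofReal ε := by
            gcongr
            exact (eLpNorm_two_le _).trans hdist
        _ = ENNReal.ofReal (√m + ε) := by rw [← ENNReal.ofReal_add hsm.le hε0.le]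
        _ ≤ _ := by
            refine ENNReal.ofReal_le_ofReal ?_
            have : ε ≤ (c - 1) * √m := min_le_right _ _
            linarith
    have hcc : ‖((c⁻¹ : ℝ) : ℂ)‖ₑ = ENNReal.ofReal c⁻¹ := by
      rw [← ofReal_norm, Complex.norm_real, Real.norm_of_nonneg (by positivity)]
    have hs : ∀ p : ℝ≥0∞, eLpNorm ((((c⁻¹ : ℝ) : ℂ) • ψ : 𝓢(Space N, ℂ))) p volume =
        ENNReal.ofReal c⁻¹ * eLpNorm ψ p volume := by
      intro p
      rw [← hcc, ← eLpNorm_const_smul ((c⁻¹ : ℝ) : ℂ) (ψ : Space N → ℂ)]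
      rfl
    have h5 := hB (((c⁻¹ : ℝ) : ℂ) • ψ) (by
      rw [hs]
      calc _ ≤ ENNReal.ofReal c⁻¹ * ENNReal.ofReal (c * m) := by gcongr
        _ = _ := by rw [← ENNReal.ofReal_mul (by positivity)]; congr 1; field_simp) (by
      rw [hs]
      calc _ ≤ ENNReal.ofReal c⁻¹ * ENNReal.ofReal (c * √m) := by gcongr
        _ = _ := by rw [← ENNReal.ofReal_mul (by positivity)]; congr 1; field_simp)
    have h6 : (((c⁻¹ : ℝ) : ℂ) • ψ).toLp 2 (wvol N) = ((c⁻¹ : ℝ) : ℂ) • ψ.toLp 2 (wvol N) :=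
      (SchwartzMap.toLpCLM ℂ (E := Space N) ℂ 2 (wvol N)).map_smul _ _
    rw [h6, inner_smul_right, enorm_mul, hcc] at h5
    rw [mem_ofPred_eq]
    calc _ = ENNReal.ofReal c * (ENNReal.ofReal c⁻¹ * ‖⟪h, ψ.toLp 2 (wvol N)⟫_ℂ‖ₑ) := by
          rw [← mul_assoc, ← ENNReal.ofReal_mul hc0.le, mul_inv_cancel₀ hc0.ne', ENNReal.ofReal_one,
            one_mul]
      _ ≤ _ := by gcongr
  rwa [IsClosed.closure_eq (isClosed_le (by fun_prop) continuous_const)] at hcl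

/-- Duality between the `K`-functional at scale `m` and Schwartz functions. -/
theorem IsRep.kfun_le {φ : Fn N} {V : 𝓢(Space N, ℂ) → ℂ} (hφ : IsRep φ V) {m : ℝ} (hm : 0 < m)
    {B : ℝ≥0∞} (hB : ∀ ψ : 𝓢(Space N, ℂ), eLpNorm ψ 1 volume ≤ ENNReal.ofReal m →
      eLpNorm ψ 2 volume ≤ ENNReal.ofReal (√m) → ‖V ψ‖ₑ ≤ B) :
    kfun volume (fun x => ‖φ x‖ₑ) m ≤ B := by
  obtain ⟨h, rfl, e⟩ := hφ
  simp_rw [e] at hB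
  have hh : Measurable h := (Lp.stronglyMeasurable h).measurable
  refine NLS.kfun_le fun w hw hw1 hwm => ?_
  have hmono : ∫⁻ x, w x * ‖repFn h x‖ₑ =
      ⨆ n : ℕ, ∫⁻ x in Metric.ball 0 n, w x * ‖repFn h x‖ₑ := by
    rw [← setLIntegral_iUnion_of_directed, Metric.iUnion_ball_nat, setLIntegral_univ]
    exact (monotone_nat_of_le_succ fun n => Metric.ball_subset_ball (by simp)).directed_le
  rw [hmono]
  refine iSup_le fun n => ?_
  -- Restricting to a ball, which has finite weighted measure, puts the test function in the
  -- weighted L² space.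
  set b : Set (Space N) := Metric.ball 0 n with hb
  have hbm : MeasurableSet b := measurableSet_ball
  let s : ℂ → ℂ := fun z => z / (‖z‖ : ℂ)
  have hs : Measurable s := by fun_prop
  have hs1 : ∀ z, ‖s z‖ ≤ 1 := fun z => by
    simp only [s, norm_div, Complex.norm_real, norm_norm]
    exact div_self_le_one _
  -- The phase of h is chosen to cancel the conjugate in `repFn`, so that pairing h with G yields
  -- the integral of w|φ| over the ball.
  let G : Space N → ℂ := b.indicator fun x => ((w x).toReal : ℂ) * s (h x)
  have hGm : Measurable G := by
    refine Measurable.indicator ?_ hbm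
    exact (Complex.measurable_ofReal.comp hw.ennreal_toReal).mul (hs.comp hh)
  have hGw : ∀ x, ‖G x‖ₑ ≤ w x := fun x => by
    simp only [G]
    by_cases hx : x ∈ b
    · rw [indicator_of_mem hx, enorm_mul, ← ofReal_norm, Complex.norm_real,
        Real.norm_of_nonneg ENNReal.toReal_nonneg,
        ENNReal.ofReal_toReal (ne_top_of_le_ne_top ENNReal.one_ne_top (hw1 x))]
      calc w x * ‖s (h x)‖ₑ ≤ w x * 1 := by
            gcongr
            exact enorm_le_one_iff.2 (hs1 _)
        _ = w x := mul_one _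
    · rw [indicator_of_notMem hx, enorm_zero]; exact zero_le
  have hG2 : MemLp G 2 (wvol N) := by
    have hbig : MemLp (b.indicator fun _ : Space N => (1 : ℂ)) 2 (wvol N) :=
      memLp_indicator_const 2 hbm 1 (Or.inr measure_ball_lt_top.ne)
    refine hbig.mono hGm.aestronglyMeasurable (Eventually.of_forall fun x => ?_)
    by_cases hx : x ∈ b
    · rw [indicator_of_mem hx]
      simpa using enorm_le_one_iff.1 ((hGw x).trans (hw1 x))
    · simp [G, hx]
  have hcoe : ∀ᵐ x, hG2.toLp G x = G x := ae_wvol_iff.1 hG2.coeFn_toLp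
  have n1 : eLpNorm G 1 volume ≤ ENNReal.ofReal m := by
    rw [eLpNorm_one_eq_lintegral_enorm]
    exact (lintegral_mono fun x => hGw x).trans hwm
  -- Since w ≤ 1, w² ≤ w, so the L² constraint follows from the mass constraint.
  have n2 : eLpNorm G 2 volume ≤ ENNReal.ofReal (√m) := by
    rw [eLpNorm_eq_lintegral_rpow_enorm_toReal (by norm_num) (by norm_num), Real.sqrt_eq_rpow,
      ← ENNReal.ofReal_rpow_of_pos hm]
    simp only [ENNReal.toReal_ofNat]
    gcongr
    refine le_trans (lintegral_mono fun x => ?_) hwm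
    rw [ENNReal.rpow_two, sq]
    calc ‖G x‖ₑ * ‖G x‖ₑ ≤ w x * 1 := mul_le_mul' (hGw x) ((hGw x).trans (hw1 x))
      _ = w x := mul_one _
  have h3 := enorm_inner_le h hm hB (hG2.toLp G) (by rwa [eLpNorm_congr_ae hcoe])
    (by rwa [eLpNorm_congr_ae hcoe])
  refine le_trans (le_of_eq ?_) h3
  set I : Space N → ℂ := b.indicator fun x => ((w x).toReal : ℂ) * repFn h x with hI
  have pt : (fun x => (wt x) • ⟪h x, hG2.toLp G x⟫_ℂ) =ᵐ[volume] fun x => ((‖I x‖ : ℝ) : ℂ) := by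
    filter_upwards [hcoe, coeFn_repFn h] with x h4 h5
    rw [h4]
    by_cases hx : x ∈ b
    · simp only [G, I, indicator_of_mem hx, h5, RCLike.inner_apply, norm_mul, Complex.norm_real,
        RCLike.norm_conj, Real.norm_of_nonneg ENNReal.toReal_nonneg,
        Real.norm_of_nonneg (wt x).coe_nonneg, s]
      rcases eq_or_ne (h x) 0 with h0 | h0
      · simp [h0]
      · have h7 : (‖h x‖ : ℂ) ≠ 0 := by simpa using h0
        have h6 : h x * conj (h x) = (‖h x‖ : ℂ) * ‖h x‖ := by
          rw [Complex.mul_conj, Complex.normSq_eq_norm_sq]; push_cast; ring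
        rw [NNReal.smul_def, Complex.real_smul]
        push_cast
        field_simp
        linear_combination ((wt x : ℝ) : ℂ) * ((w x).toReal : ℂ) * h6
    · simp [G, I, hx]
  have hint : Integrable I := by
    have h1 := L2.integrable_inner h (hG2.toLp G) (𝕜 := ℂ)
    rw [integrable_wvol_iff] at h1
    refine (integrable_norm_iff ?_).1 ((h1.congr pt).norm.congr (Eventually.of_forall fun x => ?_))
    · refine AEStronglyMeasurable.indicator ?_ hbm
      exact (Complex.measurable_ofReal.comp hw.ennreal_toReal).aestronglyMeasurable.mul
        (repFn h).aestronglyMeasurable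
    · simp
  have key : ⟪h, hG2.toLp G⟫_ℂ = ((∫ x, ‖I x‖ : ℝ) : ℂ) := by
    rw [L2.inner_def, integral_wvol, integral_congr_ae pt]
    exact integral_complex_ofReal
  rw [key, ← ofReal_norm, Complex.norm_real, Real.norm_of_nonneg
    (integral_nonneg fun _ => norm_nonneg _), ← lintegral_indicator hbm]
  rw [ofReal_integral_norm_eq_lintegral_enorm hint]
  refine lintegral_congr fun x => ?_
  by_cases hx : x ∈ b
  · rw [hI, indicator_of_mem hx, indicator_of_mem hx, enorm_mul]
    congr 1
    rw [← ofReal_norm, Complex.norm_real, Real.norm_of_nonneg ENNReal.toReal_nonneg,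
      ENNReal.ofReal_toReal (ne_top_of_le_ne_top ENNReal.one_ne_top (hw1 x))]
  · simp [I, hx]

end Representation

/-! ### Dispersive decay in Lorentz spaces, integrated in time. -/

section RetardedIntegral

variable {N : ℕ} {P R : ℝ} {q : ℝ≥0∞} [hq : Fact (1 ≤ q)] [hP : Fact (1 ≤ P)]

/-- The exponent of the dispersive decay `L^{R',q} → L^{R,q}`. -/
def decayExp (N : ℕ) (R : ℝ) : ℝ := N * (1 / 2 - 1 / R)

/-- The kernel of the dispersive estimate in logarithmic variables. -/
def dispKernel (N : ℕ) (R τ s : ℝ) : ℝ≥0∞ :=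
  ENNReal.ofReal (Real.exp (s / R) * min (Real.exp (-(1 / 2) * s)) (τ ^ (-((N : ℝ) / 2))))

/-- The constant of the dispersive estimate. -/
def dispConst (R : ℝ) : ℝ := 1 / (1 / R) + Real.exp (1 / 2 - 1 / R) / (1 / 2 - 1 / R)

theorem half_sub_inv_pos (hR : 2 < R) : 0 < 1 / 2 - 1 / R :=
  sub_pos.2 (one_div_lt_one_div_of_lt two_pos hR)

theorem dispConst_pos (hR : 2 < R) : 0 < dispConst R := by
  have := half_sub_inv_pos hR
  unfold dispConst
  positivity

theorem measurable_dispKernel : Measurable fun z : ℝ × ℝ => dispKernel N R z.1 z.2 := by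
  unfold dispKernel
  fun_prop

theorem lintegral_dispKernel_le (hR : 2 < R) {τ : ℝ} (hτ : 0 < τ) :
    ∫⁻ s, dispKernel N R τ s ≤ ENNReal.ofReal (dispConst R) * ENNReal.ofReal (τ ^ (-decayExp N R)) := by
  have hR0 : 0 < R := by linarith
  have hb := half_sub_inv_pos hR
  -- The branches exp(-s/2) and τ^{-N/2} cross at s = N log τ. Translating there extracts the power
  -- of τ and leaves a fixed kernel.
  rw [← lintegral_add_right_eq_self _ (N * Real.log τ)]
  calc _ = ∫⁻ s : ℝ, ENNReal.ofReal (τ ^ (-decayExp N R)) *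
        min (ENNReal.ofReal (Real.exp (1 / R * s)))
          (ENNReal.ofReal (Real.exp (-(1 / 2 - 1 / R) * s))) := by
        refine lintegral_congr fun s => ?_
        rw [dispKernel, ← ENNReal.ofReal_mono.map_min, ← ENNReal.ofReal_mul (by positivity)]
        congr 1
        rw [Real.rpow_def_of_pos hτ, Real.rpow_def_of_pos hτ,
          mul_min_of_nonneg _ _ (Real.exp_pos _).le, mul_min_of_nonneg _ _ (Real.exp_pos _).le,
          ← Real.exp_add, ← Real.exp_add, ← Real.exp_add, ← Real.exp_add, min_comm]
        congr 2 <;> · rw [decayExp]; ring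
    _ = ENNReal.ofReal (τ ^ (-decayExp N R)) * ∫⁻ s : ℝ,
        min (ENNReal.ofReal (Real.exp (1 / R * s)))
          (ENNReal.ofReal (Real.exp (-(1 / 2 - 1 / R) * s))) :=
        lintegral_const_mul' _ _ ENNReal.ofReal_ne_top
    _ ≤ ENNReal.ofReal (τ ^ (-decayExp N R)) * ENNReal.ofReal (dispConst R) := by
        gcongr
        exact lintegral_min_exp_le (by positivity) hb
    _ = _ := mul_comm _ _

/-- Unitarity bounds the evolved test function in L² and dispersion bounds it in supremum, which is
the input of `lintegral_mul_enorm_le`. -/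
theorem enorm_pair_propagate_le {τ : ℝ} (hτ : 0 < τ) (g : lorentz N P q) (ψ : 𝓢(Space N, ℂ))
    {M₁ M₂ : ℝ} (h₁ : eLpNorm ψ 1 volume ≤ ENNReal.ofReal M₁) (hM₁ : 0 ≤ M₁)
    (h₂ : eLpNorm ψ 2 volume ≤ ENNReal.ofReal M₂) (hM₂ : 0 ≤ M₂) :
    ‖pair (propagate N τ ψ) g‖ₑ ≤ ∫⁻ z : ℝ, ENNReal.ofReal
      (min (M₂ * Real.exp (-(1 / 2) * z)) (τ ^ (-((N : ℝ) / 2)) * M₁)) * kf g z := by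
  refine (enorm_integral_le_lintegral_enorm _).trans ?_
  simp_rw [enorm_mul]
  refine lintegral_mul_enorm_le g (measurable_enorm_schwartz _) hM₂ (by positivity) ?_ fun x => ?_
  · rw [eLpNorm_schwartz, norm_toLp_two_propagate, ← eLpNorm_schwartz, eLpNorm_enorm]
    exact h₂
  · rw [← ofReal_norm]
    refine ENNReal.ofReal_le_ofReal ((norm_propagate_apply_le_dispersive hτ.ne' ψ x).trans ?_)
    rw [abs_of_pos hτ]
    gcongr
    rw [eLpNorm_one_eq_lintegral_enorm, ← ofReal_integral_norm_eq_lintegral_enorm ψ.integrable] at h₁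
    exact (ENNReal.ofReal_le_ofReal_iff hM₁).1 h₁

/-- The functional `ψ ↦ ∫_0^∞ ⟨e^{iτΔ} H(τ), ψ⟩ dτ`. -/
def retarded (H : ℝ → lorentz N P q) (ψ : 𝓢(Space N, ℂ)) : ℂ :=
  ∫ τ in Ioi (0 : ℝ), pair (propagate N τ ψ) (H τ)

/-- The majorant of `retarded` at scale `exp x`. -/
def retardedMaj (R : ℝ) (H : ℝ → lorentz N P q) (x : ℝ) : ℝ≥0∞ :=
  ∫⁻ τ in Ioi (0 : ℝ), (∫⁻ z : ℝ, dispKernel N R τ (x + z) *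
    (ENNReal.ofReal (Real.exp (-(z / R))) * kf (H τ) z))

/-- For M = 1 the hypotheses are those met by a K-functional weight at scale exp x; with them the
kernel depends on x and z through x + z only. General M, at x = 0, gives continuity in the L¹ and L²
norms of ψ. -/
theorem lintegral_enorm_pair_le (H : ℝ → lorentz N P q) (ψ : 𝓢(Space N, ℂ))
    {x M : ℝ} (hM : 0 ≤ M) (h₁ : eLpNorm ψ 1 volume ≤ ENNReal.ofReal (M * Real.exp x))
    (h₂ : eLpNorm ψ 2 volume ≤ ENNReal.ofReal (M * Real.exp (x / 2))) :
    ENNReal.ofReal (Real.exp (x * (1 / R - 1))) *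
      (∫⁻ τ in Ioi (0 : ℝ), ‖pair (propagate N τ ψ) (H τ)‖ₑ) ≤
      ENNReal.ofReal M * retardedMaj R H x := by
  rw [retardedMaj, ← lintegral_const_mul' _ _ ENNReal.ofReal_ne_top,
    ← lintegral_const_mul' _ _ ENNReal.ofReal_ne_top]
  refine setLIntegral_mono' measurableSet_Ioi fun τ hτ => ?_
  have hb := enorm_pair_propagate_le hτ (H τ) ψ h₁ (by positivity) h₂ (by positivity)
  refine (mul_le_mul_right hb _).trans (le_of_eq ?_)
  rw [← lintegral_const_mul' _ _ ENNReal.ofReal_ne_top,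
    ← lintegral_const_mul' _ _ ENNReal.ofReal_ne_top]
  refine lintegral_congr fun z => ?_
  have eassoc : ∀ a b c d : ℝ≥0∞, a * (b * (c * d)) = a * b * c * d := fun a b c d => by ring
  rw [dispKernel, eassoc, ← mul_assoc, ← ENNReal.ofReal_mul (Real.exp_pos _).le,
    ← ENNReal.ofReal_mul hM, ← ENNReal.ofReal_mul (by
      have : 0 ≤ τ ^ (-((N : ℝ) / 2)) := Real.rpow_nonneg (le_of_lt hτ) _
      positivity)]
  congr 2
  have e1 : M * Real.exp (x / 2) * Real.exp (-(1 / 2) * z) =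
      M * Real.exp x * Real.exp (-(1 / 2) * (x + z)) := by
    rw [mul_assoc, mul_assoc, ← Real.exp_add, ← Real.exp_add]; congr 2; ring
  have e2 : τ ^ (-((N : ℝ) / 2)) * (M * Real.exp x) = M * Real.exp x * τ ^ (-((N : ℝ) / 2)) := by
    ring
  rw [e1, e2, ← mul_min_of_nonneg _ _ (by positivity : 0 ≤ M * Real.exp x)]
  have e3 : Real.exp (x * (1 / R - 1)) * Real.exp x =
      Real.exp ((x + z) / R) * Real.exp (-(z / R)) := by
    rw [← Real.exp_add, ← Real.exp_add]; congr 1; ring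
  linear_combination M * min (Real.exp (-(1 / 2) * (x + z))) (τ ^ (-((N : ℝ) / 2))) * e3

variable {H : ℝ → lorentz N P q}

theorem measurable_retardedMaj_integrand (hH : StronglyMeasurable H) :
    Measurable fun w : (ℝ × ℝ) × ℝ => dispKernel N R w.1.2 (w.1.1 + w.2) *
      (ENNReal.ofReal (Real.exp (-(w.2 / R))) * kf (H w.1.2) w.2) := by
  have h1 : Measurable fun w : (ℝ × ℝ) × ℝ => dispKernel N R w.1.2 (w.1.1 + w.2) :=
    measurable_dispKernel.comp (f := fun w : (ℝ × ℝ) × ℝ => (w.1.2, w.1.1 + w.2)) (by fun_prop)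
  have h2 : Measurable fun w : (ℝ × ℝ) × ℝ => kf (H w.1.2) w.2 :=
    (measurable_kf hH).comp (f := fun w : (ℝ × ℝ) × ℝ => (w.2, w.1.2)) (by fun_prop)
  exact h1.mul (Measurable.mul (by fun_prop) h2)

/-- Minkowski over τ, then Young in the logarithmic scale at each τ. Since 1/R = 1 - 1/P, the factor
paired with the kernel is the integrand of the L^{P,q} norm. -/
theorem eLpNorm_retardedMaj_le (hR : 2 < R) (hRP : 1 / R = 1 - 1 / P) (hH : StronglyMeasurable H) :
    eLpNorm (retardedMaj R H) q volume ≤ ENNReal.ofReal (dispConst R) *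
      ∫⁻ τ in Ioi (0 : ℝ), ENNReal.ofReal (τ ^ (-decayExp N R)) * ‖H τ‖ₑ := by
  have hm := (measurable_retardedMaj_integrand (R := R) hH).lintegral_prod_right'
    (ν := (volume : Measure ℝ))
  refine (eLpNorm_lintegral_le (μ := volume) (ν := volume.restrict (Ioi (0 : ℝ)))
    (F := fun x τ => ∫⁻ z : ℝ, dispKernel N R τ (x + z) *
      (ENNReal.ofReal (Real.exp (-(z / R))) * kf (H τ) z)) hm hq.out).trans ?_
  rw [← lintegral_const_mul' _ _ ENNReal.ofReal_ne_top]
  refine setLIntegral_mono' measurableSet_Ioi fun τ hτ => ?_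
  set G : ℝ → ℝ≥0∞ := fun z => ENNReal.ofReal (Real.exp (-(z / R))) * kf (H τ) z with hG
  have hGm : Measurable G := Measurable.mul (by fun_prop) (kf_continuous (H τ)).measurable
  have hGn : eLpNorm G q volume = ‖H τ‖ₑ := by
    rw [lorentz_enorm_def, fnorm, kNorm]
    refine congrArg (fun g => eLpNorm g q volume) (funext fun z => ?_)
    simp only [hG, kf]
    congr 3
    have : 1 / P = 1 - 1 / R := by linarith
    rw [this]; ring
  have hk : Measurable (dispKernel N R τ) :=
    measurable_dispKernel.comp (f := fun s : ℝ => (τ, s)) (by fun_prop)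
  -- The kernel depends on x + z because duality reverses scales; reflecting x gives the form
  -- required by Young's inequality and preserves the norm.
  have hrefl : (fun x : ℝ => ∫⁻ z, dispKernel N R τ (x + z) * G z) =
      (fun x => ∫⁻ s, dispKernel N R τ s * G (x + s)) ∘ Neg.neg := by
    funext x
    simp only [Function.comp_apply]
    rw [← lintegral_add_left_eq_self (fun s => dispKernel N R τ s * G (-x + s)) x]
    simp
  rw [hrefl, eLpNorm_comp_measurePreserving _ (Measure.measurePreserving_neg volume)]
  · refine (eLpNorm_lintegral_mul_comp_add_le hk hGm hq.out).trans ?_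
    rw [hGn, ← mul_assoc]
    gcongr
    exact lintegral_dispKernel_le hR hτ
  · refine Measurable.aestronglyMeasurable ?_
    refine Measurable.lintegral_prod_right'
      (f := fun w : ℝ × ℝ => dispKernel N R τ w.2 * G (w.1 + w.2)) ?_
    exact (hk.comp measurable_snd).mul (hGm.comp (measurable_fst.add measurable_snd))

/-- A pointwise bound, obtained by inserting `kf_le`. It makes the retarded functional bounded
before any representing function is known. -/
theorem retardedMaj_zero_le (hR : 2 < R) (hRP : 1 / R = 1 - 1 / P) (H : ℝ → lorentz N P q) :
    retardedMaj R H 0 ≤ ENNReal.ofReal (Real.exp (1 / R) * dispConst R) *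
      ∫⁻ τ in Ioi (0 : ℝ), ENNReal.ofReal (τ ^ (-decayExp N R)) * ‖H τ‖ₑ := by
  rw [retardedMaj, ← lintegral_const_mul' _ _ ENNReal.ofReal_ne_top]
  refine setLIntegral_mono' measurableSet_Ioi fun τ hτ => ?_
  have hc := (dispConst_pos hR).le
  calc _ ≤ ∫⁻ z : ℝ, dispKernel N R τ z * (ENNReal.ofReal (Real.exp (1 / R)) * ‖H τ‖ₑ) := by
        refine lintegral_mono fun z => ?_
        rw [zero_add]
        refine mul_le_mul_right ((mul_le_mul_right (kf_le (H τ) z) _).trans (le_of_eq ?_)) _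
        rw [← mul_assoc, ← ENNReal.ofReal_mul (Real.exp_pos _).le, ← Real.exp_add, ← hRP]
        congr 3
        ring
    _ = (∫⁻ z : ℝ, dispKernel N R τ z) * (ENNReal.ofReal (Real.exp (1 / R)) * ‖H τ‖ₑ) :=
        lintegral_mul_const' _ _ (ENNReal.mul_ne_top ENNReal.ofReal_ne_top enorm_ne_top)
    _ ≤ ENNReal.ofReal (dispConst R) * ENNReal.ofReal (τ ^ (-decayExp N R)) *
          (ENNReal.ofReal (Real.exp (1 / R)) * ‖H τ‖ₑ) := by
        gcongr
        exact lintegral_dispKernel_le hR hτ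
    _ = _ := by
        rw [ENNReal.ofReal_mul (Real.exp_pos _).le]
        ring

theorem enorm_retarded_le (H : ℝ → lorentz N P q) (ψ : 𝓢(Space N, ℂ)) :
    ‖retarded H ψ‖ₑ ≤ ∫⁻ τ in Ioi (0 : ℝ), ‖pair (propagate N τ ψ) (H τ)‖ₑ :=
  enorm_integral_le_lintegral_enorm _

/-- The `L^{R,q}` estimate of the retarded integral. -/
theorem fnorm_le_of_isRep_retarded (hR : 2 < R) (hRP : 1 / R = 1 - 1 / P)
    (hH : StronglyMeasurable H) {φ : Fn N} (hφ : IsRep φ (retarded H)) :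
    fnorm R q φ ≤ ENNReal.ofReal (dispConst R) *
      ∫⁻ τ in Ioi (0 : ℝ), ENNReal.ofReal (τ ^ (-decayExp N R)) * ‖H τ‖ₑ := by
  refine le_trans ?_ (eLpNorm_retardedMaj_le hR hRP hH)
  rw [fnorm, kNorm]
  refine eLpNorm_mono_enorm fun x => ?_
  simp only [enorm_eq_self]
  have hk := hφ.kfun_le (Real.exp_pos x)
    (B := ENNReal.ofReal (Real.exp (-(x * (1 / R - 1)))) * retardedMaj R H x) fun ψ h1 h2 => by
      have h3 := lintegral_enorm_pair_le (R := R) H ψ (x := x) zero_le_one (by rwa [one_mul])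
        (by rwa [one_mul, Real.exp_half])
      rw [ENNReal.ofReal_one, one_mul] at h3
      calc _ ≤ ENNReal.ofReal (Real.exp (-(x * (1 / R - 1)))) *
            (ENNReal.ofReal (Real.exp (x * (1 / R - 1))) *
              ∫⁻ τ in Ioi (0 : ℝ), ‖pair (propagate N τ ψ) (H τ)‖ₑ) := by
            rw [← mul_assoc, ← ENNReal.ofReal_mul (Real.exp_pos _).le, ← Real.exp_add,
              neg_add_cancel, Real.exp_zero, ENNReal.ofReal_one, one_mul]
            exact enorm_retarded_le H ψ
        _ ≤ _ := by gcongr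
  calc _ ≤ ENNReal.ofReal (Real.exp (x * (1 / R - 1))) *
        (ENNReal.ofReal (Real.exp (-(x * (1 / R - 1)))) * retardedMaj R H x) := by gcongr
    _ = _ := by
        rw [← mul_assoc, ← ENNReal.ofReal_mul (Real.exp_pos _).le, ← Real.exp_add,
          add_neg_cancel, Real.exp_zero, ENNReal.ofReal_one, one_mul]

theorem lintegral_enorm_pair_le_norm (hR : 2 < R) (hRP : 1 / R = 1 - 1 / P)
    (H : ℝ → lorentz N P q) (ψ : 𝓢(Space N, ℂ)) :
    (∫⁻ τ in Ioi (0 : ℝ), ‖pair (propagate N τ ψ) (H τ)‖ₑ) ≤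
      ENNReal.ofReal (‖ψ.toLp 1‖ + ‖ψ.toLp 2‖) *
        (ENNReal.ofReal (Real.exp (1 / R) * dispConst R) *
          ∫⁻ τ in Ioi (0 : ℝ), ENNReal.ofReal (τ ^ (-decayExp N R)) * ‖H τ‖ₑ) := by
  have e1 := eLpNorm_schwartz ψ 1
  have e2 := eLpNorm_schwartz ψ 2
  rw [eLpNorm_enorm] at e1 e2
  have h1 : 0 ≤ ‖ψ.toLp 1‖ := norm_nonneg _
  have h2 : 0 ≤ ‖ψ.toLp 2‖ := norm_nonneg _
  generalize ‖ψ.toLp 1‖ = a at *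
  generalize ‖ψ.toLp 2‖ = b at *
  have h3 := lintegral_enorm_pair_le (R := R) H ψ (x := 0) (M := a + b) (by positivity)
    (by rw [e1]; refine ENNReal.ofReal_le_ofReal ?_; simp; exact h2)
    (by rw [e2]; refine ENNReal.ofReal_le_ofReal ?_; simp; exact h1)
  simp only [zero_mul, Real.exp_zero, ENNReal.ofReal_one, one_mul] at h3
  refine h3.trans ?_
  gcongr
  exact retardedMaj_zero_le hR hRP H

theorem stronglyMeasurable_pair_propagate (h1 : 1 < P) (h2 : P < 2) (hH : StronglyMeasurable H)
    (ψ : 𝓢(Space N, ℂ)) : StronglyMeasurable fun τ => pair (propagate N τ ψ) (H τ) := by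
  have hp : StronglyMeasurable fun τ : ℝ => (τ, H τ) := stronglyMeasurable_id.prodMk hH
  have := Continuous.comp_stronglyMeasurable (f := fun τ : ℝ => (τ, H τ))
    (g := fun z : ℝ × lorentz N P q => pair (propagate N z.1 ψ) z.2)
    (continuous_pair_propagate h1 h2 ψ) hp
  exact this

theorem integrableOn_pair_propagate (h1 : 1 < P) (h2 : P < 2) (hR : 2 < R)
    (hRP : 1 / R = 1 - 1 / P) (hH : StronglyMeasurable H)
    (hfin : ∫⁻ τ in Ioi (0 : ℝ), ENNReal.ofReal (τ ^ (-decayExp N R)) * ‖H τ‖ₑ < ∞)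
    (ψ : 𝓢(Space N, ℂ)) : IntegrableOn (fun τ => pair (propagate N τ ψ) (H τ)) (Ioi 0) :=
  ⟨(stronglyMeasurable_pair_propagate h1 h2 hH ψ).aestronglyMeasurable,
    (lintegral_enorm_pair_le_norm hR hRP H ψ).trans_lt (ENNReal.mul_lt_top ENNReal.ofReal_lt_top
      (ENNReal.mul_lt_top ENNReal.ofReal_lt_top hfin))⟩

theorem exists_isRep_retarded (h1 : 1 < P) (h2 : P < 2) (hR : 2 < R)
    (hRP : 1 / R = 1 - 1 / P) (hH : StronglyMeasurable H)
    (hfin : ∫⁻ τ in Ioi (0 : ℝ), ENNReal.ofReal (τ ^ (-decayExp N R)) * ‖H τ‖ₑ < ∞) :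
    ∃ φ : Fn N, IsRep φ (retarded H) := by
  let V : 𝓢(Space N, ℂ) →ₗ[ℂ] ℂ :=
    { toFun := retarded H
      map_add' := fun ψ₁ ψ₂ => by
        simp only [retarded, propagate_add, pair_add_left h1 h2]
        exact integral_add (integrableOn_pair_propagate h1 h2 hR hRP hH hfin ψ₁)
          (integrableOn_pair_propagate h1 h2 hR hRP hH hfin ψ₂)
      map_smul' := fun c ψ => by
        simp only [retarded, propagate_smul, pair_smul_left, RingHom.id_apply, smul_eq_mul]
        exact integral_const_mul _ _ }
  set J := ENNReal.ofReal (Real.exp (1 / R) * dispConst R) *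
    ∫⁻ τ in Ioi (0 : ℝ), ENNReal.ofReal (τ ^ (-decayExp N R)) * ‖H τ‖ₑ with hJ
  have hJt : J ≠ ∞ := (ENNReal.mul_lt_top ENNReal.ofReal_lt_top hfin).ne
  refine exists_isRep V (K := J.toReal) fun ψ => ?_
  have h3 := (enorm_retarded_le H ψ).trans (lintegral_enorm_pair_le_norm hR hRP H ψ)
  have h4 : 0 ≤ ‖ψ.toLp 1‖ + ‖ψ.toLp 2‖ := add_nonneg (norm_nonneg _) (norm_nonneg _)
  rw [← hJ, ← ENNReal.ofReal_toReal hJt, ← ENNReal.ofReal_mul h4, ← ofReal_norm, mul_comm] at h3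
  exact (ENNReal.ofReal_le_ofReal_iff (mul_nonneg ENNReal.toReal_nonneg h4)).1 h3

end RetardedIntegral

/-! ### The Duhamel integral as a measurable map of time into the Lorentz space. -/

section TimeDependent

variable {N : ℕ} {P R : ℝ} {q : ℝ≥0∞} [hq : Fact (1 ≤ q)] [hP : Fact (1 ≤ P)] [hR' : Fact (1 ≤ R)]

/-- The majorant `∫_0^∞ τ^{-δ} ‖H(τ)‖ dτ`. -/
def decayInt (R : ℝ) (H : ℝ → lorentz N P q) : ℝ≥0∞ :=
  ∫⁻ τ in Ioi (0 : ℝ), ENNReal.ofReal (τ ^ (-decayExp N R)) * ‖H τ‖ₑ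

theorem IsRep.retarded_sub (h1 : 1 < P) (h2 : P < 2) (hR : 2 < R) (hRP : 1 / R = 1 - 1 / P)
    {H₁ H₂ : ℝ → lorentz N P q} (hH₁ : StronglyMeasurable H₁) (hH₂ : StronglyMeasurable H₂)
    (hf₁ : decayInt R H₁ < ∞) (hf₂ : decayInt R H₂ < ∞) {φ₁ φ₂ : Fn N}
    (hφ₁ : IsRep φ₁ (retarded H₁)) (hφ₂ : IsRep φ₂ (retarded H₂)) :
    IsRep (φ₁ - φ₂) (retarded fun τ => H₁ τ - H₂ τ) := by
  have : (retarded fun τ => H₁ τ - H₂ τ) = fun ψ => retarded H₁ ψ - retarded H₂ ψ := by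
    funext ψ
    simp only [retarded, pair_sub_right h1 h2]
    exact integral_sub (integrableOn_pair_propagate h1 h2 hR hRP hH₁ hf₁ ψ)
      (integrableOn_pair_propagate h1 h2 hR hRP hH₂ hf₂ ψ)
  rw [this]
  exact hφ₁.sub hφ₂

open Classical in
/-- The function in `L^{R,q}` representing the retarded integral of `F` at time `t` (zero if there
is none). -/
def evolve (R : ℝ) (F : ℝ → lorentz N P q) (t : ℝ) : lorentz N R q :=
  if h : ∃ φ : lorentz N R q, IsRep (φ : Fn N) (retarded fun τ => F (t - τ)) then h.choose else 0

theorem stronglyMeasurable_shift {F : ℝ → lorentz N P q} (hF : StronglyMeasurable F) (t : ℝ) :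
    StronglyMeasurable fun τ => F (t - τ) :=
  hF.comp_measurable (measurable_const.sub measurable_id)

theorem isRep_evolve (h1 : 1 < P) (h2 : P < 2) (hR : 2 < R) (hRP : 1 / R = 1 - 1 / P)
    {F : ℝ → lorentz N P q} (hF : StronglyMeasurable F) {t : ℝ}
    (hfin : decayInt R (fun τ => F (t - τ)) < ∞) :
    IsRep (evolve R F t : Fn N) (retarded fun τ => F (t - τ)) := by
  have hm := stronglyMeasurable_shift hF t
  obtain ⟨φ, hφ⟩ := exists_isRep_retarded h1 h2 hR hRP hm hfin
  have hn : fnorm R q φ < ∞ := (fnorm_le_of_isRep_retarded hR hRP hm hφ).trans_lt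
    (ENNReal.mul_lt_top ENNReal.ofReal_lt_top hfin)
  have hex : ∃ φ : lorentz N R q, IsRep (φ : Fn N) (retarded fun τ => F (t - τ)) := ⟨⟨φ, hn⟩, hφ⟩
  rw [evolve, dif_pos hex]
  exact hex.choose_spec

theorem enorm_evolve_le (h1 : 1 < P) (h2 : P < 2) (hR : 2 < R) (hRP : 1 / R = 1 - 1 / P)
    {F : ℝ → lorentz N P q} (hF : StronglyMeasurable F) (t : ℝ) :
    ‖evolve R F t‖ₑ ≤ ENNReal.ofReal (dispConst R) * decayInt R fun τ => F (t - τ) := by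
  rcases eq_or_ne (decayInt R fun τ => F (t - τ)) ∞ with h | h
  · rw [h, ENNReal.mul_top]
    · exact le_top
    · simpa using dispConst_pos hR
  · rw [lorentz_enorm_def]
    exact fnorm_le_of_isRep_retarded hR hRP (stronglyMeasurable_shift hF t)
      (isRep_evolve h1 h2 hR hRP hF (lt_top_iff_ne_top.2 h))

/-- The difference of the chosen representatives represents the retarded integral of the difference,
and the decay estimate holds for any representative. The case F = G gives continuity in time, the
case s = t stability under approximation. -/
theorem enorm_evolve_sub_le (h1 : 1 < P) (h2 : P < 2) (hR : 2 < R) (hRP : 1 / R = 1 - 1 / P)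
    {F G : ℝ → lorentz N P q} (hF : StronglyMeasurable F) (hG : StronglyMeasurable G) {s t : ℝ}
    (hf₁ : decayInt R (fun τ => F (t - τ)) < ∞) (hf₂ : decayInt R (fun τ => G (s - τ)) < ∞) :
    ‖evolve R F t - evolve R G s‖ₑ ≤
      ENNReal.ofReal (dispConst R) * decayInt R fun τ => F (t - τ) - G (s - τ) := by
  have hm₁ := stronglyMeasurable_shift hF t
  have hm₂ := stronglyMeasurable_shift hG s
  rw [lorentz_enorm_def, Submodule.coe_sub]
  exact fnorm_le_of_isRep_retarded hR hRP (hm₁.sub hm₂)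
    (IsRep.retarded_sub h1 h2 hR hRP hm₁ hm₂ hf₁ hf₂ (isRep_evolve h1 h2 hR hRP hF hf₁)
      (isRep_evolve h1 h2 hR hRP hG hf₂))

theorem lintegral_rpow_indicator_lt_top {δ : ℝ} (hδ : δ < 1) (m : ℝ) (c : ℝ≥0∞) (hc : c ≠ ∞) :
    ∫⁻ τ in Ioi (0 : ℝ), ENNReal.ofReal (τ ^ (-δ)) * (Iio m).indicator (fun _ => c) τ < ∞ := by
  have h1 : IntervalIntegrable (fun x : ℝ => x ^ (-δ)) volume 0 (max m 0) :=
    intervalIntegral.intervalIntegrable_rpow' (by linarith)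
  rw [intervalIntegrable_iff_integrableOn_Ioc_of_le (le_max_right _ _)] at h1
  have h2 : ∫⁻ τ in Ioc (0 : ℝ) (max m 0), ENNReal.ofReal (τ ^ (-δ)) < ∞ := by
    refine lt_of_le_of_lt (lintegral_mono fun τ => ?_) h1.2
    rw [← ofReal_norm]
    exact ENNReal.ofReal_le_ofReal (le_abs_self _)
  calc _ ≤ ∫⁻ τ in Ioi (0 : ℝ),
        (Ioc 0 (max m 0)).indicator (fun τ => ENNReal.ofReal (τ ^ (-δ)) * c) τ := by
        refine setLIntegral_mono' measurableSet_Ioi fun τ hτ => ?_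
        by_cases h : τ < m
        · rw [indicator_of_mem (show τ ∈ Iio m from h),
            indicator_of_mem (show τ ∈ Ioc 0 (max m 0) from ⟨hτ, h.le.trans (le_max_left _ _)⟩)]
        · rw [indicator_of_notMem (show τ ∉ Iio m from h), mul_zero]
          exact zero_le
    _ ≤ ∫⁻ τ, (Ioc 0 (max m 0)).indicator (fun τ => ENNReal.ofReal (τ ^ (-δ)) * c) τ :=
        setLIntegral_le_lintegral _ _
    _ = (∫⁻ τ in Ioc (0 : ℝ) (max m 0), ENNReal.ofReal (τ ^ (-δ))) * c := by
        rw [lintegral_indicator measurableSet_Ioc, lintegral_mul_const' _ _ hc]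
    _ < ∞ := ENNReal.mul_lt_top h2 hc.lt_top

theorem exists_enorm_shift_le {f : ℝ → lorentz N P q} (hf : Continuous f)
    (hs : HasCompactSupport f) : ∃ (ρ C : ℝ), ∀ (B t τ : ℝ), t ≤ B →
      ‖f (t - τ)‖ₑ ≤ (Iio (B + ρ)).indicator (fun _ => ENNReal.ofReal C) τ := by
  obtain ⟨C, hC⟩ := hf.bounded_above_of_compact_support hs
  obtain ⟨ρ, hρ⟩ := hs.isBounded.subset_ball (0 : ℝ)
  refine ⟨ρ, C, fun B t τ ht => ?_⟩
  by_cases h : τ < B + ρ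
  · rw [indicator_of_mem (show τ ∈ Iio (B + ρ) from h), ← ofReal_norm]
    exact ENNReal.ofReal_le_ofReal (hC _)
  · have : f (t - τ) = 0 := by
      refine image_eq_zero_of_notMem_tsupport fun hmem => h ?_
      have := hρ hmem
      rw [mem_ball_zero_iff, Real.norm_eq_abs, abs_lt] at this
      linarith [this.1]
    rw [this, enorm_zero]
    exact zero_le

theorem decayInt_lt_top {f : ℝ → lorentz N P q} (hδ : decayExp N R < 1) (hf : Continuous f)
    (hs : HasCompactSupport f) (t : ℝ) : decayInt R (fun τ => f (t - τ)) < ∞ := by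
  obtain ⟨ρ, C, h⟩ := exists_enorm_shift_le hf hs
  refine lt_of_le_of_lt (lintegral_mono fun τ => ?_)
    (lintegral_rpow_indicator_lt_top hδ (t + ρ) (ENNReal.ofReal C) ENNReal.ofReal_ne_top)
  gcongr
  exact h t t τ le_rfl

/-- Dominated convergence: for t near t₀ the shifted maps are bounded and vanish beyond a common τ,
and τ^{-δ} is integrable at 0 because δ < 1. -/
theorem continuous_evolve (h1 : 1 < P) (h2 : P < 2) (hR : 2 < R) (hRP : 1 / R = 1 - 1 / P)
    (hδ : decayExp N R < 1) {f : ℝ → lorentz N P q} (hf : Continuous f)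
    (hs : HasCompactSupport f) (hfm : StronglyMeasurable f) : Continuous (evolve R f) := by
  rw [continuous_iff_continuousAt]
  intro t₀
  rw [ContinuousAt, tendsto_iff_edist_tendsto_0]
  obtain ⟨ρ, C, h⟩ := exists_enorm_shift_le hf hs
  have hlim : Tendsto (fun t => decayInt R fun τ => f (t - τ) - f (t₀ - τ)) (𝓝 t₀) (𝓝 0) := by
    have e0 : (∫⁻ τ in Ioi (0 : ℝ), (0 : ℝ≥0∞)) = 0 := by simp
    rw [← e0]
    refine tendsto_lintegral_filter_of_dominated_convergence
      (fun τ => ENNReal.ofReal (τ ^ (-decayExp N R)) *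
        (Iio (t₀ + 1 + ρ)).indicator (fun _ => ENNReal.ofReal C + ENNReal.ofReal C) τ) ?_ ?_
      (lintegral_rpow_indicator_lt_top hδ _ _ (by simp)).ne ?_
    · refine Eventually.of_forall fun t => Measurable.mul (measurable_rpow_kernel _) ?_
      exact ((stronglyMeasurable_shift hfm t).sub (stronglyMeasurable_shift hfm t₀)).enorm
    · filter_upwards [Iio_mem_nhds (show t₀ < t₀ + 1 by linarith)] with t ht
      refine Eventually.of_forall fun τ => ?_
      gcongr
      refine enorm_sub_le.trans ((add_le_add (h (t₀ + 1) t τ (le_of_lt ht))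
        (h (t₀ + 1) t₀ τ (by linarith))).trans (le_of_eq ?_))
      by_cases hτ : τ ∈ Iio (t₀ + 1 + ρ)
      · simp only [indicator_of_mem hτ]
      · simp only [indicator_of_notMem hτ, add_zero]
    · refine Eventually.of_forall fun τ => ?_
      have hc : Continuous fun t => ‖f (t - τ) - f (t₀ - τ)‖ₑ := by fun_prop
      have := ENNReal.Tendsto.const_mul (a := ENNReal.ofReal (τ ^ (-decayExp N R)))
        (hc.tendsto t₀) (Or.inr ENNReal.ofReal_ne_top)
      simpa using this
  refine tendsto_of_tendsto_of_tendsto_of_le_of_le tendsto_const_nhds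
    (h := fun t => ENNReal.ofReal (dispConst R) * decayInt R fun τ => f (t - τ) - f (t₀ - τ))
    ?_ (fun _ => zero_le) fun t => ?_
  · simpa using ENNReal.Tendsto.const_mul (a := ENNReal.ofReal (dispConst R)) hlim
      (Or.inr ENNReal.ofReal_ne_top)
  · rw [edist_eq_enorm_sub]
    exact enorm_evolve_sub_le h1 h2 hR hRP hfm hfm (decayInt_lt_top hδ hf hs t)
      (decayInt_lt_top hδ hf hs t₀)

/-- The integrals of h_n^S are summable, so the series of h_n^S converges almost everywhere and its
terms tend to 0. -/
theorem ae_tendsto_zero_of_eLpNorm_le {h : ℕ → ℝ → ℝ≥0∞} (hh : ∀ n, Measurable (h n)) {S : ℝ}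
    (hS : 1 ≤ S) (hle : ∀ n, eLpNorm (h n) (ENNReal.ofReal S) volume ≤ (2⁻¹ : ℝ≥0∞) ^ n) :
    ∀ᵐ t, Tendsto (fun n => h n t) atTop (𝓝 0) := by
  have hS0 : 0 < S := by linarith
  have hint : ∀ n, ∫⁻ t, h n t ^ S ≤ (2⁻¹ : ℝ≥0∞) ^ n := by
    intro n
    have := hle n
    rw [eLpNorm_eq_lintegral_rpow_enorm_toReal (by simpa using hS0) ENNReal.ofReal_ne_top,
      ENNReal.toReal_ofReal hS0.le, one_div, ENNReal.rpow_inv_le_iff hS0] at this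
    simp only [enorm_eq_self] at this
    refine this.trans ?_
    calc ((2⁻¹ : ℝ≥0∞) ^ n) ^ S ≤ ((2⁻¹ : ℝ≥0∞) ^ n) ^ (1 : ℝ) :=
          ENNReal.rpow_le_rpow_of_exponent_ge (pow_le_one₀ zero_le (by norm_num)) hS
      _ = _ := ENNReal.rpow_one _
  have hsum : ∫⁻ t, ∑' n, h n t ^ S ≠ ∞ := by
    rw [lintegral_tsum fun n => ((hh n).pow_const S).aemeasurable]
    refine ne_top_of_le_ne_top ?_ (ENNReal.tsum_le_tsum hint)
    rw [ENNReal.tsum_geometric]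
    simp
  filter_upwards [ae_lt_top (Measurable.tsum fun n => (hh n).pow_const S) hsum] with t ht
  have h1 := ENNReal.tendsto_atTop_zero_of_tsum_ne_top ht.ne
  have h2 := h1.ennrpow_const S⁻¹
  rw [ENNReal.zero_rpow_of_pos (inv_pos.2 hS0)] at h2
  refine h2.congr fun n => ?_
  rw [← ENNReal.rpow_mul, mul_inv_cancel₀ hS0.ne', ENNReal.rpow_one]

theorem ae_lt_top_of_eLpNorm_lt_top {h : ℝ → ℝ≥0∞} (hh : Measurable h) {S : ℝ} (hS : 0 < S)
    (hlt : eLpNorm h (ENNReal.ofReal S) volume < ∞) : ∀ᵐ t, h t < ∞ := by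
  rw [eLpNorm_lt_top_iff_lintegral_rpow_enorm_lt_top (by simpa using hS) ENNReal.ofReal_ne_top,
    ENNReal.toReal_ofReal hS.le] at hlt
  simp only [enorm_eq_self] at hlt
  filter_upwards [ae_lt_top (hh.pow_const S) hlt.ne] with t ht
  exact (ENNReal.rpow_lt_top_iff_of_pos hS).1 ht

/-- F is approximated in L^A by continuous compactly supported maps. By Hardy–Littlewood–Sobolev the
fractional integrals of the errors have geometrically small L^S norms, so the continuous evolutions
converge almost everywhere to that of F. -/
theorem aestronglyMeasurable_evolve (h1 : 1 < P) (h2 : P < 2) (hR : 2 < R)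
    (hRP : 1 / R = 1 - 1 / P) (hδ0 : 0 < decayExp N R) (hδ : decayExp N R < 1) {A S : ℝ}
    (hS : 1 < S) (hSδ : 1 / S < decayExp N R) (hA : 1 / A = 1 - decayExp N R + 1 / S)
    {F : ℝ → lorentz N P q} (hF : StronglyMeasurable F)
    (hFA : MemLp F (ENNReal.ofReal A) volume) : AEStronglyMeasurable (evolve R F) volume := by
  obtain ⟨K, hK, hle⟩ := exists_eLpNorm_fracInt_le hδ0 hδ hS hSδ hA
  have happ : ∀ n : ℕ, ∃ g : ℝ → lorentz N P q, HasCompactSupport g ∧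
      eLpNorm (F - g) (ENNReal.ofReal A) volume ≤ (ENNReal.ofReal K)⁻¹ * (2⁻¹ : ℝ≥0∞) ^ n ∧
      Continuous g ∧ MemLp g (ENNReal.ofReal A) volume := fun n =>
    hFA.exists_hasCompactSupport_eLpNorm_sub_le ENNReal.ofReal_ne_top
      (mul_ne_zero (by simp) (by simp))
  choose g hgs hgn hgc hgm using happ
  have hgsm : ∀ n, StronglyMeasurable (g n) := fun n => (hgc n).stronglyMeasurable
  have hdm : ∀ n, Measurable fun s => ‖F s - g n s‖ₑ := fun n => (hF.sub (hgsm n)).enorm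
  have hsmall : ∀ n, eLpNorm (fracInt (decayExp N R) fun s => ‖F s - g n s‖ₑ)
      (ENNReal.ofReal S) volume ≤ (2⁻¹ : ℝ≥0∞) ^ n := fun n => by
    refine (hle _ (hdm n)).trans ?_
    calc _ ≤ ENNReal.ofReal K * ((ENNReal.ofReal K)⁻¹ * (2⁻¹ : ℝ≥0∞) ^ n) := by
          gcongr
          rw [eLpNorm_enorm]
          exact hgn n
      _ = _ := by
          rw [← mul_assoc, ENNReal.mul_inv_cancel (by simpa using hK) ENNReal.ofReal_ne_top, one_mul]
  have hlim := ae_tendsto_zero_of_eLpNorm_le (fun n => measurable_fracInt _ (hdm n)) hS.le hsmall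
  have hfin : ∀ᵐ t, fracInt (decayExp N R) (fun s => ‖F s‖ₑ) t < ∞ := by
    have hb := hle _ hF.enorm
    rw [eLpNorm_enorm] at hb
    exact ae_lt_top_of_eLpNorm_lt_top (measurable_fracInt _ hF.enorm) (by linarith)
      (hb.trans_lt (ENNReal.mul_lt_top ENNReal.ofReal_lt_top hFA.2))
  refine aestronglyMeasurable_of_tendsto_ae atTop (f := fun n => evolve R (g n))
    (fun n => (continuous_evolve h1 h2 hR hRP hδ (hgc n) (hgs n) (hgsm n)).aestronglyMeasurable) ?_
  filter_upwards [hlim, hfin] with t ht hft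
  rw [tendsto_iff_edist_tendsto_0]
  refine tendsto_of_tendsto_of_tendsto_of_le_of_le tendsto_const_nhds
    (h := fun n => ENNReal.ofReal (dispConst R) *
      fracInt (decayExp N R) (fun s => ‖F s - g n s‖ₑ) t) ?_ (fun _ => zero_le) fun n => ?_
  · simpa using ENNReal.Tendsto.const_mul (a := ENNReal.ofReal (dispConst R)) ht
      (Or.inr ENNReal.ofReal_ne_top)
  · rw [edist_comm, edist_eq_enorm_sub]
    exact enorm_evolve_sub_le h1 h2 hR hRP hF (hgsm n) hft (decayInt_lt_top hδ (hgc n) (hgs n) t)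

end TimeDependent

/-! ### Arithmetic of the exponents. -/

theorem conjExponent_ofReal {b : ℝ} (hb : 1 < b) :
    (ENNReal.ofReal b).conjExponent = ENNReal.ofReal (1 + (b - 1)⁻¹) := by
  have h : 0 < b - 1 := by linarith
  rw [ENNReal.conjExponent, ENNReal.ofReal_add zero_le_one (by positivity),
    ENNReal.ofReal_inv_of_pos h, ENNReal.ofReal_sub _ zero_le_one, ENNReal.ofReal_one]

/-- The exponents of the inhomogeneous Strichartz estimate, as real numbers. -/
structure StrichartzExponents (N : ℕ) (P R A S : ℝ) : Prop where
  one_lt_P : 1 < P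
  P_lt_two : P < 2
  two_lt_R : 2 < R
  inv_R : 1 / R = 1 - 1 / P
  one_le_A : 1 ≤ A
  one_lt_S : 1 < S
  inv_S_lt : 1 / S < decayExp N R
  inv_A : 1 / A = 1 - decayExp N R + 1 / S
  decayExp_lt : decayExp N R < 1

theorem exists_strichartzExponents {N : ℕ} (hN : 1 ≤ N) {r p σ σt : ℝ≥0∞}
    (hrp : Admissible N r p) (hp : p < ∞) (hr : 2 < r) (hσ : r / 2 < σ) (hσ' : σ < ∞)
    (hσt : 1 / σt + 1 / σ = 2 / r) :
    ∃ P R A S : ℝ, StrichartzExponents N P R A S ∧ p = ENNReal.ofReal R ∧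
      p.conjExponent = ENNReal.ofReal P ∧ σ = ENNReal.ofReal S ∧
      σt.conjExponent = ENNReal.ofReal A := by
  -- For r = ∞ no exponent σ could exceed r/2.
  have hr' : r ≠ ∞ := by
    rintro rfl
    rw [ENNReal.top_div_of_ne_top (by norm_num)] at hσ
    exact not_top_lt hσ
  lift r to NNReal using hr'
  lift p to NNReal using hp.ne
  lift σ to NNReal using hσ'.ne
  set a : ℝ := NNReal.toReal r with ha
  set R : ℝ := NNReal.toReal p with hR
  set S : ℝ := NNReal.toReal σ with hS
  have er : (r : ℝ≥0∞) = ENNReal.ofReal a := by simp [ha]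
  have ep : (p : ℝ≥0∞) = ENNReal.ofReal R := by simp [hR]
  have eσ : (σ : ℝ≥0∞) = ENNReal.ofReal S := by simp [hS]
  have ha2 : 2 < a := by exact_mod_cast hr
  have hR2 : 2 ≤ R := by exact_mod_cast hrp.two_le
  have ha0 : 0 < a := by linarith
  have hR0 : 0 < R := by linarith
  have hNpos : (0 : ℝ) < N := by exact_mod_cast hN
  have haS : a / 2 < S := by
    have e2 : (2 : ℝ≥0∞) = ENNReal.ofReal 2 := by simp
    rw [er, eσ, e2, ← ENNReal.ofReal_div_of_pos two_pos,
      ENNReal.ofReal_lt_ofReal_iff_of_nonneg (by positivity)] at hσ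
    exact hσ
  have hS1 : 1 < S := by linarith
  have hS0 : 0 < S := by linarith
  have hscal : 2 / a + N / R = N / 2 := by
    have h := congrArg ENNReal.toReal hrp.scaling
    rw [ENNReal.toReal_add (ENNReal.div_ne_top (by simp) (by rw [er]; simpa using ha0))
      (ENNReal.div_ne_top (by simp) (by rw [ep]; simpa using hR0))] at h
    simpa using h
  have hδ : decayExp N R = 2 / a := by
    rw [decayExp]
    have : (N : ℝ) * (1 / 2 - 1 / R) = N / 2 - N / R := by ring
    linarith
  have hδ1 : 2 / a < 1 := by rw [div_lt_one ha0]; exact ha2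
  have hδ0 : 0 < 2 / a := by positivity
  -- The value p = 2 would force 2/r = 0, impossible for finite r.
  have hR2' : 2 < R := by
    refine lt_of_le_of_ne hR2 fun h => ?_
    rw [← h] at hscal
    linarith
  have hSδ : 1 / S < 2 / a := by
    rw [div_lt_div_iff₀ hS0 ha0]
    linarith
  -- This is σ̃; since 0 < 2/r - 1/σ < 1, it is finite and larger than 1.
  set b : ℝ := (2 / a - 1 / S)⁻¹ with hb
  have hd : 0 < 2 / a - 1 / S := by linarith
  have hd1 : 2 / a - 1 / S < 1 := by
    have : 0 < 1 / S := by positivity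
    linarith
  have hb1 : 1 < b := (one_lt_inv₀ hd).2 hd1
  have eσt : σt = ENNReal.ofReal b := by
    have e2 : (2 : ℝ≥0∞) = ENNReal.ofReal 2 := by simp
    rw [er, eσ, e2, ← ENNReal.ofReal_div_of_pos ha0, ← ENNReal.ofReal_one,
      ← ENNReal.ofReal_div_of_pos hS0] at hσt
    have h := ENNReal.eq_sub_of_add_eq ENNReal.ofReal_ne_top hσt
    rw [← ENNReal.ofReal_sub _ (by positivity), ENNReal.ofReal_one, one_div] at h
    rw [hb, ENNReal.ofReal_inv_of_pos hd, ← h, inv_inv]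
  have hP : 0 < R - 1 := by linarith
  have hb1' : 0 < b - 1 := by linarith
  refine ⟨1 + (R - 1)⁻¹, R, 1 + (b - 1)⁻¹, S, ⟨?_, ?_, hR2', ?_, ?_, hS1, ?_, ?_, ?_⟩, ep, ?_, eσ, ?_⟩
  · have : 0 < (R - 1)⁻¹ := by positivity
    linarith
  · have : (R - 1)⁻¹ < 1 := inv_lt_one_of_one_lt₀ (by linarith)
    linarith
  · have : R - 1 + 1 ≠ 0 := by linarith
    field_simp
    ring
  · have : 0 < (b - 1)⁻¹ := by positivity
    linarith
  · rw [hδ]; exact hSδ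
  · have e1 : 1 / (1 + (b - 1)⁻¹) = 1 - b⁻¹ := by
      have : b - 1 + 1 ≠ 0 := by linarith
      have : b ≠ 0 := by linarith
      field_simp
      ring
    rw [e1, hb, inv_inv, hδ]
    ring
  · rw [hδ]; exact hδ1
  · rw [ep, conjExponent_ofReal (by linarith)]
  · rw [eσt, conjExponent_ofReal hb1]

/-! ### Transfer to Bochner spaces and the final estimate. -/

section Duhamel

variable {N : ℕ} {P R : ℝ} {q : ℝ≥0∞} [hq : Fact (1 ≤ q)] [hP : Fact (1 ≤ P)] [hR' : Fact (1 ≤ R)]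

theorem measurableSet_timeInterval (T : EReal) : MeasurableSet (timeInterval T) := by
  have h : Continuous fun t : ℝ => (t : EReal) := continuous_coe_real_ereal
  exact (measurableSet_Ioi (a := (0 : ℝ))).inter (measurableSet_lt h.measurable measurable_const)

open Classical in
/-- A function as an element of the Lorentz space (zero if it does not belong to it). -/
def toLorentz (P : ℝ) (q : ℝ≥0∞) [Fact (1 ≤ q)] (φ : Fn N) : lorentz N P q :=
  if h : fnorm P q φ < ∞ then ⟨φ, h⟩ else 0

theorem toLorentz_coe {φ : Fn N} (h : fnorm P q φ < ∞) : (toLorentz P q φ : Fn N) = φ := by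
  rw [toLorentz, dif_pos h]

theorem lorentzNorm_ofReal_le (hP1 : 1 < P) (φ : Fn N) :
    lorentzNorm (ENNReal.ofReal P) q φ ≤ fnorm P q φ := by
  have := lorentzNorm_le_fnorm (p := ENNReal.ofReal P) (by simp; linarith)
    ENNReal.ofReal_ne_top hq.out φ
  rwa [ENNReal.toReal_ofReal (by linarith)] at this

theorem fnorm_le_lorentzNorm_ofReal (hP1 : 1 < P) (φ : Fn N) :
    fnorm P q φ ≤ ENNReal.ofReal (1 / (1 - 1 / P)) * lorentzNorm (ENNReal.ofReal P) q φ := by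
  have := fnorm_le_lorentzNorm (p := ENNReal.ofReal P)
    (by rw [← ENNReal.ofReal_one]; exact (ENNReal.ofReal_lt_ofReal_iff (by linarith)).2 hP1)
    ENNReal.ofReal_ne_top hq.out φ
  rwa [ENNReal.toReal_ofReal (by linarith)] at this

/-- A function of the Bochner space agrees almost everywhere with a strongly measurable map into
the Lorentz space vanishing outside the time interval. -/
theorem MemBochner.exists_stronglyMeasurable (hP1 : 1 < P) {a : ℝ≥0∞} {T : EReal} {f : ℝ → Fn N}
    (hf : MemBochner a T (ENNReal.ofReal P) q f) :
    ∃ F : ℝ → lorentz N P q, StronglyMeasurable F ∧ (∀ t ∉ timeInterval T, F t = 0) ∧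
      (∀ᵐ t ∂(volume.restrict (timeInterval T)), (F t : Fn N) = f t) ∧
      eLpNorm F a volume ≤
        ENNReal.ofReal (1 / (1 - 1 / P)) * bochnerNorm a T (ENNReal.ofReal P) q f := by
  obtain ⟨S, hS, hlim⟩ := hf.stronglyMeasurable
  have hI := measurableSet_timeInterval T
  have hSf : ∀ n t, fnorm P q (S n t) < ∞ := fun n t =>
    (fnorm_le_lorentzNorm_ofReal hP1 _).trans_lt (ENNReal.mul_lt_top ENNReal.ofReal_lt_top (hS n t))
  -- Almost every f(t) is within distance 1 of some simple approximation, which has finite norm.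
  have hmem : ∀ᵐ t ∂(volume.restrict (timeInterval T)), fnorm P q (f t) < ∞ := by
    filter_upwards [hlim] with t ht
    obtain ⟨n, hn⟩ := (ht.eventually_lt_const (show (0 : ℝ≥0∞) < 1 by simp)).exists
    have e : f t = (f t - S n t) + S n t := (sub_add_cancel _ _).symm
    rw [e]
    refine (fnorm_add_le hq.out _ _).trans_lt (ENNReal.add_lt_top.2 ⟨?_, hSf n t⟩)
    exact (fnorm_le_lorentzNorm_ofReal hP1 _).trans_lt
      (ENNReal.mul_lt_top ENNReal.ofReal_lt_top (hn.trans ENNReal.one_lt_top))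
  have hF0 : AEStronglyMeasurable (fun t => toLorentz P q (f t))
      (volume.restrict (timeInterval T)) := by
    refine aestronglyMeasurable_of_tendsto_ae atTop
      (f := fun n t => ((S n).map (toLorentz P q)) t)
      (fun n => (SimpleFunc.stronglyMeasurable _).aestronglyMeasurable) ?_
    filter_upwards [hlim, hmem] with t ht hft
    rw [tendsto_iff_edist_tendsto_0]
    have h0 : Tendsto (fun n => ENNReal.ofReal (1 / (1 - 1 / P)) *
        lorentzNorm (ENNReal.ofReal P) q (f t - S n t)) atTop (𝓝 0) := by
      simpa using ENNReal.Tendsto.const_mul (a := ENNReal.ofReal (1 / (1 - 1 / P))) ht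
        (Or.inr ENNReal.ofReal_ne_top)
    refine tendsto_of_tendsto_of_tendsto_of_le_of_le tendsto_const_nhds h0
      (fun _ => zero_le) fun n => ?_
    simp only [SimpleFunc.map_apply]
    rw [edist_comm, edist_eq_enorm_sub, lorentz_enorm_def, Submodule.coe_sub, toLorentz_coe hft,
      toLorentz_coe (hSf n t)]
    exact fnorm_le_lorentzNorm_ofReal hP1 _
  refine ⟨(timeInterval T).indicator (hF0.mk _), hF0.stronglyMeasurable_mk.indicator hI,
    fun t ht => indicator_of_notMem ht _, ?_, ?_⟩
  · filter_upwards [hF0.ae_eq_mk, hmem, ae_restrict_mem hI] with t h1 h2 h3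
    rw [indicator_of_mem h3, ← h1, toLorentz_coe h2]
  · rw [eLpNorm_indicator_eq_eLpNorm_restrict hI, ← eLpNorm_congr_ae hF0.ae_eq_mk, bochnerNorm]
    refine eLpNorm_le_nnreal_smul_eLpNorm_of_ae_le_mul' (c := (1 / (1 - 1 / P)).toNNReal) ?_ a
    filter_upwards [hmem] with t ht
    rw [lorentz_enorm_def, toLorentz_coe ht, enorm_eq_self]
    exact fnorm_le_lorentzNorm_ofReal hP1 _

theorem duhamelIntegrand_eq (h1 : 1 < P) (h2 : P < 2) {f : ℝ → Fn N} {s : ℝ} (g : lorentz N P q)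
    (hg : (g : Fn N) = f s) (t : ℝ) (ψ : 𝓢(Space N, ℂ)) :
    duhamelIntegrand f t ψ s = pair (propagate N (t - s) ψ) g := by
  rw [duhamelIntegrand, schrodinger_apply, ← hg, (represents_toTempered h1 h2 g _).2, pair]

theorem pair_zero_right (w : 𝓢(Space N, ℂ)) : pair w (0 : lorentz N P q) = 0 := by
  rw [pair]
  refine integral_eq_zero_of_ae ?_
  filter_upwards [AEEqFun.coeFn_zero (α := Space N) (β := ℂ) (μ := volume)] with x hx
  rw [Submodule.coe_zero, hx]
  simp

section Lift

variable {T : EReal} {f : ℝ → Fn N} {F : ℝ → lorentz N P q}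

theorem ae_duhamelIntegrand_eq (h1 : 1 < P) (h2 : P < 2)
    (hfF : ∀ᵐ t ∂(volume.restrict (timeInterval T)), (F t : Fn N) = f t) {t : ℝ}
    (htT : (t : EReal) < T) (ψ : 𝓢(Space N, ℂ)) :
    ∀ᵐ s ∂(volume.restrict (Ioc 0 t)),
      duhamelIntegrand f t ψ s = pair (propagate N (t - s) ψ) (F s) := by
  have hsub : Ioc 0 t ⊆ timeInterval T := fun s hs =>
    ⟨hs.1, (EReal.coe_le_coe_iff.2 hs.2).trans_lt htT⟩
  filter_upwards [ae_mono (Measure.restrict_mono hsub le_rfl) hfF] with s hs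
  exact duhamelIntegrand_eq h1 h2 (F s) hs t ψ

/-- Pairing with a propagated Schwartz function is bounded uniformly in time, and L^A is locally in
L¹. No dispersive decay is used, so the result holds at every t and not only almost every t. -/
theorem intervalIntegrable_duhamelIntegrand (h1 : 1 < P) (h2 : P < 2) (hF : StronglyMeasurable F)
    {A : ℝ} (hA : 1 ≤ A) (hFA : MemLp F (ENNReal.ofReal A) volume)
    (hfF : ∀ᵐ t ∂(volume.restrict (timeInterval T)), (F t : Fn N) = f t) {t : ℝ} (ht : 0 ≤ t)
    (htT : (t : EReal) < T) (ψ : 𝓢(Space N, ℂ)) :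
    IntervalIntegrable (duhamelIntegrand f t ψ) volume 0 t := by
  rw [intervalIntegrable_iff_integrableOn_Ioc_of_le ht]
  refine Integrable.congr ?_ ((ae_duhamelIntegrand_eq h1 h2 hfF htT ψ).mono fun s hs => hs.symm)
  obtain ⟨C, hC, hb⟩ := norm_pair_propagate_le (N := N) (P := P) (q := q) h1 h2 ψ
  have hFi : Integrable F (volume.restrict (Ioc 0 t)) :=
    (hFA.restrict (Ioc 0 t)).integrable (by simpa using hA)
  have hm : StronglyMeasurable fun s => pair (propagate N (t - s) ψ) (F s) := by
    have hp : StronglyMeasurable fun s : ℝ => (t - s, F s) :=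
      (continuous_const.sub continuous_id).stronglyMeasurable.prodMk hF
    have := Continuous.comp_stronglyMeasurable (f := fun s : ℝ => (t - s, F s))
      (g := fun z : ℝ × lorentz N P q => pair (propagate N z.1 ψ) z.2)
      (continuous_pair_propagate h1 h2 ψ) hp
    exact this
  exact Integrable.mono' (hFi.norm.const_mul C) hm.aestronglyMeasurable
    (Eventually.of_forall fun s => hb _ _)

/-- Substitute τ = t - s. As F vanishes at negative times, the integral over (0, t) extends to the
whole half-line. -/
theorem duhamel_eq_retarded (h1 : 1 < P) (h2 : P < 2) (hF0 : ∀ t ∉ timeInterval T, F t = 0)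
    (hfF : ∀ᵐ t ∂(volume.restrict (timeInterval T)), (F t : Fn N) = f t) {t : ℝ}
    (ht : t ∈ timeInterval T) : duhamel f t = retarded fun τ => F (t - τ) := by
  funext ψ
  have e1 : duhamel f t ψ = ∫ s in (0 : ℝ)..t, pair (propagate N (t - s) ψ) (F s) := by
    rw [duhamel, intervalIntegral.integral_of_le ht.1.le, intervalIntegral.integral_of_le ht.1.le]
    exact integral_congr_ae (ae_duhamelIntegrand_eq h1 h2 hfF ht.2 ψ)
  have e2 : (∫ s in (0 : ℝ)..t, pair (propagate N (t - s) ψ) (F s)) =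
      ∫ τ in (0 : ℝ)..t, pair (propagate N τ ψ) (F (t - τ)) := by
    have := intervalIntegral.integral_comp_sub_left (a := 0) (b := t)
      (fun τ => pair (propagate N τ ψ) (F (t - τ))) t
    simpa using this
  rw [e1, e2, intervalIntegral.integral_of_le ht.1.le, retarded]
  refine (setIntegral_eq_of_subset_of_forall_sdiff_eq_zero measurableSet_Ioi
    (fun τ hτ => hτ.1) fun τ hτ => ?_).symm
  have hlt : t < τ := by
    by_contra h
    exact hτ.2 ⟨hτ.1, not_lt.1 h⟩
  rw [hF0 (t - τ) fun h => by linarith [h.1], pair_zero_right]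

end Lift

theorem memBochner_of_aestronglyMeasurable (hR1 : 1 < R) {a : ℝ≥0∞} {T : EReal}
    {u : ℝ → lorentz N R q} (hu : AEStronglyMeasurable u volume) (hfin : eLpNorm u a volume < ∞) :
    MemBochner a T (ENNReal.ofReal R) q (fun t => (u t : Fn N)) ∧
      bochnerNorm a T (ENNReal.ofReal R) q (fun t => (u t : Fn N)) ≤ eLpNorm u a volume := by
  have hle : bochnerNorm a T (ENNReal.ofReal R) q (fun t => (u t : Fn N)) ≤ eLpNorm u a volume := by
    refine le_trans (eLpNorm_mono_enorm fun t => ?_)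
      (eLpNorm_mono_measure u (Measure.restrict_le_self (s := timeInterval T)))
    rw [enorm_eq_self, lorentz_enorm_def]
    exact lorentzNorm_ofReal_le hR1 _
  refine ⟨⟨⟨fun n => (hu.stronglyMeasurable_mk.approx n).map Subtype.val, fun n t => ?_, ?_⟩,
    hle.trans_lt hfin⟩, hle⟩
  · exact (lorentzNorm_ofReal_le hR1 _).trans_lt (hu.stronglyMeasurable_mk.approx n t).2
  · filter_upwards [ae_restrict_of_ae hu.ae_eq_mk] with t ht
    have h0 := tendsto_iff_edist_tendsto_0.1 (hu.stronglyMeasurable_mk.tendsto_approx t)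
    refine tendsto_of_tendsto_of_tendsto_of_le_of_le tendsto_const_nhds h0
      (fun _ => zero_le) fun n => ?_
    simp only [SimpleFunc.map_apply]
    rw [edist_comm, edist_eq_enorm_sub, ← ht, lorentz_enorm_def, Submodule.coe_sub]
    exact lorentzNorm_ofReal_le hR1 _

/-- The inhomogeneous Strichartz estimate with real exponents. -/
theorem exists_duhamel_estimate {A S : ℝ} (hE : StrichartzExponents N P R A S) :
    ∃ C : ℝ, 0 < C ∧ ∀ T : EReal, ∀ f : ℝ → Fn N,
      MemBochner (ENNReal.ofReal A) T (ENNReal.ofReal P) q f →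
        (∀ t : ℝ, 0 ≤ t → (t : EReal) < T → ∀ ψ : 𝓢(Space N, ℂ),
          IntervalIntegrable (duhamelIntegrand f t ψ) volume 0 t) ∧
        ∃ u : ℝ → Fn N,
          (∀ᵐ t ∂(volume.restrict (timeInterval T)), Represents (u t) (duhamel f t)) ∧
          MemBochner (ENNReal.ofReal S) T (ENNReal.ofReal R) q u ∧
          bochnerNorm (ENNReal.ofReal S) T (ENNReal.ofReal R) q u ≤
            ENNReal.ofReal C * bochnerNorm (ENNReal.ofReal A) T (ENNReal.ofReal P) q f := by
  have hP1 := hE.one_lt_P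
  have hP2 := hE.P_lt_two
  have hR2 := hE.two_lt_R
  have hRP := hE.inv_R
  have hS := hE.one_lt_S
  have hδ0 : 0 < decayExp N R := lt_trans (by positivity) hE.inv_S_lt
  have hc : 0 < 1 / (1 - 1 / P) := one_div_pos.2 (one_sub_inv_pos hP1)
  obtain ⟨K, hK, hle⟩ := exists_eLpNorm_fracInt_le hδ0 hE.decayExp_lt hS hE.inv_S_lt hE.inv_A
  have hdc := dispConst_pos hR2
  -- Product of the dispersive, Hardy–Littlewood–Sobolev and Hardy constants. It is independent of T
  -- because f is extended by zero to the whole line.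
  refine ⟨dispConst R * K * (1 / (1 - 1 / P)), by positivity, fun T f hf => ?_⟩
  obtain ⟨F, hF, hF0, hfF, hFn⟩ := hf.exists_stronglyMeasurable hP1
  have hFA : MemLp F (ENNReal.ofReal A) volume := ⟨hF.aestronglyMeasurable,
    hFn.trans_lt (ENNReal.mul_lt_top ENNReal.ofReal_lt_top hf.norm_lt_top)⟩
  refine ⟨fun t ht htT ψ =>
    intervalIntegrable_duhamelIntegrand hP1 hP2 hF hE.one_le_A hFA hfF ht htT ψ, ?_⟩
  have hfrac : eLpNorm (fracInt (decayExp N R) fun s => ‖F s‖ₑ) (ENNReal.ofReal S) volume ≤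
      ENNReal.ofReal K * eLpNorm F (ENNReal.ofReal A) volume := by
    have := hle _ hF.enorm
    rwa [eLpNorm_enorm] at this
  have hu := aestronglyMeasurable_evolve hP1 hP2 hR2 hRP hδ0 hE.decayExp_lt hS hE.inv_S_lt hE.inv_A
    hF hFA
  have hun : eLpNorm (evolve R F) (ENNReal.ofReal S) volume ≤
      ENNReal.ofReal (dispConst R) * (ENNReal.ofReal K * eLpNorm F (ENNReal.ofReal A) volume) := by
    refine le_trans ?_ (mul_le_mul_right hfrac _)
    refine eLpNorm_le_nnreal_smul_eLpNorm_of_ae_le_mul' (c := (dispConst R).toNNReal)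
      (Eventually.of_forall fun t => ?_) _
    rw [enorm_eq_self]
    exact enorm_evolve_le hP1 hP2 hR2 hRP hF t
  obtain ⟨hmem, hnorm⟩ := memBochner_of_aestronglyMeasurable (T := T) (by linarith : 1 < R) hu
    (hun.trans_lt (ENNReal.mul_lt_top ENNReal.ofReal_lt_top
      (ENNReal.mul_lt_top ENNReal.ofReal_lt_top hFA.2)))
  refine ⟨fun t => (evolve R F t : Fn N), ?_, hmem, ?_⟩
  · have hfin := ae_lt_top_of_eLpNorm_lt_top (measurable_fracInt (decayExp N R) hF.enorm)
      (by linarith : 0 < S) (hfrac.trans_lt (ENNReal.mul_lt_top ENNReal.ofReal_lt_top hFA.2))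
    filter_upwards [ae_restrict_of_ae hfin, ae_restrict_mem (measurableSet_timeInterval T)]
      with t ht htT
    rw [duhamel_eq_retarded hP1 hP2 hF0 hfF htT]
    exact (isRep_evolve hP1 hP2 hR2 hRP hF ht).represents
  · calc _ ≤ ENNReal.ofReal (dispConst R) * (ENNReal.ofReal K *
          eLpNorm F (ENNReal.ofReal A) volume) := hnorm.trans hun
      _ ≤ ENNReal.ofReal (dispConst R) * (ENNReal.ofReal K * (ENNReal.ofReal (1 / (1 - 1 / P)) *
          bochnerNorm (ENNReal.ofReal A) T (ENNReal.ofReal P) q f)) := by gcongr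
      _ = _ := by
          rw [ENNReal.ofReal_mul (by positivity), ENNReal.ofReal_mul hdc.le]
          ring

end Duhamel

end NLS

end

theorem proposition2p3 (N : ℕ) (hN : 1 ≤ N) (r p q σ σt : ℝ≥0∞)
    (hrp : NLS.Admissible N r p) (hp : p < ∞) (hr : 2 < r) (hq : 1 ≤ q)
    (hσ : r / 2 < σ) (hσ' : σ < ∞) (hσt : 1 / σt + 1 / σ = 2 / r) :
    ∃ C : ℝ, 0 < C ∧ ∀ T : EReal, 0 < T →
      ∀ f : ℝ → NLS.Fn N, NLS.MemBochner σt.conjExponent T p.conjExponent q f →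
        (∀ t : ℝ, 0 ≤ t → (t : EReal) < T → ∀ ψ : 𝓢(NLS.Space N, ℂ),
          IntervalIntegrable (NLS.duhamelIntegrand f t ψ) volume 0 t) ∧
        ∃ u : ℝ → NLS.Fn N,
          (∀ᵐ t ∂(volume.restrict (NLS.timeInterval T)),
            NLS.Represents (u t) (NLS.duhamel f t)) ∧
          NLS.MemBochner σ T p q u ∧
          NLS.bochnerNorm σ T p q u ≤
            ENNReal.ofReal C * NLS.bochnerNorm σt.conjExponent T p.conjExponent q f := by
  obtain ⟨P, R, A, S, hE, ep, ep', eσ, eσt⟩ :=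
    NLS.exists_strichartzExponents hN hrp hp hr hσ hσ' hσt
  have : Fact (1 ≤ q) := ⟨hq⟩
  have : Fact (1 ≤ P) := ⟨hE.one_lt_P.le⟩
  have : Fact (1 ≤ R) := ⟨by linarith [hE.two_lt_R]⟩
  obtain ⟨C, hC, h⟩ := NLS.exists_duhamel_estimate (q := q) hE
  rw [ep', eσt, ep, eσ]
  exact ⟨C, hC, fun T _ f hf => h T f hf⟩
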